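/- **Theorem (Reduction Theorem).** Let $G$ be a connected negative definite plumbing tree with finite non-empty vertex set $\mathcal J$ and all genera zero, and let $L=\mathbb Z\langle E_j\rangle_{j\in\mathcal J}$ be its lattice with intersection form $(\cdot,\cdot)$: $(E_j,E_j)=e_j$ is the Euler number of $j$, and for $i\neq j$, $(E_i,E_j)$ is $1$ if $i,j$ are adjacent and $0$ otherwise. Let $L'=\{l'\in L\otimes\mathbb Q: (l',L)\subseteq\mathbb Z\}$, let $\le$ be the coefficientwise order on $L\otimes\mathbb Q$, let $k_{can}\in L'$ be defined by $(k_{can},E_j)=-e_j-2$ for all $j$, and let $Char=\{k\in L' : (k,x)+(x,x)\in 2\mathbb Z \text{ for all } x\in L\}=k_{can}+2L'$. For $k\in Char$ put $\chi_k(l)=-(l,l+k)/2$ for $l\in L$. Fix a class $[k]=k+2L=k_{can}+2(l'+L)$ with $k\in Char$, $l'\in L'$. Let $l'_{[k]}$ be the unique minimal element of $\{y\in l'+L : (y,E_j)\le 0 \text{ for all } j\in\mathcal J\}$, and let $k_r=k_{can}+2l'_{[k]}$ be the distinguished representative of $[k]$. A connected negative definite plumbing tree is called rational if $\chi_{k_{can}}(l)>0$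 for all $l\in L$ with $l>0$ (that is, $l\geq 0$ and $l\neq 0$). Let $\overline{\mathcal J}\subseteq\mathcal J$ be a (not necessarily minimal) set of $\nu$ bad vertices: there are integers $e'_j\le e_j$ for $j\in\overline{\mathcal J}$ such that replacing $e_j$ by $e'_j$ for all $j\in\overline{\mathcal J}$ turns $G$ into a rational graph. For $\mathbf i\in(\mathbb Z_{\ge0})^\nu=(\mathbb Z_{\ge 0})^{\overline{\mathcal J}}$ let $x(\mathbf i)\in L$ be the minimal element among the $x\in L$ whose coefficient at $E_j$ is $i_j$ for every $j\in\overline{\mathcal J}$ and which satisfy $(x+l'_{[k]},E_j)\le 0$ for every $j\in\mathcal J\setminus\overline{\mathcal J}$; set $\overline w(\mathbf i)=\chi_{k_r}(x(\mathbf i))$. For an integer-valued weight function $w$ on the lattice points of $\mathbb R^s$ (or of $[0,\infty)^s$), such that for each integer $N$ only finitely many points have weight at most $N$, recall the lattice cohomology $\mathbb H^*$. The $q$-cubes are the pairs $(l,I)$ of a lattice point $l$ and a set $I$ of $q$ coordinate directions, with vertices $l+\sum_{j\in I'}E_j$, $I'\subseteq I$; the weight of a cube is the maximum of $w$ at its vertices.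 Let $\mathcal T^+_0=\mathbb Z[U,U^{-1}]/U\mathbb Z[U]$, graded by $\deg U^{-d}=2d$, let $\mathcal F^q=\operatorname{Hom}_{\mathbb Z}(\mathcal C_q,\mathcal T^+_0)$, where $\mathcal C_q$ is the free abelian group on the oriented $q$-cubes, and let $(\delta_w\phi)(\square)=\sum_m\varepsilon_m U^{w(\square)-w(\square_m)}\phi(\square_m)$ for $\partial\square=\sum_m\varepsilon_m\square_m$. A cochain $\phi$ is homogeneous of degree $d$ if each $\phi(\square)$ is zero or homogeneous of degree $d-2w(\square)$. Then $\mathbb H^q$ is the $q$-th cohomology of $(\mathcal F^*,\delta_w)$, with the induced $\mathbb Z[U]$-action and grading. Write $\mathbb H^*(G,k_r)$ for the lattice cohomology of all of $L$ with $w=\chi_{k_r}$, and $\mathbb H^*((\mathbb Z_{\ge0})^\nu,\overline w)$ for that of the cubes of $[0,\infty)^\nu$ with weight function $\overline w$. Then there is an isomorphism of graded $\mathbb Z[U]$-modules $$\mathbb H^*(G,k_r)\cong\mathbb H^*((\mathbb Z_{\ge0})^\nu,\overline w).$$ -/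

import Mathlib

open Polynomial

/-! # Lattice cohomology of a free module with a fixed ordered basis and a weight function -/

namespace LatticeCohomology

/-- The graded `ℤ[U]`-module `𝒯₀⁺ = ℤ[U, U⁻¹] / U·ℤ[U]`.  The polynomial ring `ℤ[X]` plays the
role of `ℤ[U]`, and `LaurentPolynomial.T n` is `Uⁿ`. -/
abbrev TPlus : Type :=
  LaurentPolynomial ℤ ⧸
    (Submodule.span ℤ[X] {(LaurentPolynomial.T 1 : LaurentPolynomial ℤ)})

/-- The class of `Uⁿ` in `𝒯₀⁺` (it is zero for `n > 0`). -/
noncomputable def TPlus.ofPow (n : ℤ) : TPlus :=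
  Submodule.Quotient.mk (LaurentPolynomial.T n : LaurentPolynomial ℤ)

/-- The homogeneous elements of degree `d` of `𝒯₀⁺`, where `deg U⁻ⁿ = 2n`. -/
noncomputable def TPlus.homogeneous (d : ℤ) : AddSubgroup TPlus :=
  AddSubgroup.closure {t | ∃ n : ℤ, 2 * n = d ∧ t = TPlus.ofPow (-n)}

/-- A `q`-dimensional cube `(l, I)`: it has the vertices `l + ∑_{j ∈ I'} E_j`, `I' ⊆ I`.
Lattice points have coordinates in `R`; the value `R = ℤ` gives all the cubes of `ℝ^ι`, and
`R = ℕ` gives the cubes of the first quadrant `[0,∞)^ι`. -/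
structure Cube (ι R : Type*) (q : ℕ) where
  /-- the lowest vertex `l` -/
  base : ι → R
  /-- the set `I` of directions -/
  dirs : Finset ι
  card_dirs : dirs.card = q

variable {ι R : Type*} [LinearOrder ι] [AddMonoidWithOne R]

/-- The lattice point `l + ∑_{j ∈ I} E_j`. -/
def translate (l : ι → R) (I : Finset ι) : ι → R :=
  fun j => if j ∈ I then l j + 1 else l j

/-- The weight of a cube: the maximum of the weights of its vertices. -/
def Cube.weight {q : ℕ} (w : (ι → R) → ℤ) (c : Cube ι R q) : ℤ :=
  c.dirs.powerset.sup' (Finset.powerset_nonempty _) fun I' => w (translate c.base I')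

/-- The face `(l, I ∖ {j})` of the cube `(l, I)`. -/
def Cube.lowerFace {q : ℕ} (c : Cube ι R (q + 1)) (j : ι) (hj : j ∈ c.dirs) : Cube ι R q where
  base := c.base
  dirs := c.dirs.erase j
  card_dirs := by rw [Finset.card_erase_of_mem hj, c.card_dirs]; rfl

/-- The face `(l + E_j, I ∖ {j})` of the cube `(l, I)`. -/
def Cube.upperFace {q : ℕ} (c : Cube ι R (q + 1)) (j : ι) (hj : j ∈ c.dirs) : Cube ι R q where
  base := translate c.base {j}
  dirs := c.dirs.erase j
  card_dirs := by rw [Finset.card_erase_of_mem hj, c.card_dirs]; rfl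

/-- The weight of a cube is at least the weight of each of its lower faces. -/
theorem Cube.weight_lowerFace_le {q : ℕ} (w : (ι → R) → ℤ) (c : Cube ι R (q + 1)) (j : ι)
    (hj : j ∈ c.dirs) : (c.lowerFace j hj).weight w ≤ c.weight w := by
  refine Finset.sup'_le _ _ fun I' hI' => ?_
  have h : I' ∈ c.dirs.powerset := by
    rw [Finset.mem_powerset] at hI' ⊢
    exact hI'.trans (Finset.erase_subset _ _)
  exact Finset.le_sup' (fun I' => w (translate c.base I')) h

/-- The weight of a cube is at least the weight of each of its upper faces. -/
theorem Cube.weight_upperFace_le {q : ℕ} (w : (ι → R) → ℤ) (c : Cube ι R (q + 1)) (j : ι)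
    (hj : j ∈ c.dirs) : (c.upperFace j hj).weight w ≤ c.weight w := by
  refine Finset.sup'_le _ _ fun I' hI' => ?_
  have hI : I' ⊆ c.dirs.erase j := Finset.mem_powerset.mp hI'
  have h : insert j I' ∈ c.dirs.powerset := by
    rw [Finset.mem_powerset]
    exact Finset.insert_subset hj (hI.trans (Finset.erase_subset _ _))
  have e : translate (c.upperFace j hj).base I' = translate c.base (insert j I') := by
    funext v
    by_cases hv : v = j
    · subst hv
      have : v ∉ I' := fun hm => by simpa using hI hm
      simp [translate, Cube.upperFace, this]
    · simp [translate, Cube.upperFace, hv]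
  rw [e]
  exact Finset.le_sup' (fun I' => w (translate c.base I')) h

/-- The orientation sign `(-1)^(number of elements of I below j)` of the face in direction `j`. -/
def Cube.sign {q : ℕ} (c : Cube ι R q) (j : ι) : ℤ :=
  (-1) ^ (c.dirs.filter (· < j)).card

/-- The `ℤ[U]`-module `ℱ^q = Hom_ℤ(𝒞_q, 𝒯₀⁺)`; since `𝒞_q` is freely generated by the `q`-cubes,
its elements are the functions from the set of `q`-cubes to `𝒯₀⁺`. -/
abbrev Cochain (ι R : Type*) (q : ℕ) : Type _ := Cube ι R q → TPlus

/-- The coboundary `δ_w : ℱ^q → ℱ^{q+1}`,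
`(δ_w φ)(□) = ∑_k ε_k U^{w(□) - w(□_k)} φ(□_k)`, the sum over the oriented faces of `□`.
The exponents are nonnegative. -/
noncomputable def coboundary (w : (ι → R) → ℤ) (q : ℕ) :
    Cochain ι R q →ₗ[ℤ[X]] Cochain ι R (q + 1) where
  toFun φ c := ∑ j : c.dirs, c.sign j.1 •
    ((X : ℤ[X]) ^ (c.weight w - (c.upperFace j.1 j.2).weight w).toNat • φ (c.upperFace j.1 j.2)
      - (X : ℤ[X]) ^ (c.weight w - (c.lowerFace j.1 j.2).weight w).toNat •
        φ (c.lowerFace j.1 j.2))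
  map_add' φ ψ := by
    funext c
    rw [Pi.add_apply, ← Finset.sum_add_distrib]
    refine Finset.sum_congr rfl fun j _ => ?_
    simp only [Pi.add_apply]
    rw [smul_add (_ ^ _), smul_add (_ ^ _), add_sub_add_comm, smul_add]
  map_smul' p φ := by
    funext c
    rw [Pi.smul_apply, Finset.smul_sum]
    refine Finset.sum_congr rfl fun j _ => ?_
    simp only [Pi.smul_apply, RingHom.id_apply]
    rw [smul_comm p (c.sign j.1), smul_sub p, smul_comm p (_ ^ _), smul_comm p (_ ^ _)]

/-- The cocycles in `ℱ^q`. -/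
noncomputable def cocycles (w : (ι → R) → ℤ) (q : ℕ) : Submodule ℤ[X] (Cochain ι R q) :=
  LinearMap.ker (coboundary w q)

/-- The coboundaries in `ℱ^q`. -/
noncomputable def coboundaries (w : (ι → R) → ℤ) : (q : ℕ) → Submodule ℤ[X] (Cochain ι R q)
  | 0 => ⊥
  | q + 1 => LinearMap.range (coboundary w q)

/-- The lattice cohomology `ℍ^q`, as a `ℤ[U]`-module. -/
abbrev Cohomology (w : (ι → R) → ℤ) (q : ℕ) : Type _ :=
  cocycles w q ⧸ (coboundaries w q).comap (cocycles w q).subtype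

/-- A cochain `φ` is homogeneous of degree `d` if each `φ(□)` is homogeneous of degree
`d - 2 w(□)` in `𝒯₀⁺` (zero is homogeneous of every degree). -/
def IsHomogeneous (w : (ι → R) → ℤ) {q : ℕ} (d : ℤ) (φ : Cochain ι R q) : Prop :=
  ∀ c, φ c ∈ TPlus.homogeneous (d - 2 * c.weight w)

/-- The homogeneous elements of degree `d` of `ℍ^q`: the classes of the homogeneous cocycles of
degree `d`. -/
def cohomologyDegree (w : (ι → R) → ℤ) (q : ℕ) (d : ℤ) : Set (Cohomology w q) :=
  {x | ∃ φ : cocycles w q, IsHomogeneous w d φ.1 ∧ Submodule.Quotient.mk φ = x}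

end LatticeCohomology

/-! # Negative definite plumbing trees -/

section Plumbing

variable {V : Type*} [Fintype V] [DecidableEq V]

open Classical in
/-- The intersection matrix `(E_u, E_v)` of a graph with Euler decorations `e`. -/
noncomputable def intersectionMatrix (Γ : SimpleGraph V) (e : V → ℤ) : Matrix V V ℤ :=
  fun u v => if u = v then e u else if Γ.Adj u v then 1 else 0

/-- A connected negative definite plumbing tree (all genera are zero): a finite tree with an
Euler number at each vertex, whose intersection form is negative definite on the lattice
`L = ℤ⟨E_v⟩_v`. -/
structure PlumbingTree (V : Type*) [Fintype V] [DecidableEq V] where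
  graph : SimpleGraph V
  isTree : graph.IsTree
  euler : V → ℤ
  negDef : ∀ x : V → ℤ, x ≠ 0 →
    dotProduct x (Matrix.mulVec (intersectionMatrix graph euler) x) < 0

namespace PlumbingTree

variable (G : PlumbingTree V)

/-- The intersection matrix with rational entries. -/
noncomputable def matrix : Matrix V V ℚ :=
  (intersectionMatrix G.graph G.euler).map (Int.cast : ℤ → ℚ)

/-- The intersection pairing `(x, y)` of rational cycles (elements of `L ⊗ ℚ`). -/
noncomputable def pairing (x y : V → ℚ) : ℚ :=
  dotProduct x (Matrix.mulVec G.matrix y)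

/-- The base element `E_v`. -/
def E (v : V) : V → ℚ := Pi.single v 1

/-- An integral cycle (an element of `L`), regarded as a rational cycle. -/
def toRat (x : V → ℤ) : V → ℚ := fun v => (x v : ℚ)

/-- The dual lattice `L'`. -/
def dualLattice : Set (V → ℚ) :=
  {l | ∀ x : V → ℤ, ∃ n : ℤ, G.pairing l (toRat x) = n}

/-- The set `Char` of characteristic elements. -/
def charElements : Set (V → ℚ) :=
  {k | k ∈ G.dualLattice ∧
    ∀ x : V → ℤ, ∃ n : ℤ, G.pairing k (toRat x) + G.pairing (toRat x) (toRat x) = 2 * n}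

/-- The canonical cycle, the solution of `(k_can, E_v) = -(E_v, E_v) - 2` for all `v`. -/
noncomputable def kCan : V → ℚ :=
  Matrix.mulVec G.matrix⁻¹ fun v => -(G.euler v : ℚ) - 2

/-- The anti-nef (Lipman) cone `𝒮'`. -/
def antiNefCone : Set (V → ℚ) :=
  {l | l ∈ G.dualLattice ∧ ∀ v, G.pairing l (E v) ≤ 0}

/-- `χ_k(l) = -(l, l + k)/2`, as a rational number. -/
noncomputable def chi (k : V → ℚ) (l : V → ℤ) : ℚ :=
  -G.pairing (toRat l) (toRat l + k) / 2

/-- The weight function `χ_k : L → ℤ`; the floor is there only to land in `ℤ`, see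
`weight_eq_chi`. -/
noncomputable def weight (k : V → ℚ) (l : V → ℤ) : ℤ := ⌊G.chi k l⌋

/-- Artin's criterion: the graph is rational if `χ_can(l) > 0` for every integral `l > 0`. -/
def IsRational : Prop := ∀ l : V → ℤ, 0 < l → 0 < G.chi G.kCan l

/-- `J` is a (not necessarily minimal) set of bad vertices: decreasing the Euler numbers of the
vertices in `J` suitably, one gets a rational graph. -/
def IsBadSet (J : Finset V) : Prop :=
  ∃ G' : PlumbingTree V, G'.graph = G.graph ∧ (∀ v ∈ J, G'.euler v ≤ G.euler v) ∧
    (∀ v, v ∉ J → G'.euler v = G.euler v) ∧ G'.IsRational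

/-! ### Existence of the distinguished representatives and of the universal cycles -/

theorem matrix_symm (u v : V) : G.matrix u v = G.matrix v u := by
  simp only [matrix, Matrix.map_apply, intersectionMatrix]
  by_cases h : u = v
  · subst h; rfl
  · rw [if_neg h, if_neg (Ne.symm h)]
    by_cases ha : G.graph.Adj u v
    · rw [if_pos ha, if_pos ha.symm]
    · rw [if_neg ha, if_neg fun h' => ha h'.symm]

theorem matrix_offDiag_nonneg {u v : V} (h : u ≠ v) : 0 ≤ G.matrix u v := by
  simp only [matrix, Matrix.map_apply, intersectionMatrix, h, if_false]
  split_ifs <;> simp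

theorem matrix_diag (v : V) : G.matrix v v = G.euler v := by
  simp [matrix, intersectionMatrix]

theorem pairing_eq_sum (x y : V → ℚ) :
    G.pairing x y = ∑ u, ∑ v, x u * G.matrix u v * y v := by
  simp only [pairing, dotProduct, Matrix.mulVec, Finset.mul_sum, mul_assoc]

theorem pairing_comm (x y : V → ℚ) : G.pairing x y = G.pairing y x := by
  rw [pairing_eq_sum, pairing_eq_sum, Finset.sum_comm]
  refine Finset.sum_congr rfl fun u _ => Finset.sum_congr rfl fun v _ => ?_
  rw [G.matrix_symm v u]; ring

theorem pairing_E (x : V → ℚ) (v : V) : G.pairing x (E v) = ∑ u, x u * G.matrix u v := by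
  simp [pairing, E, dotProduct]

theorem pairing_add_left (x y z : V → ℚ) :
    G.pairing (x + y) z = G.pairing x z + G.pairing y z := by
  simp [pairing, add_dotProduct]

theorem pairing_sub_left (x y z : V → ℚ) :
    G.pairing (x - y) z = G.pairing x z - G.pairing y z := by
  simp [pairing, sub_dotProduct]

theorem pairing_smul_left (a : ℚ) (x z : V → ℚ) :
    G.pairing (a • x) z = a * G.pairing x z := by
  simp [pairing, smul_dotProduct]

theorem pairing_add_right (x y z : V → ℚ) :
    G.pairing x (y + z) = G.pairing x y + G.pairing x z := by
  rw [pairing_comm, pairing_add_left, pairing_comm, G.pairing_comm z]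

theorem pairing_eq_sum_E (x y : V → ℚ) : G.pairing x y = ∑ v, y v * G.pairing x (E v) := by
  rw [pairing_eq_sum, Finset.sum_comm]
  simp only [pairing_E, Finset.mul_sum]
  refine Finset.sum_congr rfl fun v _ => Finset.sum_congr rfl fun u _ => ?_
  ring

theorem pairing_toRat (x y : V → ℤ) : ∃ n : ℤ, G.pairing (toRat x) (toRat y) = n := by
  refine ⟨∑ u, ∑ v, x u * intersectionMatrix G.graph G.euler u v * y v, ?_⟩
  rw [pairing_eq_sum]
  push_cast
  rfl

theorem exists_common_denominator (y : V → ℚ) :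
    ∃ (D : ℕ) (z : V → ℤ), 0 < D ∧ toRat z = (D : ℚ) • y := by
  refine ⟨∏ v, (y v).den, fun v => (∏ u ∈ Finset.univ.erase v, (y u).den : ℕ) * (y v).num,
    Finset.prod_pos fun v _ => (y v).den_pos, ?_⟩
  funext v
  simp only [toRat, Pi.smul_apply, smul_eq_mul]
  rw [← Finset.mul_prod_erase Finset.univ (fun u => (y u).den) (Finset.mem_univ v)]
  have h := Rat.den_mul_eq_num (y v)
  push_cast
  rw [← h]
  ring

/-- Negative definiteness for rational cycles. -/
theorem pairing_self_neg (y : V → ℚ) (hy : y ≠ 0) : G.pairing y y < 0 := by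
  obtain ⟨D, z, hD, hz⟩ := exists_common_denominator y
  have hD' : (0 : ℚ) < D := by exact_mod_cast hD
  have hz0 : z ≠ 0 := by
    rintro rfl
    apply hy
    have : (D : ℚ) • y = 0 := by rw [← hz]; funext v; simp [toRat]
    exact (smul_eq_zero.mp this).resolve_left hD'.ne'
  have h := G.negDef z hz0
  have h1 : G.pairing (toRat z) (toRat z) < 0 := by
    have e : G.pairing (toRat z) (toRat z)
        = ((dotProduct z (Matrix.mulVec (intersectionMatrix G.graph G.euler) z) : ℤ) : ℚ) := by
      simp only [pairing, dotProduct, Matrix.mulVec, toRat, matrix, Matrix.map_apply]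
      push_cast
      rfl
    rw [e]
    exact_mod_cast h
  rw [hz, pairing_smul_left, pairing_comm, pairing_smul_left] at h1
  by_contra hc
  push Not at hc
  have := mul_nonneg hD'.le (mul_nonneg hD'.le hc)
  linarith

theorem matrix_det_ne_zero : G.matrix.det ≠ 0 := by
  intro h
  obtain ⟨v, hv, hv0⟩ := Matrix.exists_mulVec_eq_zero_iff.mpr h
  have := G.pairing_self_neg v hv
  simp [pairing, hv0] at this

theorem pairing_solve (b : V → ℚ) (v : V) :
    G.pairing (Matrix.mulVec G.matrix⁻¹ b) (E v) = b v := by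
  rw [pairing_comm]
  have hu : IsUnit G.matrix.det := G.matrix_det_ne_zero.isUnit
  simp [pairing, Matrix.mulVec_mulVec, Matrix.mul_nonsing_inv _ hu, E]

/-- The adjunction relations. -/
theorem pairing_kCan (v : V) : G.pairing G.kCan (E v) = -G.pairing (E v) (E v) - 2 := by
  rw [kCan, pairing_solve, pairing_E]
  simp [E, Pi.single_apply, matrix_diag]

theorem toRat_add {W : Type*} (x y : W → ℤ) : toRat (x + y) = toRat x + toRat y := by
  funext v; simp [toRat]

/-- The canonical cycle is characteristic. -/
theorem kCan_mem_charElements : G.kCan ∈ G.charElements := by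
  have key : ∀ x : V → ℤ, ∃ n : ℤ,
      G.pairing G.kCan (toRat x) + G.pairing (toRat x) (toRat x) = 2 * n := by
    let S : AddSubgroup (V → ℤ) :=
      { carrier := {x | ∃ n : ℤ,
          G.pairing G.kCan (toRat x) + G.pairing (toRat x) (toRat x) = 2 * n}
        zero_mem' := ⟨0, by
          have : toRat (0 : V → ℤ) = 0 := by funext v; simp [toRat]
          simp [this, pairing]⟩
        add_mem' := by
          rintro x y ⟨n, hn⟩ ⟨m, hm⟩
          obtain ⟨p, hp⟩ := G.pairing_toRat x y
          refine ⟨n + m + p, ?_⟩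
          rw [toRat_add, pairing_add_right, pairing_add_right, pairing_add_left,
            pairing_add_left, G.pairing_comm (toRat y) (toRat x), hp]
          push_cast
          linarith
        neg_mem' := by
          rintro x ⟨n, hn⟩
          obtain ⟨p, hp⟩ := G.pairing_toRat x x
          refine ⟨p - n, ?_⟩
          have e : toRat (-x) = (-1 : ℚ) • toRat x := by funext v; simp [toRat]
          rw [e, pairing_comm, pairing_smul_left, pairing_smul_left,
            G.pairing_comm (toRat x) (_ • _), pairing_smul_left, hp,
            G.pairing_comm (toRat x)]
          rw [hp] at hn
          push_cast
          linarith }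
    intro x
    have hx : x = ∑ v, x v • (Pi.single v 1 : V → ℤ) := by
      funext u
      simp [Finset.sum_apply, Pi.single_apply]
    change x ∈ S
    rw [hx]
    refine sum_mem fun v _ => zsmul_mem ?_ _
    refine ⟨-1, ?_⟩
    have e : toRat (Pi.single v 1 : V → ℤ) = E v := by
      funext u
      by_cases h : u = v
      · subst h; simp [toRat, E]
      · simp [toRat, E, h]
    rw [e, pairing_kCan]
    push_cast
    ring
  refine ⟨fun x => ?_, key⟩
  obtain ⟨n, hn⟩ := key x
  obtain ⟨p, hp⟩ := G.pairing_toRat x x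
  exact ⟨2 * n - p, by push_cast; linarith⟩

/-- For a characteristic element `k`, the function `χ_k` takes integral values, and `weight k` is
equal to it. -/
theorem weight_eq_chi {k : V → ℚ} (hk : k ∈ G.charElements) (l : V → ℤ) :
    (G.weight k l : ℚ) = G.chi k l := by
  obtain ⟨n, hn⟩ := hk.2 l
  have h : G.chi k l = ((-n : ℤ) : ℚ) := by
    rw [chi, pairing_add_right, G.pairing_comm (toRat l) k]
    push_cast
    linarith
  rw [weight, h, Int.floor_intCast]

/-- A cycle that is nonnegative on `J` and pairs nonpositively with the other base elements is
nonnegative. -/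
theorem nonneg_of_pairing (J : Finset V) (y : V → ℚ) (h0 : ∀ v ∈ J, 0 ≤ y v)
    (h1 : ∀ v, v ∉ J → G.pairing y (E v) ≤ 0) (v : V) : 0 ≤ y v := by
  let n : V → ℚ := fun v => max (-y v) 0
  let p : V → ℚ := fun v => max (y v) 0
  have hy : y = p - n := by
    funext u
    simp only [p, n, Pi.sub_apply]
    rcases le_total 0 (y u) with h | h
    · rw [max_eq_left h, max_eq_right (by linarith)]; ring
    · rw [max_eq_right h, max_eq_left (by linarith)]; ring
  have a1 : G.pairing y n ≤ 0 := by
    rw [pairing_eq_sum_E]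
    refine Finset.sum_nonpos fun u _ => ?_
    by_cases hu : u ∈ J
    · have : n u = 0 := max_eq_right (by linarith [h0 u hu])
      rw [this, zero_mul]
    · exact mul_nonpos_of_nonneg_of_nonpos (le_max_right _ _) (h1 u hu)
  have a2 : 0 ≤ G.pairing p n := by
    rw [pairing_eq_sum]
    refine Finset.sum_nonneg fun u _ => Finset.sum_nonneg fun u' _ => ?_
    by_cases h : u = u'
    · subst h
      rcases le_total 0 (y u) with h | h
      · have : n u = 0 := max_eq_right (by linarith)
        rw [this, mul_zero]
      · have : p u = 0 := max_eq_right h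
        rw [this, zero_mul, zero_mul]
    · exact mul_nonneg (mul_nonneg (le_max_right _ _) (G.matrix_offDiag_nonneg h))
        (le_max_right _ _)
  have a3 : G.pairing y n = G.pairing p n - G.pairing n n := by
    conv_lhs => rw [hy]
    rw [pairing_sub_left]
  have hn : n = 0 := by
    by_contra hne
    have := G.pairing_self_neg n hne
    linarith
  have := congrFun hn v
  have h2 : -y v ≤ n v := le_max_left _ _
  rw [this] at h2
  simpa using h2

/-- There is an integral cycle with positive coefficients that pairs negatively with each base
element. -/
theorem exists_antiNef : ∃ z : V → ℤ, (∀ v, 1 ≤ z v) ∧ ∀ v, G.pairing (toRat z) (E v) ≤ -1 := by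
  obtain ⟨D, z, hD, hz⟩ := exists_common_denominator (Matrix.mulVec G.matrix⁻¹ fun _ => (-1 : ℚ))
  have hD' : (1 : ℚ) ≤ D := by exact_mod_cast hD
  have h1 : ∀ v, G.pairing (toRat z) (E v) ≤ -1 := fun v => by
    rw [hz, pairing_smul_left, pairing_solve]
    linarith
  have h0 : ∀ v, 0 ≤ toRat z v :=
    G.nonneg_of_pairing ∅ (toRat z) (by simp) fun v _ => (h1 v).trans (by norm_num)
  refine ⟨z, fun v => ?_, h1⟩
  by_contra hc
  have hz0 : 0 ≤ z v := by have := h0 v; simp only [toRat] at this; exact_mod_cast this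
  have hzv : toRat z v = 0 := by
    have : z v = 0 := by omega
    simp [toRat, this]
  have h2 := h1 v
  have h3 : 0 ≤ G.pairing (toRat z) (E v) := by
    rw [pairing_E]
    refine Finset.sum_nonneg fun u _ => ?_
    by_cases h : u = v
    · subst h; rw [hzv, zero_mul]
    · exact mul_nonneg (h0 u) (G.matrix_offDiag_nonneg h)
  linarith

/-- A nonempty set of integral cycles that is bounded below and closed under coefficientwise
minima has a least element. -/
theorem exists_isLeast_of_inf_closed {W : Type*} [Fintype W] (S : Set (W → ℤ)) (hne : S.Nonempty) (b : W → ℤ)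
    (hb : ∀ x ∈ S, b ≤ x) (hinf : ∀ x ∈ S, ∀ y ∈ S, x ⊓ y ∈ S) : ∃ x, IsLeast S x := by
  obtain ⟨x, hx, hmin⟩ := (measure fun x : W → ℤ => (∑ v, (x v - b v)).toNat).wf.has_min S hne
  refine ⟨x, hx, fun y hy => ?_⟩
  have hm := hinf x hx y hy
  have h1 : ¬ (∑ v, ((x ⊓ y) v - b v)).toNat < (∑ v, (x v - b v)).toNat := hmin _ hm
  have h2 : 0 ≤ ∑ v, ((x ⊓ y) v - b v) :=
    Finset.sum_nonneg fun v _ => sub_nonneg.mpr (hb _ hm v)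
  have h3 : ∑ v, (x v - b v) ≤ ∑ v, ((x ⊓ y) v - b v) := by omega
  intro v
  by_contra hv
  push Not at hv
  have h4 : ∑ v, ((x ⊓ y) v - b v) < ∑ v, (x v - b v) := by
    refine Finset.sum_lt_sum (fun u _ => ?_) ⟨v, Finset.mem_univ v, ?_⟩
    · exact sub_le_sub_right ((inf_le_left : x ⊓ y ≤ x) u) _
    · have : (x ⊓ y) v = y v := inf_eq_right.mpr hv.le
      rw [this]
      exact sub_lt_sub_right hv _
  omega

theorem exists_isLeast_cycle (J : Finset V) (a : V → ℚ) (c : V → ℤ)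
    (hc : ∀ v ∈ J, 0 ≤ (c v : ℚ) + a v) :
    ∃ x, IsLeast {x : V → ℤ | (∀ v ∈ J, x v = c v) ∧
      ∀ v, v ∉ J → G.pairing (toRat x + a) (E v) ≤ 0} x := by
  refine exists_isLeast_of_inf_closed _ ?_ (fun v => ⌈-a v⌉) ?_ ?_
  · obtain ⟨z, hz, hz'⟩ := G.exists_antiNef
    obtain ⟨n, hn, hn'⟩ : ∃ n : ℕ, (∀ v, c v ≤ n) ∧ ∀ v, G.pairing a (E v) ≤ n := by
      refine ⟨∑ v, ((c v).natAbs + ⌈|G.pairing a (E v)|⌉₊), fun v => ?_, fun v => ?_⟩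
      · have := Finset.single_le_sum
          (f := fun v => (c v).natAbs + ⌈|G.pairing a (E v)|⌉₊)
          (fun _ _ => Nat.zero_le _) (Finset.mem_univ v)
        omega
      · have := Finset.single_le_sum
          (f := fun v => (c v).natAbs + ⌈|G.pairing a (E v)|⌉₊)
          (fun _ _ => Nat.zero_le _) (Finset.mem_univ v)
        have h2 : ⌈|G.pairing a (E v)|⌉₊ ≤ ∑ v, ((c v).natAbs + ⌈|G.pairing a (E v)|⌉₊) := by
          omega
        exact (le_abs_self _).trans ((Nat.le_ceil _).trans (by exact_mod_cast h2))
    refine ⟨fun v => if v ∈ J then c v else n * z v, fun v hv => by simp [hv], fun v hv => ?_⟩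
    have h1 : G.pairing (toRat fun v => if v ∈ J then c v else n * z v) (E v)
        ≤ G.pairing ((n : ℚ) • toRat z) (E v) := by
      rw [pairing_E, pairing_E]
      refine Finset.sum_le_sum fun u _ => ?_
      by_cases hu : u ∈ J
      · have huv : u ≠ v := fun h => hv (h ▸ hu)
        refine mul_le_mul_of_nonneg_right ?_ (G.matrix_offDiag_nonneg huv)
        have h2 : c u ≤ n * z u := by nlinarith [hn u, hz u]
        simp only [toRat, hu, if_true, Pi.smul_apply, smul_eq_mul]
        exact_mod_cast h2
      · simp [toRat, hu]
    rw [pairing_smul_left] at h1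
    rw [pairing_add_left]
    have h3 := hz' v
    have h4 := hn' v
    have h5 : (n : ℚ) * G.pairing (toRat z) (E v) ≤ n * (-1) :=
      mul_le_mul_of_nonneg_left h3 (Nat.cast_nonneg n)
    linarith
  · rintro x ⟨hx, hx'⟩ v
    have h := G.nonneg_of_pairing J (toRat x + a)
      (fun u hu => by simpa [toRat, hx u hu] using hc u hu) hx' v
    simp only [Pi.add_apply, toRat] at h
    exact Int.ceil_le.mpr (by linarith)
  · rintro x ⟨hx, hx'⟩ y ⟨hy, hy'⟩
    refine ⟨fun v hv => by simp [hx v hv, hy v hv], fun v hv => ?_⟩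
    have aux : ∀ t : V → ℤ, G.pairing (toRat t + a) (E v) ≤ 0 → x ⊓ y ≤ t → (x ⊓ y) v = t v →
        G.pairing (toRat (x ⊓ y) + a) (E v) ≤ 0 := by
      intro t ht hle heq
      refine le_trans ?_ ht
      rw [pairing_E, pairing_E]
      refine Finset.sum_le_sum fun u _ => ?_
      by_cases huv : u = v
      · subst huv
        simp only [Pi.add_apply, toRat, heq, le_refl]
      · refine mul_le_mul_of_nonneg_right ?_ (G.matrix_offDiag_nonneg huv)
        have : (((x ⊓ y) u : ℤ) : ℚ) ≤ t u := by exact_mod_cast hle u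
        simp only [Pi.add_apply, toRat]
        linarith
    rcases le_total (x v) (y v) with h | h
    · exact aux x (hx' v hv) inf_le_left (inf_eq_left.mpr h)
    · exact aux y (hy' v hv) inf_le_right (inf_eq_right.mpr h)

/-- For `[k] = k_can + 2(l' + L)`, the set `(l' + L) ∩ 𝒮'`. -/
def antiNefLifts (k : V → ℚ) : Set (V → ℚ) :=
  {y | y ∈ G.antiNefCone ∧ ∃ m : V → ℤ, k = G.kCan + (2 : ℚ) • (y + toRat m)}

theorem exists_isLeast_antiNefLifts (k : G.charElements) :
    ∃ y, IsLeast (G.antiNefLifts k) y := by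
  set a : V → ℚ := (1 / 2 : ℚ) • (k.1 - G.kCan) with ha
  have hk : ∀ (y : V → ℚ) (m : V → ℤ),
      k.1 = G.kCan + (2 : ℚ) • (y + toRat m) ↔ y = toRat (-m) + a := by
    intro y m
    constructor
    · intro h
      funext v
      simp only [ha, h, Pi.add_apply, Pi.smul_apply, Pi.sub_apply, smul_eq_mul, toRat,
        Pi.neg_apply]
      push_cast
      ring
    · rintro rfl
      funext v
      simp only [ha, Pi.add_apply, Pi.smul_apply, Pi.sub_apply, smul_eq_mul, toRat,
        Pi.neg_apply]
      push_cast
      ring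
  have hdual : ∀ x : V → ℤ, toRat x + a ∈ G.dualLattice := by
    intro x l
    obtain ⟨p, hp⟩ := G.pairing_toRat x l
    obtain ⟨n, hn⟩ := k.2.2 l
    obtain ⟨m, hm⟩ := G.kCan_mem_charElements.2 l
    refine ⟨p + n - m, ?_⟩
    rw [pairing_add_left, hp, ha, pairing_smul_left, pairing_sub_left]
    push_cast
    linarith
  obtain ⟨x, ⟨-, hx⟩, hmin⟩ := G.exists_isLeast_cycle ∅ a 0 (by simp)
  refine ⟨toRat x + a, ⟨⟨hdual x, fun v => hx v (by simp)⟩, -x, ?_⟩, ?_⟩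
  · rw [hk, neg_neg]
  · rintro y ⟨⟨-, hy⟩, m, hm⟩
    rw [hk] at hm
    subst hm
    have h : x ≤ -m := hmin ⟨by simp, fun v _ => hy v⟩
    intro v
    have h2 : (x v : ℚ) ≤ ((-m) v : ℤ) := by exact_mod_cast h v
    simp only [Pi.add_apply, toRat]
    linarith

/-- `l'_{[k]}`, the minimal element of `(l' + L) ∩ 𝒮'`. -/
noncomputable def minLift (k : G.charElements) : V → ℚ :=
  (G.exists_isLeast_antiNefLifts k).choose

theorem minLift_isLeast (k : G.charElements) : IsLeast (G.antiNefLifts k) (G.minLift k) :=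
  (G.exists_isLeast_antiNefLifts k).choose_spec

/-- `k_r = k_can + 2 l'_{[k]}`, the distinguished representative of the class `[k]`. -/
noncomputable def distinguishedRep (k : G.charElements) : V → ℚ :=
  G.kCan + (2 : ℚ) • G.minLift k

/-- The integral cycles `x` with prescribed coefficients `i` at the vertices in `J`, such that
`(x + l'_{[k]}, E_v) ≤ 0` for all `v ∉ J`. -/
def cyclesOver (k : G.charElements) (J : Finset V) (i : J → ℕ) : Set (V → ℤ) :=
  {x | (∀ j : J, x j = i j) ∧ ∀ v, v ∉ J → G.pairing (toRat x + G.minLift k) (E v) ≤ 0}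

theorem exists_isLeast_cyclesOver (k : G.charElements) (J : Finset V) (i : J → ℕ) :
    ∃ x, IsLeast (G.cyclesOver k J i) x := by
  have h0 : ∀ v, 0 ≤ G.minLift k v :=
    G.nonneg_of_pairing ∅ _ (by simp) fun v _ => (G.minLift_isLeast k).1.1.2 v
  obtain ⟨x, hx⟩ := G.exists_isLeast_cycle J (G.minLift k)
    (fun v => if h : v ∈ J then (i ⟨v, h⟩ : ℤ) else 0) (fun v hv => by
      simp only [hv, dif_pos]
      exact add_nonneg (by simp) (h0 v))
  refine ⟨x, ?_⟩
  convert hx using 1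
  ext y
  constructor
  · rintro ⟨h1, h2⟩
    exact ⟨fun v hv => by simpa [hv] using h1 ⟨v, hv⟩, h2⟩
  · rintro ⟨h1, h2⟩
    exact ⟨fun j => by simpa using h1 j.1 j.2, h2⟩

/-- The universal cycle `x(i)`: the minimal element of `cyclesOver k J i`. -/
noncomputable def universalCycle (k : G.charElements) (J : Finset V) (i : J → ℕ) : V → ℤ :=
  (G.exists_isLeast_cyclesOver k J i).choose

theorem universalCycle_isLeast (k : G.charElements) (J : Finset V) (i : J → ℕ) :
    IsLeast (G.cyclesOver k J i) (G.universalCycle k J i) :=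
  (G.exists_isLeast_cyclesOver k J i).choose_spec

/-- The reduced weight function `w̄(i) = χ_{k_r}(x(i))` on `(ℤ_{≥0})^J`. -/
noncomputable def reducedWeight (k : G.charElements) (J : Finset V) (i : J → ℕ) : ℤ :=
  G.weight (G.distinguishedRep k) (G.universalCycle k J i)

end PlumbingTree

end Plumbing

set_option linter.unusedSectionVars false

namespace LatticeCohomology

/-! ### The homogeneous parts of `𝒯₀⁺` -/

/-! All comparisons are made on integral cubical chains filtered by weight. A chain map that does
not raise weights induces a degree preserving map of cochains with values in `TPlus`, once powers of
U are inserted to make up for the drop in weight. Chain maps that are inverse up to filtered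
homotopy therefore give an isomorphism of graded modules (`CohomologyIso.of_homotopyEquiv`). It
remains to deform the lattice without raising weights, in three stages.

Effective cycles. Adding E_v to x changes χ_{k_r} by 1 - (x + l'_{[k]}, E_v). By minimality of
l'_{[k]}, every nonzero z ≤ 0 has a vertex v with z_v < 0 at which this change is at most zero. A
climb from -Z to 0, for an anti-nef Z with positive coefficients, read backwards and repeated
periodically, is a descending sequence that eventually drops below any given lattice point. The
regions above its members retract onto one another (`CohomologyIso.of_quadrant`), so χ_{k_r}(x) may
be replaced by χ_{k_r}(x⁺), the reduced weight for the bad set of all vertices.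

Removing a vertex v from a bad set J for which J ∖ v is still bad. Rationality makes the reduced
weight the minimum of χ_{k_r} over the cycles with the given coefficients at the bad vertices
(`IsBadSet.weightOver_le`). Along a line in direction v it falls up to the coefficient of the
universal cycle for J ∖ v and rises afterwards. To contract these lines, the vertices of a cube must
be moved to a common level without exceeding the weight of the projected cube
(`IsBadSet.exists_level`). By rationality it suffices to look at a universal cycle plus reduced
cycles (`IsBadSet.chi_reduced_le`). There χ_{k_r} is a set function whose quadratic part comes from
the edges of a tree, and such a function has a pure saddle point for the game of cube directions
against lifts (`exists_saddle_point`). The strategy of the minimizing player is the common level.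

Coordinates outside J. The reduced weight for J ignores them, as well as negative parts, so the
lattice retracts onto the first quadrant of the coordinates in J (`CohomologyIso.of_subspace`). -/

theorem TPlus.X_smul_ofPow (n : ℤ) : (X : ℤ[X]) • TPlus.ofPow n = TPlus.ofPow (n + 1) := by
  rw [TPlus.ofPow, TPlus.ofPow, ← Submodule.Quotient.mk_smul, Algebra.smul_def,
    add_comm, LaurentPolynomial.T_add]
  congr 2
  exact Polynomial.toLaurent_X

theorem TPlus.X_smul_mem {d : ℤ} {t : TPlus} (ht : t ∈ TPlus.homogeneous d) :
    (X : ℤ[X]) • t ∈ TPlus.homogeneous (d - 2) := by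
  unfold TPlus.homogeneous at ht
  induction ht using AddSubgroup.closure_induction with
  | mem x hx =>
    obtain ⟨n, hn, rfl⟩ := hx
    rw [TPlus.X_smul_ofPow]
    exact AddSubgroup.subset_closure ⟨n - 1, by omega, by congr 1; ring⟩
  | zero => rw [smul_zero]; exact zero_mem _
  | add x y _ _ hx hy => rw [smul_add]; exact add_mem hx hy
  | neg x _ hx => rw [smul_neg]; exact neg_mem hx

theorem TPlus.X_pow_smul_mem {d : ℤ} {t : TPlus} (ht : t ∈ TPlus.homogeneous d) (n : ℕ) :
    (X : ℤ[X]) ^ n • t ∈ TPlus.homogeneous (d - 2 * n) := by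
  induction n with
  | zero => simpa using ht
  | succ n ih =>
    rw [pow_succ', mul_smul]
    convert TPlus.X_smul_mem ih using 1
    push_cast
    ring_nf

/-! ### Integral chains on all cubes -/

/-- The integral chains on the cubes `(l, I)` of all dimensions. -/
abbrev Chain (ι R : Type*) : Type _ := ((ι → R) × Finset ι) →₀ ℤ

/-- The cochains with values in `𝒯₀⁺` on the cubes of all dimensions. -/
abbrev TotalCochain (ι R : Type*) : Type _ := ((ι → R) × Finset ι) → TPlus

section General

variable {ι R ι' R' ι'' R'' : Type*} [LinearOrder ι] [AddMonoidWithOne R]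
  [LinearOrder ι'] [AddMonoidWithOne R'] [LinearOrder ι''] [AddMonoidWithOne R'']

/-- The weight of the cube `(l, I)`. -/
def cubeWeight (w : (ι → R) → ℤ) (c : (ι → R) × Finset ι) : ℤ :=
  c.2.powerset.sup' (Finset.powerset_nonempty _) fun I' => w (translate c.1 I')

theorem cubeWeight_le_iff {w : (ι → R) → ℤ} {c : (ι → R) × Finset ι} {N : ℤ} :
    cubeWeight w c ≤ N ↔ ∀ A ⊆ c.2, w (translate c.1 A) ≤ N := by
  simp [cubeWeight, Finset.sup'_le_iff]

theorem le_cubeWeight (w : (ι → R) → ℤ) (c : (ι → R) × Finset ι) {A : Finset ι} (hA : A ⊆ c.2) :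
    w (translate c.1 A) ≤ cubeWeight w c :=
  cubeWeight_le_iff.mp le_rfl A hA

theorem cubeWeight_mono {w w' : (ι → R) → ℤ} (h : ∀ x, w' x ≤ w x) (c : (ι → R) × Finset ι) :
    cubeWeight w' c ≤ cubeWeight w c :=
  cubeWeight_le_iff.mpr fun _ hA => (h _).trans (le_cubeWeight w c hA)

/-- The orientation sign `(-1)^(number of elements of I below j)`. -/
def orient (I : Finset ι) (j : ι) : ℤ := (-1) ^ (I.filter (· < j)).card

theorem orient_mul_self (I : Finset ι) (j : ι) : orient I j * orient I j = 1 := by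
  rw [orient, ← pow_add, ← two_mul, pow_mul]; simp

theorem orient_insert_self (I : Finset ι) (j : ι) : orient (insert j I) j = orient I j := by
  simp [orient, Finset.filter_insert]

theorem orient_erase_self (I : Finset ι) (j : ι) : orient (I.erase j) j = orient I j := by
  have : (I.erase j).filter (· < j) = I.filter (· < j) := by
    ext a; simp only [Finset.mem_filter, Finset.mem_erase]
    exact ⟨fun h => ⟨h.1.2, h.2⟩, fun h => ⟨⟨h.2.ne, h.1⟩, h.2⟩⟩
  rw [orient, this, orient]

theorem orient_erase_lt {I : Finset ι} {i j : ι} (hi : i ∈ I) (h : i < j) :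
    orient (I.erase i) j = -orient I j := by
  have h1 : I.filter (· < j) = insert i ((I.erase i).filter (· < j)) := by
    ext a; simp only [Finset.mem_filter, Finset.mem_erase, Finset.mem_insert]
    constructor
    · rintro ⟨ha, hj⟩
      by_cases hai : a = i
      · exact Or.inl hai
      · exact Or.inr ⟨⟨hai, ha⟩, hj⟩
    · rintro (rfl | h')
      · exact ⟨hi, h⟩
      · exact ⟨h'.1.2, h'.2⟩
  rw [orient, orient, h1, Finset.card_insert_of_notMem (by simp), pow_succ]
  ring

theorem orient_erase_gt {I : Finset ι} {i j : ι} (h : j < i) :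
    orient (I.erase i) j = orient I j := by
  have : (I.erase i).filter (· < j) = I.filter (· < j) := by
    ext a; simp only [Finset.mem_filter, Finset.mem_erase]
    exact ⟨fun h => ⟨h.1.2, h.2⟩, fun h' => ⟨⟨(h'.2.trans h).ne, h'.1⟩, h'.2⟩⟩
  rw [orient, this, orient]

/-- Only the sign of the larger direction notices the removal of the smaller one, so the two orders
of removal differ by one sign. This is what makes the boundary square to zero. -/
theorem orient_mul_orient_erase {I : Finset ι} {i j : ι} (hi : i ∈ I) (hj : j ∈ I) (hij : i ≠ j) :
    orient I i * orient (I.erase i) j = -(orient I j * orient (I.erase j) i) := by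
  rcases lt_or_gt_of_ne hij with h | h
  · rw [orient_erase_lt hi h, orient_erase_gt h]; ring
  · rw [orient_erase_gt h, orient_erase_lt hj h]; ring

theorem translate_of_notMem (l : ι → R) {I : Finset ι} {j : ι} (h : j ∉ I) :
    translate l I j = l j := by simp [translate, h]

theorem translate_of_mem (l : ι → R) {I : Finset ι} {j : ι} (h : j ∈ I) :
    translate l I j = l j + 1 := by simp [translate, h]

@[simp] theorem translate_empty (l : ι → R) : translate l ∅ = l := by
  funext j; simp [translate]

theorem translate_translate (l : ι → R) {A B : Finset ι} (h : Disjoint A B) :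
    translate (translate l A) B = translate l (A ∪ B) := by
  funext j
  by_cases hA : j ∈ A
  · have : j ∉ B := Finset.disjoint_left.mp h hA
    simp [translate, hA, this]
  · by_cases hB : j ∈ B <;> simp [translate, hA, hB]

theorem translate_singleton_comm (l : ι → R) {i j : ι} (h : i ≠ j) :
    translate (translate l {i}) {j} = translate (translate l {j}) {i} := by
  rw [translate_translate l (by simpa using h), translate_translate l (by simpa using h.symm),
    Finset.union_comm]

/-- The contribution of the two faces in direction `j` to the boundary of the cube `(l, I)`. -/
noncomputable def facePair (c : (ι → R) × Finset ι) (j : ι) : Chain ι R :=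
  Finsupp.single (translate c.1 {j}, c.2.erase j) 1 - Finsupp.single (c.1, c.2.erase j) 1

/-- The boundary operator on integral chains. -/
noncomputable def boundary : Chain ι R →ₗ[ℤ] Chain ι R :=
  Finsupp.linearCombination ℤ fun c => ∑ j ∈ c.2, orient c.2 j • facePair c j

theorem boundary_single (c : (ι → R) × Finset ι) :
    boundary (Finsupp.single c 1) = ∑ j ∈ c.2, orient c.2 j • facePair c j := by
  simp [boundary]

/-- Swapping the indices is an involution without fixed points, so the terms cancel in pairs and no
division by two is needed. -/
theorem sum_antisymm {M : Type*} [AddCommGroup M] (s : Finset ι) (f : ι → ι → M)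
    (h : ∀ i ∈ s, ∀ j ∈ s, i ≠ j → f i j = -f j i) :
    ∑ i ∈ s, ∑ j ∈ s.erase i, f i j = 0 := by
  rw [Finset.sum_sigma']
  refine Finset.sum_involution (fun p _ => ⟨p.2, p.1⟩) ?_ ?_ ?_ ?_
  · rintro ⟨i, j⟩ hp
    simp only [Finset.mem_sigma, Finset.mem_erase] at hp
    rw [h i hp.1 j hp.2.2 (Ne.symm hp.2.1)]; simp
  · rintro ⟨i, j⟩ hp _ he
    simp only [Finset.mem_sigma, Finset.mem_erase] at hp
    simp only [Sigma.mk.injEq] at he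
    exact hp.2.1 he.1
  · rintro ⟨i, j⟩ hp
    simp only [Finset.mem_sigma, Finset.mem_erase] at hp ⊢
    exact ⟨hp.2.2, Ne.symm hp.2.1, hp.1⟩
  · rintro ⟨i, j⟩ hp; rfl

theorem boundary_boundary (x : Chain ι R) : boundary (boundary x) = 0 := by
  have : (boundary (ι := ι) (R := R)) ∘ₗ boundary = 0 := by
    ext1 c
    refine LinearMap.ext_ring ?_
    simp only [LinearMap.comp_apply, Finsupp.lsingle_apply, LinearMap.zero_apply]
    rw [boundary_single, map_sum]
    have e : ∀ j ∈ c.2, boundary (orient c.2 j • facePair c j) =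
        ∑ i ∈ c.2.erase j, (orient c.2 j * orient (c.2.erase j) i) •
          (facePair (translate c.1 {j}, c.2.erase j) i - facePair (c.1, c.2.erase j) i) := by
      intro j _
      rw [map_smul, facePair, map_sub, boundary_single, boundary_single, ← Finset.sum_sub_distrib,
        Finset.smul_sum]
      refine Finset.sum_congr rfl fun i _ => ?_
      rw [← smul_sub, smul_smul]
    rw [Finset.sum_congr rfl e]
    refine sum_antisymm c.2 _ fun i hi j hj hij => ?_
    rw [orient_mul_orient_erase hi hj hij, neg_smul]
    congr 2
    simp only [facePair]
    rw [translate_singleton_comm c.1 hij, Finset.erase_right_comm]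
    abel
  exact LinearMap.congr_fun this x

/-! ### Filtered maps and the induced maps of cochains -/

/-- A map of chains that does not increase weights. -/
def Filtered (w : (ι → R) → ℤ) (w' : (ι' → R') → ℤ) (f : Chain ι R →ₗ[ℤ] Chain ι' R') : Prop :=
  ∀ c, f (Finsupp.single c 1) ∈ Finsupp.supported ℤ ℤ {c' | cubeWeight w' c' ≤ cubeWeight w c}

/-- A map of chains that raises the dimension of cubes from `p` to `q`, where `r p q`. -/
def DimRel (r : ℕ → ℕ → Prop) (f : Chain ι R →ₗ[ℤ] Chain ι' R') : Prop :=
  ∀ c, f (Finsupp.single c 1) ∈ Finsupp.supported ℤ ℤ {c' | r c.2.card c'.2.card}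

theorem map_mem_of_forall_single {f : Chain ι R →ₗ[ℤ] Chain ι' R'} {S : Set ((ι → R) × Finset ι)}
    {P : Submodule ℤ (Chain ι' R')} (h : ∀ c ∈ S, f (Finsupp.single c 1) ∈ P) {x : Chain ι R}
    (hx : x ∈ Finsupp.supported ℤ ℤ S) : f x ∈ P := by
  have : Finsupp.supported ℤ ℤ S ≤ P.comap f := by
    rw [Finsupp.supported_eq_span_single, Submodule.span_le]
    rintro _ ⟨c, hc, rfl⟩
    exact h c hc
  exact this hx

theorem Filtered.comp {w : (ι → R) → ℤ} {w' : (ι' → R') → ℤ} {w'' : (ι'' → R'') → ℤ}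
    {f : Chain ι R →ₗ[ℤ] Chain ι' R'} {g : Chain ι' R' →ₗ[ℤ] Chain ι'' R''}
    (hg : Filtered w' w'' g) (hf : Filtered w w' f) : Filtered w w'' (g ∘ₗ f) := fun c =>
  map_mem_of_forall_single (f := g) (fun c' hc' => Finsupp.supported_mono
    (fun c'' (h : cubeWeight w'' c'' ≤ cubeWeight w' c') => show cubeWeight w'' c'' ≤ _ from
      h.trans hc') (hg c')) (hf c)

theorem DimRel.comp {r r' r'' : ℕ → ℕ → Prop} {f : Chain ι R →ₗ[ℤ] Chain ι' R'}
    {g : Chain ι' R' →ₗ[ℤ] Chain ι'' R''} (hg : DimRel r' g) (hf : DimRel r f)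
    (h : ∀ m n p, r m n → r' n p → r'' m p) : DimRel r'' (g ∘ₗ f) := by
  intro c
  refine map_mem_of_forall_single (f := g) (fun c' hc' => ?_) (hf c)
  have hsub : {c'' : (ι'' → R'') × Finset ι'' | r' c'.2.card c''.2.card} ⊆
      {c'' | r'' c.2.card c''.2.card} := fun _ h' => h _ _ _ hc' h'
  exact Finsupp.supported_mono hsub (hg c')

theorem Filtered.sub {w : (ι → R) → ℤ} {w' : (ι' → R') → ℤ}
    {f g : Chain ι R →ₗ[ℤ] Chain ι' R'}
    (hf : Filtered w w' f) (hg : Filtered w w' g) : Filtered w w' (f - g) := fun c =>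
  sub_mem (hf c) (hg c)

theorem Filtered.add {w : (ι → R) → ℤ} {w' : (ι' → R') → ℤ}
    {f g : Chain ι R →ₗ[ℤ] Chain ι' R'}
    (hf : Filtered w w' f) (hg : Filtered w w' g) : Filtered w w' (f + g) := fun c =>
  add_mem (hf c) (hg c)

theorem single_mem {S : Set ((ι → R) × Finset ι)} {c : (ι → R) × Finset ι} (h : c ∈ S) :
    (Finsupp.single c 1 : Chain ι R) ∈ Finsupp.supported ℤ ℤ S :=
  Finsupp.single_mem_supported ℤ 1 h

theorem Filtered.id {w w' : (ι → R) → ℤ} (h : ∀ x, w' x ≤ w x) :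
    Filtered w w' (LinearMap.id : Chain ι R →ₗ[ℤ] Chain ι R) := fun c =>
  single_mem (cubeWeight_mono h c)

theorem translate_insert (l : ι → R) {j : ι} {A : Finset ι} (h : j ∉ A) :
    translate (translate l {j}) A = translate l (insert j A) := by
  rw [translate_translate l (by simpa using h), Finset.insert_eq]

/-- The cubes all of whose vertices lie in `S`. -/
def cubesIn (S : Set (ι → R)) : Set ((ι → R) × Finset ι) := {c | ∀ A ⊆ c.2, translate c.1 A ∈ S}

theorem boundary_mem_cubesIn {S : Set (ι → R)} {c : (ι → R) × Finset ι} (hc : c ∈ cubesIn S) :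
    boundary (Finsupp.single c 1) ∈ Finsupp.supported ℤ ℤ (cubesIn S) := by
  rw [boundary_single]
  refine sum_mem fun j hj => Submodule.smul_mem _ _ (sub_mem ?_ ?_)
  · refine single_mem fun A hA => ?_
    have hjA : j ∉ A := fun h => by simpa using hA h
    rw [translate_insert _ hjA]
    exact hc _ (Finset.insert_subset hj (hA.trans (Finset.erase_subset _ _)))
  · exact single_mem fun A hA => hc _ (hA.trans (Finset.erase_subset _ _))

theorem filtered_boundary (w : (ι → R) → ℤ) : Filtered w w boundary := fun c =>
  Finsupp.supported_mono (fun _ h => cubeWeight_le_iff.mpr h)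
    (boundary_mem_cubesIn (S := {x | w x ≤ cubeWeight w c}) fun _ hA => le_cubeWeight w c hA)

theorem dimRel_boundary :
    DimRel (fun p q => q + 1 = p) (boundary : Chain ι R →ₗ[ℤ] Chain ι R) := fun c => by
  rw [boundary_single]
  refine sum_mem fun j hj => Submodule.smul_mem _ _ (sub_mem ?_ ?_) <;>
  exact single_mem (Finset.card_erase_add_one hj)

/-- The value of a total cochain on a chain, viewed in weight `n`. -/
noncomputable def evalAt (w : (ι → R) → ℤ) (n : ℤ) (φ : TotalCochain ι R) : Chain ι R →ₗ[ℤ] TPlus :=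
  Finsupp.linearCombination ℤ fun c => (X : ℤ[X]) ^ (n - cubeWeight w c).toNat • φ c

theorem evalAt_single (w : (ι → R) → ℤ) (n : ℤ) (φ : TotalCochain ι R) (c : (ι → R) × Finset ι) :
    evalAt w n φ (Finsupp.single c 1) = (X : ℤ[X]) ^ (n - cubeWeight w c).toNat • φ c := by
  simp [evalAt]

theorem evalAt_add (w : (ι → R) → ℤ) (n : ℤ) (φ ψ : TotalCochain ι R) :
    evalAt w n (φ + ψ) = evalAt w n φ + evalAt w n ψ := by
  ext1 c
  refine LinearMap.ext_ring ?_
  simp [evalAt_single]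

theorem evalAt_smul (w : (ι → R) → ℤ) (n : ℤ) (p : ℤ[X]) (φ : TotalCochain ι R) (x : Chain ι R) :
    evalAt w n (p • φ) x = p • evalAt w n φ x := by
  simp only [evalAt, Finsupp.linearCombination_apply, Finsupp.sum, Finset.smul_sum, Pi.smul_apply]
  refine Finset.sum_congr rfl fun c _ => ?_
  rw [smul_comm p (x c), smul_comm p (_ ^ _)]

/-- The map of cochains induced by a map of chains. -/
noncomputable def pull (w : (ι → R) → ℤ) (w' : (ι' → R') → ℤ) (f : Chain ι R →ₗ[ℤ] Chain ι' R') :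
    TotalCochain ι' R' →ₗ[ℤ[X]] TotalCochain ι R where
  toFun φ c := evalAt w' (cubeWeight w c) φ (f (Finsupp.single c 1))
  map_add' φ ψ := by funext c; simp [evalAt_add]
  map_smul' p φ := by funext c; simp [evalAt_smul]

theorem pull_apply (w : (ι → R) → ℤ) (w' : (ι' → R') → ℤ) (f : Chain ι R →ₗ[ℤ] Chain ι' R')
    (φ : TotalCochain ι' R') (c : (ι → R) × Finset ι) :
    pull w w' f φ c = evalAt w' (cubeWeight w c) φ (f (Finsupp.single c 1)) := rfl

/-- The exponents are truncated by `toNat`, so they add up only when the weights decrease along the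
way: U^(n-m) U^(m-w') = U^(n-w') for w' ≤ m ≤ n. This is the source of functoriality of `pull`. -/
theorem evalAt_pull {w : (ι → R) → ℤ} {w' : (ι' → R') → ℤ} {f : Chain ι R →ₗ[ℤ] Chain ι' R'}
    (hf : Filtered w w' f) (n : ℤ) (φ : TotalCochain ι' R') {x : Chain ι R}
    (hx : x ∈ Finsupp.supported ℤ ℤ {c | cubeWeight w c ≤ n}) :
    evalAt w n (pull w w' f φ) x = evalAt w' n φ (f x) := by
  have shift : ∀ {m : ℤ} (_ : m ≤ n) {y : Chain ι' R'}
      (_ : y ∈ Finsupp.supported ℤ ℤ {c | cubeWeight w' c ≤ m}),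
      (X : ℤ[X]) ^ (n - m).toNat • evalAt w' m φ y = evalAt w' n φ y := by
    intro m hm y hy
    simp only [evalAt, Finsupp.linearCombination_apply, Finsupp.sum, Finset.smul_sum]
    refine Finset.sum_congr rfl fun c hc => ?_
    have hc' : cubeWeight w' c ≤ m := hy hc
    rw [smul_comm _ (y c), smul_smul, ← pow_add]
    congr 3
    omega
  rw [Finsupp.supported_eq_span_single] at hx
  induction hx using Submodule.span_induction with
  | mem x hx =>
    obtain ⟨c, hc, rfl⟩ := hx
    simp only [evalAt_single, pull_apply]
    exact shift hc (hf c)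
  | zero => simp
  | add x y _ _ hx hy => rw [map_add, map_add, map_add, hx, hy]
  | smul a x _ hx => rw [map_smul, map_smul, map_smul, hx]

theorem pull_comp {w : (ι → R) → ℤ} {w' : (ι' → R') → ℤ} {w'' : (ι'' → R'') → ℤ}
    {f : Chain ι R →ₗ[ℤ] Chain ι' R'} {g : Chain ι' R' →ₗ[ℤ] Chain ι'' R''}
    (hg : Filtered w' w'' g) (hf : Filtered w w' f) (φ : TotalCochain ι'' R'') :
    pull w w' f (pull w' w'' g φ) = pull w w'' (g ∘ₗ f) φ := by
  funext c
  rw [pull_apply, evalAt_pull hg _ _ (hf c)]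
  rfl

theorem pull_id (w : (ι → R) → ℤ) (φ : TotalCochain ι R) : pull w w LinearMap.id φ = φ := by
  funext c
  simp [pull_apply, evalAt_single]

theorem pull_sub (w : (ι → R) → ℤ) (w' : (ι' → R') → ℤ) (f g : Chain ι R →ₗ[ℤ] Chain ι' R')
    (φ : TotalCochain ι' R') : pull w w' (f - g) φ = pull w w' f φ - pull w w' g φ := by
  funext c; simp [pull_apply]

/-- A total cochain that vanishes outside the cubes of the dimensions with `P`. -/
def InDim (P : ℕ → Prop) (φ : TotalCochain ι R) : Prop := ∀ c, ¬ P c.2.card → φ c = 0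

/-- Homogeneity of total cochains. -/
def TotalHomogeneous (w : (ι → R) → ℤ) (d : ℤ) (φ : TotalCochain ι R) : Prop :=
  ∀ c, φ c ∈ TPlus.homogeneous (d - 2 * cubeWeight w c)

theorem evalAt_mem (w : (ι → R) → ℤ) (n : ℤ) (φ : TotalCochain ι R) {T : AddSubgroup TPlus}
    {S : Set ((ι → R) × Finset ι)} (h : ∀ c ∈ S, (X : ℤ[X]) ^ (n - cubeWeight w c).toNat • φ c ∈ T)
    {x : Chain ι R} (hx : x ∈ Finsupp.supported ℤ ℤ S) : evalAt w n φ x ∈ T := by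
  simp only [evalAt, Finsupp.linearCombination_apply, Finsupp.sum]
  exact sum_mem fun c hc => zsmul_mem (h c (hx hc)) _

/-- The inserted power of U lowers the degree by twice the drop in weight, which is exactly the
difference between the degrees required on the two cubes. -/
theorem TotalHomogeneous.pull {w : (ι → R) → ℤ} {w' : (ι' → R') → ℤ}
    {f : Chain ι R →ₗ[ℤ] Chain ι' R'} (hf : Filtered w w' f) {d : ℤ} {φ : TotalCochain ι' R'}
    (hφ : TotalHomogeneous w' d φ) : TotalHomogeneous w d (pull w w' f φ) := fun c => by
  refine evalAt_mem _ _ _ (fun c' hc' => ?_) (hf c)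
  have hc'' : cubeWeight w' c' ≤ cubeWeight w c := hc'
  have := TPlus.X_pow_smul_mem (hφ c') (cubeWeight w c - cubeWeight w' c').toNat
  convert this using 2
  rw [Int.toNat_of_nonneg (by omega)]
  ring

theorem InDim.pull {w : (ι → R) → ℤ} {w' : (ι' → R') → ℤ} {r : ℕ → ℕ → Prop}
    {f : Chain ι R →ₗ[ℤ] Chain ι' R'} (hf : DimRel r f) {P Q : ℕ → Prop} {φ : TotalCochain ι' R'}
    (hφ : InDim P φ) (h : ∀ p q, r p q → P q → Q p) : InDim Q (pull w w' f φ) := fun c hc => by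
  refine AddSubgroup.mem_bot.mp (evalAt_mem w' (cubeWeight w c) φ (T := ⊥) (fun c' hc' => ?_) (hf c))
  rw [hφ c' fun hP => hc (h _ _ hc' hP), smul_zero]
  exact zero_mem _

/-! ### Comparison with the cochains of a given dimension -/

/-- Extension by zero of a cochain to all dimensions. -/
noncomputable def extend {q : ℕ} (φ : Cochain ι R q) : TotalCochain ι R := fun c =>
  if h : c.2.card = q then φ ⟨c.1, c.2, h⟩ else 0

theorem extend_apply {q : ℕ} (φ : Cochain ι R q) (c : Cube ι R q) :
    extend φ (c.base, c.dirs) = φ c := by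
  simp [extend, c.card_dirs]

/-- The part of dimension `q` of a total cochain. -/
def restrict (q : ℕ) : TotalCochain ι R →ₗ[ℤ[X]] Cochain ι R q where
  toFun φ c := φ (c.base, c.dirs)
  map_add' _ _ := rfl
  map_smul' _ _ := rfl

theorem restrict_extend {q : ℕ} (φ : Cochain ι R q) : restrict q (extend φ) = φ := by
  funext c; exact extend_apply φ c

theorem inDim_extend {q : ℕ} (φ : Cochain ι R q) : InDim (· = q) (extend φ) := fun _ hc => by
  simp [extend, hc]

theorem extend_restrict {q : ℕ} {φ : TotalCochain ι R} (h : InDim (· = q) φ) :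
    extend (restrict q φ) = φ := by
  funext c
  by_cases hc : c.2.card = q
  · simp [extend, hc, restrict]
  · rw [inDim_extend _ c hc, h c hc]

theorem extend_sub {q : ℕ} (φ ψ : Cochain ι R q) : extend (φ - ψ) = extend φ - extend ψ := by
  funext c
  by_cases hc : c.2.card = q <;> simp [extend, hc]

theorem extend_injective {q : ℕ} : Function.Injective (extend : Cochain ι R q → _) :=
  Function.LeftInverse.injective restrict_extend

theorem extend_zero {q : ℕ} : extend (0 : Cochain ι R q) = 0 := by
  funext c
  simp [extend]

/-- The bridge between the definition of the cohomology and the chain level: identities between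
operators on integral chains become identities between operators on cochains. -/
theorem extend_coboundary (w : (ι → R) → ℤ) {q : ℕ} (φ : Cochain ι R q) :
    extend (coboundary w q φ) = pull w w boundary (extend φ) := by
  have hd : InDim (· = q + 1) (pull w w boundary (extend φ)) :=
    (inDim_extend φ).pull dimRel_boundary fun p q h h' => by omega
  funext c
  by_cases hc : c.2.card = q + 1
  · rw [extend, dif_pos hc, pull_apply, boundary_single, map_sum]
    simp only [coboundary, LinearMap.coe_mk, AddHom.coe_mk]
    rw [Finset.sum_coe_sort_eq_attach, ← Finset.sum_attach c.2]
    refine Finset.sum_congr rfl fun j _ => ?_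
    rw [map_smul, facePair, map_sub, evalAt_single, evalAt_single]
    have h1 := extend_apply φ (Cube.upperFace ⟨c.1, c.2, hc⟩ j.1 j.2)
    have h2 := extend_apply φ (Cube.lowerFace ⟨c.1, c.2, hc⟩ j.1 j.2)
    rw [← h1, ← h2]
    rfl
  · rw [inDim_extend _ c hc, hd c hc]

theorem mem_cocycles_iff (w : (ι → R) → ℤ) {q : ℕ} (φ : Cochain ι R q) :
    φ ∈ cocycles w q ↔ pull w w boundary (extend φ) = 0 := by
  rw [cocycles, LinearMap.mem_ker, ← extend_coboundary]
  constructor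
  · intro h; rw [h, extend_zero]
  · intro h; exact extend_injective (h.trans extend_zero.symm)

/-- Asking ψ to live in the dimensions p with p + 1 = q treats all q alike: for q = 0 there is no
such dimension and ψ vanishes. -/
theorem mem_coboundaries_of_eq (w : (ι → R) → ℤ) {q : ℕ} {φ : Cochain ι R q}
    {ψ : TotalCochain ι R} (hψ : InDim (fun p => p + 1 = q) ψ)
    (h : extend φ = pull w w boundary ψ) : φ ∈ coboundaries w q := by
  cases q with
  | zero =>
    have : ψ = 0 := by funext c; exact hψ c (by simp)
    rw [this, map_zero] at h
    exact extend_injective (h.trans extend_zero.symm)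
  | succ q =>
    refine ⟨restrict q ψ, extend_injective ?_⟩
    rw [extend_coboundary, extend_restrict, h]
    exact fun c hc => hψ c (by simpa using hc)

theorem exists_of_mem_coboundaries (w : (ι → R) → ℤ) {q : ℕ} {φ : Cochain ι R q}
    (h : φ ∈ coboundaries w q) :
    ∃ ψ : TotalCochain ι R, InDim (fun p => p + 1 = q) ψ ∧ extend φ = pull w w boundary ψ := by
  cases q with
  | zero =>
    refine ⟨0, fun _ _ => rfl, ?_⟩
    have : φ = 0 := h
    rw [this, extend_zero, map_zero]
  | succ q =>
    obtain ⟨ψ, rfl⟩ := h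
    exact ⟨extend ψ, fun c hc => inDim_extend ψ c (by simpa using hc), extend_coboundary w ψ⟩

theorem isHomogeneous_iff (w : (ι → R) → ℤ) {q : ℕ} (d : ℤ) (φ : Cochain ι R q) :
    IsHomogeneous w d φ ↔ TotalHomogeneous w d (extend φ) := by
  constructor
  · intro h c
    by_cases hc : c.2.card = q
    · have := h ⟨c.1, c.2, hc⟩
      rw [← extend_apply φ] at this
      exact this
    · rw [inDim_extend _ c hc]; exact zero_mem _
  · intro h c
    have := h (c.base, c.dirs)
    rw [extend_apply φ] at this
    exact this

/-! ### Isomorphisms of lattice cohomology -/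

/-- The lattice cohomologies of two weight functions are isomorphic as graded `ℤ[U]`-modules. -/
def CohomologyIso (w : (ι → R) → ℤ) (w' : (ι' → R') → ℤ) : Prop :=
  ∃ e : ∀ q : ℕ, Cohomology w q ≃ₗ[ℤ[X]] Cohomology w' q,
    ∀ (q : ℕ) (d : ℤ) (x : Cohomology w q),
      e q x ∈ cohomologyDegree w' q d ↔ x ∈ cohomologyDegree w q d

theorem CohomologyIso.trans {w : (ι → R) → ℤ} {w' : (ι' → R') → ℤ} {w'' : (ι'' → R'') → ℤ}
    (h : CohomologyIso w w') (h' : CohomologyIso w' w'') : CohomologyIso w w'' := by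
  obtain ⟨e, he⟩ := h
  obtain ⟨e', he'⟩ := h'
  exact ⟨fun q => (e q).trans (e' q), fun q d x => (he' q d _).trans (he q d x)⟩

theorem CohomologyIso.refl (w : (ι → R) → ℤ) : CohomologyIso w w :=
  ⟨fun _ => LinearEquiv.refl _ _, fun _ _ _ => Iff.rfl⟩

/-- The map of cochains of dimension `q` induced by a map of chains. -/
noncomputable def pullDim (w : (ι → R) → ℤ) (w' : (ι' → R') → ℤ) (f : Chain ι R →ₗ[ℤ] Chain ι' R')
    (q : ℕ) : Cochain ι' R' q →ₗ[ℤ[X]] Cochain ι R q where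
  toFun φ := restrict q (pull w w' f (extend φ))
  map_add' φ ψ := by
    have : extend (φ + ψ) = extend φ + extend ψ := by
      funext c; by_cases hc : c.2.card = q <;> simp [extend, hc]
    rw [this, map_add, map_add]
  map_smul' p φ := by
    have : extend (p • φ) = p • extend φ := by
      funext c; by_cases hc : c.2.card = q <;> simp [extend, hc]
    rw [this, map_smul, map_smul]; rfl

/-- A filtered chain map. -/
structure FilteredChainMap (w : (ι → R) → ℤ) (w' : (ι' → R') → ℤ)
    (f : Chain ι R →ₗ[ℤ] Chain ι' R') : Prop where
  filtered : Filtered w w' f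
  dim : DimRel (fun p q => q = p) f
  comm : boundary ∘ₗ f = f ∘ₗ boundary

/-- A filtered chain homotopy. -/
structure FilteredHomotopy (w : (ι → R) → ℤ) (K : Chain ι R →ₗ[ℤ] Chain ι R) : Prop where
  filtered : Filtered w w K
  dim : DimRel (fun p q => q = p + 1) K

section ChainMap

variable {w : (ι → R) → ℤ} {w' : (ι' → R') → ℤ} {f : Chain ι R →ₗ[ℤ] Chain ι' R'}
  {g : Chain ι' R' →ₗ[ℤ] Chain ι R}

theorem FilteredChainMap.extend_pullDim (hf : FilteredChainMap w w' f) {q : ℕ}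
    (φ : Cochain ι' R' q) : extend (pullDim w w' f q φ) = pull w w' f (extend φ) :=
  extend_restrict ((inDim_extend φ).pull hf.dim fun p q h h' => by omega)

theorem FilteredChainMap.pull_boundary (hf : FilteredChainMap w w' f) (φ : TotalCochain ι' R') :
    pull w w boundary (pull w w' f φ) = pull w w' f (pull w' w' boundary φ) := by
  rw [pull_comp hf.filtered (filtered_boundary w), pull_comp (filtered_boundary w') hf.filtered,
    hf.comm]

theorem FilteredChainMap.mapsTo_cocycles (hf : FilteredChainMap w w' f) {q : ℕ} :
    ∀ φ ∈ cocycles w' q, pullDim w w' f q φ ∈ cocycles w q := fun φ hφ => by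
  rw [mem_cocycles_iff] at hφ ⊢
  rw [hf.extend_pullDim, hf.pull_boundary, hφ, map_zero]

theorem FilteredChainMap.mapsTo_coboundaries (hf : FilteredChainMap w w' f) {q : ℕ} :
    ∀ φ ∈ coboundaries w' q, pullDim w w' f q φ ∈ coboundaries w q := fun φ hφ => by
  obtain ⟨ψ, hψ, h⟩ := exists_of_mem_coboundaries w' hφ
  refine mem_coboundaries_of_eq w (ψ := pull w w' f ψ)
    (hψ.pull hf.dim fun p q h h' => by omega) ?_
  rw [hf.extend_pullDim, hf.pull_boundary, h]

/-- The map of lattice cohomologies induced by a filtered chain map. -/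
noncomputable def FilteredChainMap.cohomologyMap (hf : FilteredChainMap w w' f) (q : ℕ) :
    Cohomology w' q →ₗ[ℤ[X]] Cohomology w q :=
  Submodule.mapQ _ _ ((pullDim w w' f q).restrict hf.mapsTo_cocycles) fun φ hφ =>
    hf.mapsTo_coboundaries φ.1 hφ

theorem FilteredChainMap.cohomologyMap_mem (hf : FilteredChainMap w w' f) {q : ℕ} {d : ℤ}
    {x : Cohomology w' q} (hx : x ∈ cohomologyDegree w' q d) :
    hf.cohomologyMap q x ∈ cohomologyDegree w q d := by
  obtain ⟨φ, hφ, rfl⟩ := hx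
  refine ⟨_, ?_, (Submodule.mapQ_apply _ _ _ φ).symm⟩
  rw [isHomogeneous_iff] at hφ ⊢
  change TotalHomogeneous w d (extend (pullDim w w' f q φ.1))
  rw [hf.extend_pullDim]
  exact hφ.pull hf.filtered

/-- Pulling back reverses compositions. On a cocycle the term of `boundary ∘ₗ K` vanishes, and the
term of `K ∘ₗ boundary` is the coboundary of the pullback along `K`. -/
theorem cohomologyMap_comp_eq (hf : FilteredChainMap w w' f) (hg : FilteredChainMap w' w g)
    {K : Chain ι R →ₗ[ℤ] Chain ι R} (hK : FilteredHomotopy w K)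
    (h : g ∘ₗ f = LinearMap.id - boundary ∘ₗ K - K ∘ₗ boundary) (q : ℕ) (x : Cohomology w q) :
    hf.cohomologyMap q (hg.cohomologyMap q x) = x := by
  obtain ⟨φ, rfl⟩ := Submodule.Quotient.mk_surjective _ x
  refine (Submodule.Quotient.eq _).mpr ?_
  change pullDim w w' f q (pullDim w' w g q φ.1) - φ.1 ∈ coboundaries w q
  rw [← neg_sub]
  refine neg_mem (mem_coboundaries_of_eq w (ψ := pull w w K (extend φ.1))
    ((inDim_extend φ.1).pull hK.dim fun p q h h' => by omega) ?_)
  have hφ := (mem_cocycles_iff w φ.1).mp φ.2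
  rw [extend_sub, hf.extend_pullDim, hg.extend_pullDim, pull_comp hg.filtered hf.filtered, h,
    pull_sub, pull_sub, pull_id, ← pull_comp hK.filtered (filtered_boundary w),
    ← pull_comp (filtered_boundary w) hK.filtered, hφ, map_zero]
  abel

theorem CohomologyIso.of_homotopyEquiv (hf : FilteredChainMap w w' f)
    (hg : FilteredChainMap w' w g)
    {K : Chain ι R →ₗ[ℤ] Chain ι R} (hK : FilteredHomotopy w K)
    (h : g ∘ₗ f = LinearMap.id - boundary ∘ₗ K - K ∘ₗ boundary)
    {K' : Chain ι' R' →ₗ[ℤ] Chain ι' R'} (hK' : FilteredHomotopy w' K')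
    (h' : f ∘ₗ g = LinearMap.id - boundary ∘ₗ K' - K' ∘ₗ boundary) : CohomologyIso w w' := by
  refine ⟨fun q => LinearEquiv.ofLinearMap (hg.cohomologyMap q) (hf.cohomologyMap q)
    (LinearMap.ext fun x => cohomologyMap_comp_eq hg hf hK' h' q x)
    (LinearMap.ext fun x => cohomologyMap_comp_eq hf hg hK h q x), fun q d x => ?_⟩
  constructor
  · intro hx
    have := hf.cohomologyMap_mem hx
    rwa [LinearEquiv.coe_ofLinearMap, cohomologyMap_comp_eq hf hg hK h] at this
  · exact hg.cohomologyMap_mem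

end ChainMap

end General

end LatticeCohomology

namespace LatticeCohomology

/-! ### Discrete primitives -/

section Primitive

variable {M N : Type*} [AddCommGroup M] [AddCommGroup N]

/-- The discrete primitive of `g` that vanishes at `0`. -/
noncomputable def primitive (g : ℤ → M) (n : ℤ) : M :=
  ∑ k ∈ Finset.Ico 0 n, g k - ∑ k ∈ Finset.Ico n 0, g k

theorem primitive_succ (g : ℤ → M) (n : ℤ) : primitive g (n + 1) = primitive g n + g n := by
  rcases le_or_gt 0 n with h | h
  · have h1 : Finset.Ico 0 (n + 1) = insert n (Finset.Ico 0 n) := by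
      ext a; simp only [Finset.mem_Ico, Finset.mem_insert]; omega
    rw [primitive, primitive, h1, Finset.sum_insert (by simp), Finset.Ico_eq_empty (a := n + 1) (by omega),
      Finset.Ico_eq_empty (a := n) (by omega)]
    simp [add_comm]
  · have h1 : Finset.Ico n 0 = insert n (Finset.Ico (n + 1) 0) := by
      ext a; simp only [Finset.mem_Ico, Finset.mem_insert]; omega
    rw [primitive, primitive, h1, Finset.sum_insert (by simp), Finset.Ico_eq_empty (b := n + 1) (by omega),
      Finset.Ico_eq_empty (b := n) (by omega)]
    abel

theorem sub_eq_sub_of_succ {F : ℤ → M} {F' : ℤ → M} (h : ∀ n, F (n + 1) - F n = F' (n + 1) - F' n)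
    (a b : ℤ) : F b - F a = F' b - F' a := by
  have key : ∀ n, F n - F' n = F 0 - F' 0 := by
    intro n
    induction n using Int.induction_on with
    | zero => rfl
    | succ n ih =>
      rw [← ih]
      exact sub_eq_sub_iff_sub_eq_sub.mp (h n)
    | pred n ih =>
      rw [← ih]
      have := h (-(n : ℤ) - 1)
      rw [sub_add_cancel] at this
      exact (sub_eq_sub_iff_sub_eq_sub.mp this).symm
  exact sub_eq_sub_iff_sub_eq_sub.mp ((key b).trans (key a).symm)

theorem primitive_sub_mem {S : Type*} [SetLike S M] [AddSubgroupClass S M] (P : S) {g : ℤ → M}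
    {a b : ℤ} (h : ∀ n, min a b ≤ n → n < max a b → g n ∈ P) :
    primitive g b - primitive g a ∈ P := by
  have key : ∀ a b : ℤ, a ≤ b → (∀ n, a ≤ n → n < b → g n ∈ P) →
      primitive g b - primitive g a ∈ P := by
    intro a b hab
    induction b, hab using Int.leInduction with
    | base => intro _; rw [sub_self]; exact zero_mem _
    | succ n hn ih =>
      intro h
      rw [primitive_succ, add_sub_right_comm]
      exact add_mem (ih fun k h1 h2 => h k h1 (by omega)) (h n hn (by omega))
  rcases le_total a b with hab | hab
  · exact key a b hab fun n h1 h2 => h n (by omega) (by omega)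
  · rw [← neg_sub]
    exact neg_mem (key b a hab fun n h1 h2 => h n (by omega) (by omega))

end Primitive

/-! ### Prism homotopies along one coordinate direction -/

section Line

variable {ι : Type*} [LinearOrder ι]

/-- The signed sum of the cubes `(l, I ∪ {v})` with `l_v` running from `a` to `b`. -/
noncomputable def vertPath (l : ι → ℤ) (I : Finset ι) (v : ι) (a b : ℤ) : Chain ι ℤ :=
  primitive (fun n => Finsupp.single (Function.update l v n, insert v I) 1) b -
    primitive (fun n => Finsupp.single (Function.update l v n, insert v I) 1) a

theorem vertPath_self (l : ι → ℤ) (I : Finset ι) (v : ι) (a : ℤ) : vertPath l I v a a = 0 :=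
  sub_self _

theorem vertPath_sub (l : ι → ℤ) (I : Finset ι) (v : ι) (a b c : ℤ) :
    vertPath l I v a c - vertPath l I v b c = vertPath l I v a b := by
  simp only [vertPath]; abel

theorem vertPath_succ (l : ι → ℤ) (I : Finset ι) (v : ι) (a : ℤ) :
    vertPath l I v a (a + 1) = Finsupp.single (Function.update l v a, insert v I) 1 := by
  rw [vertPath, primitive_succ]; abel

theorem vertPath_congr {l l' : ι → ℤ} {v : ι} (h : ∀ j, j ≠ v → l j = l' j) (I : Finset ι)
    (a b : ℤ) : vertPath l I v a b = vertPath l' I v a b := by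
  have : ∀ n, Function.update l v n = Function.update l' v n := by
    intro n; funext j
    by_cases hj : j = v
    · subst hj; simp
    · simp [hj, h j hj]
  simp only [vertPath, this]

theorem vertPath_mem (P : Submodule ℤ (Chain ι ℤ)) {l : ι → ℤ} {I : Finset ι} {v : ι} {a b : ℤ}
    (h : ∀ n, min a b ≤ n → n < max a b →
      (Finsupp.single (Function.update l v n, insert v I) 1 : Chain ι ℤ) ∈ P) :
    vertPath l I v a b ∈ P :=
  primitive_sub_mem P h

theorem translate_update_self (l : ι → ℤ) (v : ι) (n : ℤ) :
    translate (Function.update l v n) {v} = Function.update l v (n + 1) := by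
  funext j
  by_cases hj : j = v
  · subst hj; simp [translate]
  · simp [translate, hj]

theorem translate_update (l : ι → ℤ) {v : ι} {A : Finset ι} (h : v ∉ A) (n : ℤ) :
    translate (Function.update l v n) A = Function.update (translate l A) v n := by
  funext j
  by_cases hj : j = v
  · subst hj; simp [translate, h]
  · simp [translate, hj]

theorem translate_update_insert (l : ι → ℤ) {v : ι} {A : Finset ι} (h : v ∉ A) (n : ℤ) :
    translate (Function.update l v n) (insert v A) = Function.update (translate l A) v (n + 1) := by
  rw [← translate_insert _ h, translate_update_self, translate_update _ h]

/-- A stack of cubes is a cube times an interval: the horizontal faces telescope to the two ends,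
and the lateral faces are stacks over the faces of the cube. -/
theorem boundary_vertPath (l : ι → ℤ) {I : Finset ι} {v : ι} (hv : v ∉ I) (a b : ℤ) :
    boundary (vertPath l I v a b) =
      orient I v • (Finsupp.single (Function.update l v b, I) 1 -
        Finsupp.single (Function.update l v a, I) 1) +
      ∑ j ∈ I, orient (insert v I) j • (vertPath (translate l {j}) (I.erase j) v a b -
        vertPath l (I.erase j) v a b) := by
  let p : (ι → ℤ) → Finset ι → ℤ → Chain ι ℤ := fun l I =>
    primitive (fun n => Finsupp.single (Function.update l v n, insert v I) 1)
  -- Both sides are differences of functions of the height, so it is enough to compare unit steps,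
  -- where the identity is the boundary formula of one cube.
  have key := sub_eq_sub_of_succ (F := fun n => boundary (p l I n))
    (F' := fun n => orient I v • (Finsupp.single (Function.update l v n, I) 1 : Chain ι ℤ) +
      ∑ j ∈ I, orient (insert v I) j • (p (translate l {j}) (I.erase j) n -
        p l (I.erase j) n)) (fun n => ?_) a b
  · rw [vertPath, map_sub]
    refine key.trans ?_
    rw [add_sub_add_comm, ← smul_sub, ← Finset.sum_sub_distrib]
    congr 1
    refine Finset.sum_congr rfl fun j _ => ?_
    rw [← smul_sub, vertPath, vertPath, sub_sub_sub_comm]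
  · simp only [p, primitive_succ, map_add, add_sub_cancel_left]
    rw [boundary_single, Finset.sum_insert hv, orient_insert_self, facePair,
      translate_update_self, Finset.erase_insert hv, add_sub_add_comm, ← smul_sub,
      ← Finset.sum_sub_distrib]
    congr 1
    refine Finset.sum_congr rfl fun j hj => ?_
    have hjv : v ≠ j := fun h => hv (h ▸ hj)
    rw [← smul_sub, facePair, translate_update _ (by simpa using hjv),
      Finset.erase_insert_of_ne hjv]
    congr 1
    abel

/-- The homotopy that moves the cube `c` along the direction `v` to the level `M c`. -/
noncomputable def lineHomotopy (v : ι) (M : (ι → ℤ) × Finset ι → ℤ) : Chain ι ℤ →ₗ[ℤ] Chain ι ℤ :=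
  Finsupp.linearCombination ℤ fun c =>
    if v ∈ c.2 then 0 else orient c.2 v • vertPath c.1 c.2 v (M c) (c.1 v)

variable (v : ι) (M : (ι → ℤ) × Finset ι → ℤ)

theorem lineHomotopy_of_mem {c : (ι → ℤ) × Finset ι} (h : v ∈ c.2) :
    lineHomotopy v M (Finsupp.single c 1) = 0 := by
  simp [lineHomotopy, h]

theorem lineHomotopy_of_notMem {c : (ι → ℤ) × Finset ι} (h : v ∉ c.2) :
    lineHomotopy v M (Finsupp.single c 1) =
      orient c.2 v • vertPath c.1 c.2 v (M c) (c.1 v) := by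
  simp [lineHomotopy, h]

theorem dimRel_lineHomotopy : DimRel (fun p q => q = p + 1) (lineHomotopy v M) := fun c => by
  by_cases h : v ∈ c.2
  · rw [lineHomotopy_of_mem v M h]; exact zero_mem _
  · rw [lineHomotopy_of_notMem v M h]
    exact Submodule.smul_mem _ _ (vertPath_mem _ fun n _ _ =>
      single_mem (Finset.card_insert_of_notMem h))

/-- The chain map at the end of the homotopy `lineHomotopy v M`. -/
noncomputable def linePush : Chain ι ℤ →ₗ[ℤ] Chain ι ℤ :=
  LinearMap.id - boundary ∘ₗ lineHomotopy v M - lineHomotopy v M ∘ₗ boundary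

/-- The cube is moved to its own level and its faces to theirs. The vertical walls in the sum close
the gaps between these levels; without them the result would not be a chain map. -/
theorem linePush_of_notMem {l : ι → ℤ} {I : Finset ι} (h : v ∉ I) :
    linePush v M (Finsupp.single (l, I) 1) = Finsupp.single (Function.update l v (M (l, I)), I) 1 +
      ∑ j ∈ I, (orient I j * orient (I.erase j) v) •
        (vertPath (translate l {j}) (I.erase j) v (M (l, I)) (M (translate l {j}, I.erase j)) -
          vertPath l (I.erase j) v (M (l, I)) (M (l, I.erase j))) := by
  simp only [linePush, LinearMap.sub_apply, LinearMap.comp_apply, LinearMap.id_apply]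
  rw [lineHomotopy_of_notMem v M h, map_smul, boundary_vertPath l h, boundary_single, map_sum,
    smul_add, smul_smul, orient_mul_self, one_smul, Function.update_eq_self, sub_add_eq_sub_sub,
    sub_sub_cancel, sub_sub, sub_eq_add_neg, Finset.smul_sum, ← Finset.sum_add_distrib,
    ← Finset.sum_neg_distrib]
  congr 1
  refine Finset.sum_congr rfl fun j hj => ?_
  have hvj : v ≠ j := fun e => h (e ▸ hj)
  have hv' : v ∉ I.erase j := fun e => h (Finset.mem_of_mem_erase e)
  have hs : orient I v * orient (insert v I) j = -(orient I j * orient (I.erase j) v) := by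
    have := orient_mul_orient_erase (Finset.mem_insert_self v I) (Finset.mem_insert_of_mem hj) hvj
    rw [Finset.erase_insert h, orient_insert_self, Finset.erase_insert_of_ne hvj,
      orient_insert_self] at this
    -- The anticommutation of the two directions, multiplied by signs whose squares are one.
    linear_combination (orient (insert v I) j * orient I j) * this
      - (orient I v * orient (insert v I) j) * orient_mul_self I j
      - (orient I j * orient (I.erase j) v) * orient_mul_self (insert v I) j
  rw [map_smul, facePair, map_sub, lineHomotopy_of_notMem v M hv', lineHomotopy_of_notMem v M hv',
    smul_smul, hs, ← smul_sub, smul_smul, neg_smul, neg_add, neg_neg, ← sub_eq_add_neg, ← smul_sub]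
  change _ • (_ - (vertPath (translate l {j}) (I.erase j) v _ (translate l {j} v) - _)) = _
  rw [translate_of_notMem (j := v) l (by simpa using hvj), sub_sub_sub_comm, vertPath_sub,
    vertPath_sub]

/-- The stacks over the two ends of a vertical cube, together with the cube itself, overlap and
cancel down to the wall between the levels of the ends. -/
theorem linePush_of_mem {l : ι → ℤ} {I : Finset ι} (h : v ∈ I) :
    linePush v M (Finsupp.single (l, I) 1) =
      vertPath l (I.erase v) v (M (l, I.erase v)) (M (translate l {v}, I.erase v)) := by
  simp only [linePush, LinearMap.sub_apply, LinearMap.comp_apply, LinearMap.id_apply]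
  rw [lineHomotopy_of_mem v M h, map_zero, sub_zero, boundary_single, map_sum,
    Finset.sum_eq_single_of_mem v h]
  · rw [map_smul, facePair, map_sub, lineHomotopy_of_notMem v M (by simp),
      lineHomotopy_of_notMem v M (by simp), ← smul_sub, smul_smul, orient_erase_self,
      orient_mul_self, one_smul]
    have e : (Finsupp.single (l, I) 1 : Chain ι ℤ) = vertPath l (I.erase v) v (l v) (l v + 1) := by
      rw [vertPath_succ, Function.update_eq_self, Finset.insert_erase h]
    have e2 : ∀ a b, vertPath (translate l {v}) (I.erase v) v a b = vertPath l (I.erase v) v a b :=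
      fun a b => vertPath_congr (fun j hj => translate_of_notMem l (by simpa using hj)) _ _ _
    rw [e, e2]
    change _ - (vertPath l (I.erase v) v _ (translate l {v} v) - _) = _
    rw [translate_of_mem l (Finset.mem_singleton_self v)]
    simp only [vertPath]
    abel
  · intro j hj hjv
    have hv' : v ∈ I.erase j := Finset.mem_erase.mpr ⟨Ne.symm hjv, h⟩
    rw [map_smul, facePair, map_sub, lineHomotopy_of_mem v M hv', lineHomotopy_of_mem v M hv',
      sub_zero, smul_zero]

/-- A linear map that differs from the identity by a homotopy is a chain map. -/
theorem boundary_comp_of_homotopy {R : Type*} [AddMonoidWithOne R] (K : Chain ι R →ₗ[ℤ] Chain ι R) :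
    boundary ∘ₗ (LinearMap.id - boundary ∘ₗ K - K ∘ₗ boundary) =
      (LinearMap.id - boundary ∘ₗ K - K ∘ₗ boundary) ∘ₗ boundary := by
  ext1 c
  refine LinearMap.ext_ring ?_
  simp [boundary_boundary]

/-- Maps homotopic to the identity compose, with an explicit homotopy of the composite. This allows
retractions in different directions to be chained. -/
theorem homotopy_comp {R : Type*} [AddMonoidWithOne R] (K H : Chain ι R →ₗ[ℤ] Chain ι R) :
    (LinearMap.id - boundary ∘ₗ K - K ∘ₗ boundary) ∘ₗ
        (LinearMap.id - boundary ∘ₗ H - H ∘ₗ boundary) =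
      LinearMap.id -
        boundary ∘ₗ (K ∘ₗ (LinearMap.id - boundary ∘ₗ H - H ∘ₗ boundary) + H) -
        (K ∘ₗ (LinearMap.id - boundary ∘ₗ H - H ∘ₗ boundary) + H) ∘ₗ boundary := by
  ext1 c
  refine LinearMap.ext_ring ?_
  simp only [LinearMap.comp_apply, LinearMap.sub_apply, LinearMap.add_apply, LinearMap.id_apply,
    map_sub, map_add, boundary_boundary, map_zero]
  abel

theorem dimRel_of_homotopy {R : Type*} [AddMonoidWithOne R] {K : Chain ι R →ₗ[ℤ] Chain ι R}
    (hK : DimRel (fun p q => q = p + 1) K) :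
    DimRel (fun p q => q = p) (LinearMap.id - boundary ∘ₗ K - K ∘ₗ boundary) := fun c => by
  refine sub_mem (sub_mem (single_mem rfl) ?_) ?_
  · exact dimRel_boundary.comp (r'' := fun p q => q = p) hK (fun _ _ _ h h' => by omega) c
  · exact hK.comp (r'' := fun p q => q = p) dimRel_boundary (fun _ _ _ h h' => by omega) c

theorem filtered_of_homotopy {R : Type*} [AddMonoidWithOne R] {w : (ι → R) → ℤ}
    {K : Chain ι R →ₗ[ℤ] Chain ι R} (hK : Filtered w w K) :
    Filtered w w (LinearMap.id - boundary ∘ₗ K - K ∘ₗ boundary) :=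
  ((Filtered.id fun _ => le_rfl).sub ((filtered_boundary w).comp hK)).sub
    (hK.comp (filtered_boundary w))

/-- Comparison of two weight functions on the same lattice. -/
theorem CohomologyIso.of_le {R : Type*} [AddMonoidWithOne R] {w w' : (ι → R) → ℤ}
    (hle : ∀ x, w' x ≤ w x) {K : Chain ι R →ₗ[ℤ] Chain ι R} (hK : FilteredHomotopy w K)
    (hK' : FilteredHomotopy w' K)
    (hG : Filtered w' w (LinearMap.id - boundary ∘ₗ K - K ∘ₗ boundary)) : CohomologyIso w w' :=
  CohomologyIso.of_homotopyEquiv (f := LinearMap.id)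
    ⟨Filtered.id hle, fun _ => single_mem rfl, rfl⟩
    ⟨hG, dimRel_of_homotopy hK.dim, boundary_comp_of_homotopy K⟩ hK rfl hK' rfl

theorem single_vert_mem_cubesIn {S : Set (ι → ℤ)} {l : ι → ℤ} {I : Finset ι} {v : ι} {n : ℤ}
    (h0 : ∀ A ⊆ I, Function.update (translate l A) v n ∈ S)
    (h1 : ∀ A ⊆ I, Function.update (translate l A) v (n + 1) ∈ S) :
    (Function.update l v n, insert v I) ∈ cubesIn S := by
  intro A hA
  by_cases hvA : v ∈ A
  · rw [← Finset.insert_erase hvA]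
    change translate (Function.update l v n) _ ∈ S
    rw [translate_update_insert _ (by simp)]
    refine h1 _ fun a ha => ?_
    rw [Finset.mem_erase] at ha
    exact (Finset.mem_insert.mp (hA ha.2)).resolve_left ha.1
  · change translate (Function.update l v n) _ ∈ S
    rw [translate_update _ hvA]
    exact h0 _ fun a ha => (Finset.mem_insert.mp (hA ha)).resolve_left fun e => hvA (e ▸ ha)

theorem vertPath_mem_cubesIn {S : Set (ι → ℤ)} {l : ι → ℤ} {I : Finset ι} {v : ι} {a b : ℤ}
    (h : ∀ A ⊆ I, ∀ n, min a b ≤ n → n ≤ max a b → Function.update (translate l A) v n ∈ S) :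
    vertPath l I v a b ∈ Finsupp.supported ℤ ℤ (cubesIn S) :=
  vertPath_mem _ fun n h1 h2 => single_mem (single_vert_mem_cubesIn
    (fun A hA => h A hA n h1 h2.le) fun A hA => h A hA (n + 1) (by omega) h2)

/-- The homotopy stays in `S` if it does so at the vertices. -/
theorem lineHomotopy_mem_cubesIn {S : Set (ι → ℤ)} {c : (ι → ℤ) × Finset ι}
    (h : v ∉ c.2 → ∀ A ⊆ c.2, ∀ n, min (M c) (c.1 v) ≤ n → n ≤ max (M c) (c.1 v) →
      Function.update (translate c.1 A) v n ∈ S) :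
    lineHomotopy v M (Finsupp.single c 1) ∈ Finsupp.supported ℤ ℤ (cubesIn S) := by
  by_cases hv : v ∈ c.2
  · rw [lineHomotopy_of_mem v M hv]; exact zero_mem _
  · rw [lineHomotopy_of_notMem v M hv]
    exact Submodule.smul_mem _ _ (vertPath_mem_cubesIn (h hv))

/-- A cube has weight at most N exactly when its vertices lie in a sublevel set, so weight estimates
on chains become estimates at lattice points. -/
theorem filtered_iff {ι' R R' : Type*} [LinearOrder ι'] [AddMonoidWithOne R] [AddMonoidWithOne R']
    {w : (ι → R) → ℤ} {w' : (ι' → R') → ℤ} {f : Chain ι R →ₗ[ℤ] Chain ι' R'} :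
    Filtered w w' f ↔ ∀ c, f (Finsupp.single c 1) ∈
      Finsupp.supported ℤ ℤ (cubesIn {x | w' x ≤ cubeWeight w c}) := by
  have : ∀ N, {c' : (ι' → R') × Finset ι' | cubeWeight w' c' ≤ N} = cubesIn {x | w' x ≤ N} := by
    intro N; ext c'; exact cubeWeight_le_iff
  simp only [Filtered, this]

end Line

end LatticeCohomology

namespace LatticeCohomology

section Steps

variable {ι : Type*} [LinearOrder ι]

theorem le_translate (l : ι → ℤ) (A : Finset ι) : l ≤ translate l A := fun j => by
  by_cases h : j ∈ A
  · rw [translate_of_mem l h]; exact (lt_add_one _).le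
  · rw [translate_of_notMem l h]

/-! ### Contraction of the lines in one direction -/

theorem cubeWeight_upperFace_le (w : (ι → ℤ) → ℤ) (l : ι → ℤ) {I : Finset ι} {j : ι} (hj : j ∈ I) :
    cubeWeight w (translate l {j}, I.erase j) ≤ cubeWeight w (l, I) := by
  refine cubeWeight_le_iff.mpr fun A hA => ?_
  rw [translate_insert _ fun h => by simpa using hA h]
  exact le_cubeWeight w (l, I) (Finset.insert_subset hj (hA.trans (Finset.erase_subset _ _)))

theorem cubeWeight_lowerFace_le (w : (ι → ℤ) → ℤ) (l : ι → ℤ) {I : Finset ι} (j : ι) :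
    cubeWeight w (l, I.erase j) ≤ cubeWeight w (l, I) :=
  cubeWeight_le_iff.mpr fun _ hA => le_cubeWeight w (l, I) (hA.trans (Finset.erase_subset _ _))

/-- The identity is filtered from `w` to `w'`. Its inverse moves every cube to a level on which `w`
is bounded by the weight `w'` of the cube; quasi-convexity controls everything swept out between two
levels. -/
theorem CohomologyIso.of_lines {w w' : (ι → ℤ) → ℤ} (v : ι)
    (hconst : ∀ x n, w' (Function.update x v n) = w' x) (hle : ∀ x, w' x ≤ w x)
    (hconv : ∀ x a b c, a ≤ b → b ≤ c → w (Function.update x v b) ≤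
      max (w (Function.update x v a)) (w (Function.update x v c)))
    (hmin : ∀ l I, v ∉ I → ∃ M : ℤ, ∀ A ⊆ I,
      w (Function.update (translate l A) v M) ≤ cubeWeight w' (l, I)) :
    CohomologyIso w w' := by
  classical
  -- Choosing the level after resetting coordinate v to 0 makes it independent of the height of the
  -- cube. Both ends of a vertical cube then share a level, and the cube is pushed to zero.
  let M : (ι → ℤ) × Finset ι → ℤ := fun c =>
    if h : v ∉ c.2 then (hmin (Function.update c.1 v 0) c.2 h).choose else 0
  have hM : ∀ l I, v ∉ I → ∀ A ⊆ I,
      w (Function.update (translate l A) v (M (l, I))) ≤ cubeWeight w' (l, I) := by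
    intro l I hv A hA
    have := (hmin (Function.update l v 0) I hv).choose_spec A hA
    rw [translate_update l (fun h => hv (hA h)), Function.update_idem] at this
    simp only [M, hv, not_false_eq_true, dif_pos]
    refine this.trans (cubeWeight_le_iff.mpr fun B hB => ?_)
    rw [translate_update l (fun h => hv (hB h)), hconst]
    exact le_cubeWeight w' (l, I) hB
  have hbetween : ∀ x a b n, min a b ≤ n → n ≤ max a b → w (Function.update x v n) ≤
      max (w (Function.update x v a)) (w (Function.update x v b)) := by
    intro x a b n h1 h2
    rcases le_total a b with h | h
    · exact hconv x a n b (by omega) (by omega)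
    · rw [max_comm]; exact hconv x b n a (by omega) (by omega)
  have hupd : ∀ (l : ι → ℤ) (A I : Finset ι), v ∉ I → A ⊆ I →
      Function.update (translate l A) v (l v) = translate l A := by
    intro l A I hv hA
    rw [← translate_of_notMem l (fun h => hv (hA h)), Function.update_eq_self]
  have hK : Filtered w w (lineHomotopy v M) := by
    rw [filtered_iff]
    rintro ⟨l, I⟩
    refine lineHomotopy_mem_cubesIn v M fun hv A hA n h1 h2 => ?_
    refine (hbetween _ _ _ n h1 h2).trans (max_le ?_ ?_)
    · exact (hM l I hv A hA).trans (cubeWeight_mono hle _)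
    · rw [hupd l A I hv hA]
      exact le_cubeWeight w (l, I) hA
  have hK' : Filtered w' w' (lineHomotopy v M) := by
    rw [filtered_iff]
    rintro ⟨l, I⟩
    refine lineHomotopy_mem_cubesIn v M fun hv A hA n h1 h2 => ?_
    change w' _ ≤ _
    rw [hconst]
    exact le_cubeWeight w' (l, I) hA
  refine CohomologyIso.of_le hle ⟨hK, dimRel_lineHomotopy v M⟩ ⟨hK', dimRel_lineHomotopy v M⟩ ?_
  change Filtered w' w (linePush v M)
  rw [filtered_iff]
  rintro ⟨l, I⟩
  by_cases hv : v ∈ I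
  · rw [linePush_of_mem v M hv]
    have : M (l, I.erase v) = M (translate l {v}, I.erase v) := by
      have e : Function.update (translate l {v}) v 0 = Function.update l v 0 := by
        funext j
        by_cases hj : j = v
        · subst hj; simp
        · simp [hj, translate]
      simp only [M, e]
    rw [this, vertPath_self]
    exact zero_mem _
  · rw [linePush_of_notMem v M hv]
    -- The walls run between the level of the cube and that of a face. At both ends `w` is at most
    -- the `w'`-weight of the cube, and in between quasi-convexity applies.
    refine add_mem (single_mem fun A hA => ?_) (sum_mem fun j hj => Submodule.smul_mem _ _
      (sub_mem (vertPath_mem_cubesIn fun A hA n h1 h2 => (hbetween _ _ _ n h1 h2).trans ?_)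
        (vertPath_mem_cubesIn fun A hA n h1 h2 => (hbetween _ _ _ n h1 h2).trans ?_)))
    · change w (translate (Function.update l v _) A) ≤ _
      rw [translate_update l (fun h => hv (hA h))]
      exact hM l I hv A hA
    · refine max_le ?_ ?_
      · rw [translate_insert _ fun h => by simpa using hA h]
        exact hM l I hv _ (Finset.insert_subset hj (hA.trans (Finset.erase_subset _ _)))
      · exact (hM _ _ (fun h => hv (Finset.mem_of_mem_erase h)) A hA).trans
          (cubeWeight_upperFace_le w' l hj)
    · refine max_le ?_ ?_
      · exact hM l I hv _ (hA.trans (Finset.erase_subset _ _))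
      · exact (hM _ _ (fun h => hv (Finset.mem_of_mem_erase h)) A hA).trans
          (cubeWeight_lowerFace_le w' l j)

/-! ### Coordinate retractions -/

/-- A level that depends only on coordinate v is the same for a cube transverse to v and for its
faces, so the walls degenerate. -/
theorem linePush_coord_of_notMem (v : ι) (κ : ℤ → ℤ) {l : ι → ℤ} {I : Finset ι} (h : v ∉ I) :
    linePush v (fun c => κ (c.1 v)) (Finsupp.single (l, I) 1) =
      Finsupp.single (Function.update l v (κ (l v)), I) 1 := by
  rw [linePush_of_notMem v _ h, add_eq_left]
  refine Finset.sum_eq_zero fun j hj => ?_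
  have hvj : v ∉ ({j} : Finset ι) := by rw [Finset.mem_singleton]; exact fun e => h (e ▸ hj)
  simp only [translate_of_notMem l hvj, vertPath_self, sub_self, smul_zero]

theorem linePush_coord_of_mem (v : ι) (κ : ℤ → ℤ) {l : ι → ℤ} {I : Finset ι} (h : v ∈ I) :
    linePush v (fun c => κ (c.1 v)) (Finsupp.single (l, I) 1) =
      vertPath l (I.erase v) v (κ (l v)) (κ (l v + 1)) := by
  rw [linePush_of_mem v _ h]
  simp only [translate_of_mem l (Finset.mem_singleton_self v)]

end Steps

/-! ### Retraction onto the first quadrant -/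

section Quadrant

variable {ι : Type*} [LinearOrder ι] {w : (ι → ℤ) → ℤ} {f : ℕ → ι} {y : ℕ → ι → ℤ}

/-- The retraction of the region `y (t + 1) ≤ x` onto the region `y t ≤ x`, as a homotopy. -/
noncomputable def stepHomotopy (f : ℕ → ι) (y : ℕ → ι → ℤ) (t : ℕ) : Chain ι ℤ →ₗ[ℤ] Chain ι ℤ :=
  lineHomotopy (f t) fun c => max (c.1 (f t)) (y t (f t))

/-- The composition of the first `t` of the homotopies `stepHomotopy`. -/
noncomputable def partialHomotopy (f : ℕ → ι) (y : ℕ → ι → ℤ) : ℕ → (Chain ι ℤ →ₗ[ℤ] Chain ι ℤ)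
  | 0 => 0
  | t + 1 => partialHomotopy f y t ∘ₗ (LinearMap.id - boundary ∘ₗ stepHomotopy f y t -
      stepHomotopy f y t ∘ₗ boundary) + stepHomotopy f y t

/-- The cubes over `b` of weight at most `N`. -/
def cubesAbove (w : (ι → ℤ) → ℤ) (b : ι → ℤ) (N : ℤ) : Set ((ι → ℤ) × Finset ι) :=
  cubesIn {x | b ≤ x ∧ w x ≤ N}

theorem mem_cubesAbove {b : ι → ℤ} {N : ℤ} {c : (ι → ℤ) × Finset ι} :
    c ∈ cubesAbove w b N ↔ b ≤ c.1 ∧ cubeWeight w c ≤ N := by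
  constructor
  · intro h
    refine ⟨?_, cubeWeight_le_iff.mpr fun A hA => (h A hA).2⟩
    have := (h ∅ (Finset.empty_subset _)).1
    rwa [translate_empty] at this
  · rintro ⟨h1, h2⟩ A hA
    refine ⟨h1.trans (le_translate _ _), cubeWeight_le_iff.mp h2 A hA⟩

theorem homotopy_mem {S : Set (ι → ℤ)} {K : Chain ι ℤ →ₗ[ℤ] Chain ι ℤ}
    (hK : ∀ c ∈ cubesIn S, K (Finsupp.single c 1) ∈ Finsupp.supported ℤ ℤ (cubesIn S))
    {c : (ι → ℤ) × Finset ι} (hc : c ∈ cubesIn S) :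
    (LinearMap.id - boundary ∘ₗ K - K ∘ₗ boundary : Chain ι ℤ →ₗ[ℤ] Chain ι ℤ)
        (Finsupp.single c 1) ∈
      Finsupp.supported ℤ ℤ (cubesIn S) := by
  refine sub_mem (sub_mem (single_mem hc) ?_) ?_
  · exact map_mem_of_forall_single (fun c hc => boundary_mem_cubesIn hc) (hK c hc)
  · exact map_mem_of_forall_single hK (boundary_mem_cubesIn hc)

/-- Step t retracts the region over `y (t + 1)` onto the region over `y t` along edges on which `w`
does not increase. Infinitely many steps can be composed, because only finitely many of them move a
given cube. -/
theorem CohomologyIso.of_quadrant (hy0 : y 0 = 0) (hy : ∀ t, y t = translate (y (t + 1)) {f t})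
    (hstep : ∀ t x, y (t + 1) ≤ x → x (f t) = y (t + 1) (f t) → w (translate x {f t}) ≤ w x)
    (hex : ∀ x, ∃ t, y t ≤ x) : CohomologyIso w fun x => w (x ⊔ 0) := by
  have hyf : ∀ t, y t (f t) = y (t + 1) (f t) + 1 := fun t => by
    rw [hy t, translate_of_mem _ (Finset.mem_singleton_self _)]
  have hyne : ∀ t j, j ≠ f t → y t j = y (t + 1) j := fun t j hj => by
    rw [hy t, translate_of_notMem _ (by simpa using hj)]
  have hanti : ∀ t, y (t + 1) ≤ y t := fun t j => by
    by_cases hj : j = f t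
    · have := hyf t
      rw [hj]
      exact (lt_add_one _).le.trans_eq this.symm
    · rw [hyne t j hj]
  have hmono : Antitone y := antitone_nat_of_succ_le hanti
  have hneg : ∀ t, y t ≤ 0 := fun t => hy0 ▸ hmono (Nat.zero_le t)
  set w' : (ι → ℤ) → ℤ := fun x => w (x ⊔ 0) with hw'
  let H := stepHomotopy f y
  let K := partialHomotopy f y
  let G : ℕ → (Chain ι ℤ →ₗ[ℤ] Chain ι ℤ) := fun t =>
    LinearMap.id - boundary ∘ₗ H t - H t ∘ₗ boundary
  let Γ : ℕ → (Chain ι ℤ →ₗ[ℤ] Chain ι ℤ) := fun t =>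
    LinearMap.id - boundary ∘ₗ K t - K t ∘ₗ boundary
  have hKs : ∀ t, K (t + 1) = K t ∘ₗ G t + H t := fun t => rfl
  -- The step of largest index acts first: `G t` lifts chains over `y (t + 1)` to chains over `y t`,
  -- where `Γ t` takes over.
  have hΓs : ∀ t, Γ (t + 1) = Γ t ∘ₗ G t := fun t => (homotopy_comp (K t) (H t)).symm
  -- the steps are trivial above `y t`
  have hbd : ∀ (b : ι → ℤ) (c : (ι → ℤ) × Finset ι), b ≤ c.1 →
      boundary (Finsupp.single c 1) ∈ Finsupp.supported ℤ ℤ {c : (ι → ℤ) × Finset ι | b ≤ c.1} := by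
    intro b c hc
    have hsub : cubesIn {x : ι → ℤ | b ≤ x} ⊆ {c : (ι → ℤ) × Finset ι | b ≤ c.1} := fun c h => by
      have := h ∅ (Finset.empty_subset _)
      rwa [translate_empty] at this
    refine Finsupp.supported_mono hsub (boundary_mem_cubesIn fun A hA => ?_)
    exact hc.trans (le_translate _ _)
  have eq_of_single : ∀ (b : ι → ℤ) (L L' : Chain ι ℤ →ₗ[ℤ] Chain ι ℤ),
      (∀ c : (ι → ℤ) × Finset ι, b ≤ c.1 → L (Finsupp.single c 1) = L' (Finsupp.single c 1)) →
      ∀ x ∈ Finsupp.supported ℤ ℤ {c : (ι → ℤ) × Finset ι | b ≤ c.1}, L x = L' x := by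
    intro b L L' h x hx
    have := map_mem_of_forall_single (f := L - L') (P := ⊥)
      (fun c hc => by rw [LinearMap.sub_apply, h c hc, sub_self]; exact zero_mem _) hx
    rwa [Submodule.mem_bot, LinearMap.sub_apply, sub_eq_zero] at this
  have hH0 : ∀ t (c : (ι → ℤ) × Finset ι), y t ≤ c.1 → H t (Finsupp.single c 1) = 0 := by
    intro t c hc
    by_cases hv : f t ∈ c.2
    · exact lineHomotopy_of_mem _ _ hv
    · refine (lineHomotopy_of_notMem _ _ hv).trans ?_
      rw [max_eq_left (hc (f t)), vertPath_self, smul_zero]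
  have hG0 : ∀ t (c : (ι → ℤ) × Finset ι), y t ≤ c.1 →
      G t (Finsupp.single c 1) = Finsupp.single c 1 := by
    intro t c hc
    simp only [G, LinearMap.sub_apply, LinearMap.comp_apply, LinearMap.id_apply]
    rw [hH0 t c hc, eq_of_single (y t) (H t) 0 (fun c hc => hH0 t c hc) _ (hbd _ c hc)]
    simp
  -- Steps of index at least s do nothing over `y s`, so there the partial homotopies stabilize.
  have hKstab : ∀ s t (c : (ι → ℤ) × Finset ι), s ≤ t → y s ≤ c.1 →
      K t (Finsupp.single c 1) = K s (Finsupp.single c 1) := by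
    intro s t c hst hc
    induction t, hst using Nat.le_induction with
    | base => rfl
    | succ t hst ih =>
      have hc' : y t ≤ c.1 := (hmono hst).trans hc
      rw [hKs, LinearMap.add_apply, LinearMap.comp_apply, hG0 t c hc', hH0 t c hc', ih, add_zero]
  -- the weights
  have hHw : ∀ t N, ∀ c ∈ cubesAbove w (y (t + 1)) N, H t (Finsupp.single c 1) ∈
      Finsupp.supported ℤ ℤ (cubesAbove w (y (t + 1)) N) := by
    intro t N c hc
    obtain ⟨l, I⟩ := c
    refine lineHomotopy_mem_cubesIn _ _ fun hv A hA n h1 h2 => ?_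
    have hb := hc A hA
    have hlv : y (t + 1) (f t) ≤ l (f t) := (mem_cubesAbove.mp hc).1 (f t)
    have hA' : translate l A (f t) = l (f t) := translate_of_notMem l fun h => hv (hA h)
    dsimp only at h1 h2
    -- The target height exceeds that of the cube by at most one, and only at the bottom of the
    -- region, which is the case covered by `hstep`.
    by_cases hn : n = l (f t)
    · rw [hn, ← hA', Function.update_eq_self]; exact hb
    · have hn' : n = l (f t) + 1 ∧ l (f t) = y (t + 1) (f t) := by
        have := hyf t
        omega
      have e : Function.update (translate l A) (f t) n = translate (translate l A) {f t} := by
        rw [hn'.1, ← hA', ← translate_update_self, Function.update_eq_self]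
      rw [e]
      refine ⟨hb.1.trans (le_translate _ _), (hstep t _ hb.1 (hA'.trans hn'.2)).trans hb.2⟩
  have hGw : ∀ t N, ∀ c ∈ cubesAbove w (y (t + 1)) N, G t (Finsupp.single c 1) ∈
      Finsupp.supported ℤ ℤ (cubesAbove w (y t) N) := by
    intro t N c hc
    have h1 : G t (Finsupp.single c 1) ∈ Finsupp.supported ℤ ℤ (cubesAbove w (y (t + 1)) N) :=
      homotopy_mem (hHw t N) hc
    have h2 : G t (Finsupp.single c 1) ∈
        Finsupp.supported ℤ ℤ {c : (ι → ℤ) × Finset ι | y t ≤ c.1} := by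
      obtain ⟨l, I⟩ := c
      have hl : y (t + 1) ≤ l := (mem_cubesAbove.mp hc).1
      have key : ∀ n, y t (f t) ≤ n → y t ≤ Function.update l (f t) n := by
        intro n hn j
        by_cases hj : j = f t
        · subst hj; simpa using hn
        · rw [Function.update_of_ne hj, hyne t j hj]; exact hl j
      by_cases hv : f t ∈ I
      · have e : G t (Finsupp.single (l, I) 1) = _ :=
          linePush_coord_of_mem (f t) (fun n => max n (y t (f t))) hv
        rw [e]
        exact vertPath_mem _ fun n hn _ => single_mem (key n (by omega))
      · have e : G t (Finsupp.single (l, I) 1) = _ :=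
          linePush_coord_of_notMem (f t) (fun n => max n (y t (f t))) hv
        rw [e]
        exact single_mem (key _ (le_max_right _ _))
    intro c hc
    exact mem_cubesAbove.mpr ⟨h2 hc, (mem_cubesAbove.mp (h1 hc)).2⟩
  have hKw : ∀ t N, ∀ c ∈ cubesAbove w (y t) N, K t (Finsupp.single c 1) ∈
      Finsupp.supported ℤ ℤ {c : (ι → ℤ) × Finset ι | cubeWeight w c ≤ N} := by
    intro t
    induction t with
    | zero => intro N c _; exact zero_mem _
    | succ t ih =>
      intro N c hc
      have hsub : cubesAbove w (y (t + 1)) N ⊆ {c | cubeWeight w c ≤ N} :=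
        fun c hc => (mem_cubesAbove.mp hc).2
      exact add_mem (map_mem_of_forall_single (ih N) (hGw t N c hc))
        (Finsupp.supported_mono hsub (hHw t N c hc))
  have hΓw : ∀ t N, ∀ c ∈ cubesAbove w (y t) N, Γ t (Finsupp.single c 1) ∈
      Finsupp.supported ℤ ℤ (cubesAbove w 0 N) := by
    intro t
    induction t with
    | zero =>
      intro N c hc
      have : Γ 0 (Finsupp.single c 1) = Finsupp.single c 1 := by simp [Γ, K, partialHomotopy]
      rw [this, ← hy0]
      exact single_mem hc
    | succ t ih =>
      intro N c hc
      rw [hΓs]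
      exact map_mem_of_forall_single (ih N) (hGw t N c hc)
  have hHw' : ∀ t, Filtered w' w' (H t) := by
    intro t
    rw [filtered_iff]
    rintro ⟨l, I⟩
    refine lineHomotopy_mem_cubesIn _ _ fun hv A hA n h1 h2 => ?_
    have hA' : translate l A (f t) = l (f t) := translate_of_notMem l fun h => hv (hA h)
    have hn := hneg t (f t)
    simp only [Pi.zero_apply] at hn
    dsimp only at h1 h2
    -- Since `y t ≤ 0`, a coordinate that really moves stays nonpositive, so the positive part does
    -- not change.
    have e : Function.update (translate l A) (f t) n ⊔ 0 = translate l A ⊔ 0 := by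
      funext j
      by_cases hj : j = f t
      · subst hj
        simp only [Pi.sup_apply, Function.update_self, hA', Pi.zero_apply]
        change max n 0 = max _ 0
        omega
      · simp [Function.update_of_ne hj]
    change w (_ ⊔ 0) ≤ _
    rw [e]
    exact le_cubeWeight w' (l, I) hA
  have hKw' : ∀ t, Filtered w' w' (K t) := by
    intro t
    induction t with
    | zero => exact fun c => zero_mem _
    | succ t ih => exact (ih.comp (filtered_of_homotopy (hHw' t))).add (hHw' t)
  have hKdim : ∀ t, DimRel (fun p q => q = p + 1) (K t) := by
    intro t
    induction t with
    | zero => exact fun c => zero_mem _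
    | succ t ih =>
      have hd : DimRel (fun p q => q = p + 1) (H t) := dimRel_lineHomotopy _ _
      have hd' : DimRel (fun p q => q = p + 1) (K t ∘ₗ G t) :=
        ih.comp (dimRel_of_homotopy hd) fun m n p h h' => by omega
      exact fun c => add_mem (hd' c) (hd c)
  -- the limit
  choose T hT using hex
  let Klim : Chain ι ℤ →ₗ[ℤ] Chain ι ℤ :=
    Finsupp.linearCombination ℤ fun c => K (T c.1) (Finsupp.single c 1)
  have hKlim : ∀ c, Klim (Finsupp.single c 1) = K (T c.1) (Finsupp.single c 1) := fun c => by
    simp [Klim]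
  -- Every sufficiently large index gives the same value. Hence one partial homotopy computes the
  -- limit on a cube and on its whole boundary, although `T` depends on the base point.
  have hKlim' : ∀ t (c : (ι → ℤ) × Finset ι), y t ≤ c.1 →
      Klim (Finsupp.single c 1) = K t (Finsupp.single c 1) := by
    intro t c hc
    rw [hKlim, ← hKstab _ _ c (le_max_left (T c.1) t) (hT c.1),
      ← hKstab _ _ c (le_max_right (T c.1) t) hc]
  have hΓlim : ∀ c, (LinearMap.id - boundary ∘ₗ Klim - Klim ∘ₗ boundary : Chain ι ℤ →ₗ[ℤ] Chain ι ℤ)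
      (Finsupp.single c 1) =
      Γ (T c.1) (Finsupp.single c 1) := by
    intro c
    simp only [Γ, LinearMap.sub_apply, LinearMap.comp_apply, LinearMap.id_apply]
    rw [hKlim, eq_of_single (y (T c.1)) Klim (K (T c.1)) (hKlim' _) _ (hbd _ c (hT c.1))]
  have hdim : DimRel (fun p q => q = p + 1) Klim := fun c => by rw [hKlim]; exact hKdim _ c
  have hwf : Filtered w w Klim := fun c => by
    rw [hKlim]
    exact hKw _ _ c (mem_cubesAbove.mpr ⟨hT c.1, le_rfl⟩)
  have hwf' : Filtered w' w' Klim := fun c => by rw [hKlim]; exact hKw' _ c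
  -- The steps also carry a point x up towards its positive part: each one either raises a negative
  -- coordinate without increasing `w`, or leaves x where it is.
  have hle : ∀ x, w' x ≤ w x := by
    have : ∀ t x, y t ≤ x → w' x ≤ w x := by
      intro t
      induction t with
      | zero =>
        intro x hx
        rw [hy0] at hx
        simp only [w', sup_eq_left.mpr hx, le_refl]
      | succ t ih =>
        intro x hx
        by_cases hxf : x (f t) = y (t + 1) (f t)
        · have h1 : y t ≤ translate x {f t} := by
            rw [hy t]
            intro j
            simp only [translate]
            have : y (t + 1) j ≤ x j := hx j
            split_ifs <;> omega
          have h2 : translate x {f t} ⊔ 0 = x ⊔ 0 := by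
            funext j
            by_cases hj : j = f t
            · subst hj
              have hn := hneg t (f t)
              simp only [Pi.zero_apply] at hn
              simp only [Pi.sup_apply, translate_of_mem x (Finset.mem_singleton_self _),
                Pi.zero_apply]
              have := hyf t
              change max _ 0 = max _ 0
              omega
            · simp [translate, hj]
          have := ih _ h1
          simp only [w', h2] at this
          exact this.trans (hstep t x hx hxf)
        · refine ih x fun j => ?_
          by_cases hj : j = f t
          · subst hj
            have : y (t + 1) (f t) ≤ x (f t) := hx (f t)
            have := hyf t
            change y t (f t) ≤ x (f t)
            omega
          · rw [hyne t j hj]; exact hx j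
    exact fun x => this _ x (hT x)
  refine CohomologyIso.of_le hle ⟨hwf, hdim⟩ ⟨hwf', hdim⟩ fun c => ?_
  -- The end of the homotopy lies over 0, where `w` and `w'` agree, and its `w'`-weight has not
  -- grown. This bounds its `w`-weight by the `w'`-weight of `c`.
  have h1 := hΓw (T c.1) _ c (mem_cubesAbove.mpr ⟨hT c.1, le_rfl⟩)
  have h2 := filtered_of_homotopy hwf' c
  rw [hΓlim] at h2 ⊢
  intro c' hc'
  have h3 := (mem_cubesAbove.mp (h1 hc')).1
  have h4 : cubeWeight w' c' ≤ cubeWeight w' c := h2 hc'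
  refine le_trans (cubeWeight_le_iff.mpr fun A hA => ?_) h4
  have h5 : translate c'.1 A ⊔ 0 = translate c'.1 A := by
    exact sup_eq_left.mpr (h3.trans (le_translate _ _))
  have := le_cubeWeight w' c' hA
  simp only [w', h5] at this
  exact this

end Quadrant

end LatticeCohomology

namespace LatticeCohomology

/-! ### Passage to the first quadrant of a coordinate subspace -/

section Subspace

variable {ι : Type*} [LinearOrder ι] (J : Finset ι)

/-- Extension of a lattice point by zero. -/
def extendPoint (i : J → ℕ) : ι → ℤ := fun v => if h : v ∈ J then (i ⟨v, h⟩ : ℤ) else 0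

theorem extendPoint_injective : Function.Injective (extendPoint J) := fun i i' h => by
  funext j
  have := congrFun h j.1
  simpa [extendPoint] using this

theorem translate_extendPoint (i : J → ℕ) (A : Finset J) :
    translate (extendPoint J i) (A.map (Function.Embedding.subtype _)) =
      extendPoint J (translate i A) := by
  funext v
  by_cases hv : v ∈ J
  · by_cases hA : (⟨v, hv⟩ : J) ∈ A
    · simp [translate, extendPoint, hv, hA]
    · simp [translate, extendPoint, hv, hA]
  · simp [translate, extendPoint, hv]

/-- The inclusion of the cubes of the first quadrant. -/
def extendCube (c : (J → ℕ) × Finset J) : (ι → ℤ) × Finset ι :=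
  (extendPoint J c.1, c.2.map (Function.Embedding.subtype _))

theorem extendCube_injective : Function.Injective (extendCube J) := fun c c' h => by
  rw [extendCube, extendCube, Prod.mk.injEq] at h
  exact Prod.ext (extendPoint_injective J h.1) (Finset.map_injective _ h.2)

/-- The inclusion of the chains of the first quadrant. -/
noncomputable def extendChain : Chain J ℕ →ₗ[ℤ] Chain ι ℤ :=
  Finsupp.lmapDomain ℤ ℤ (extendCube J)

theorem extendChain_single (c : (J → ℕ) × Finset J) :
    extendChain J (Finsupp.single c 1) = Finsupp.single (extendCube J c) 1 :=
  Finsupp.mapDomain_single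

theorem extendChain_injective : Function.Injective (extendChain J) :=
  Finsupp.mapDomain_injective (extendCube_injective J)

theorem orient_map (I : Finset J) (j : J) :
    orient (I.map (Function.Embedding.subtype _)) (j : ι) = orient I j := by
  rw [orient, orient, Finset.filter_map, Finset.card_map]
  rfl

theorem boundary_comp_extendChain :
    boundary ∘ₗ extendChain J = extendChain J ∘ₗ boundary := by
  ext1 c
  refine LinearMap.ext_ring ?_
  simp only [LinearMap.comp_apply, Finsupp.lsingle_apply]
  rw [extendChain_single, boundary_single, boundary_single, map_sum]
  simp only [extendCube]
  rw [Finset.sum_map]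
  refine Finset.sum_congr rfl fun j _ => ?_
  rw [map_smul, facePair, facePair, map_sub, extendChain_single, extendChain_single]
  have h1 := orient_map J c.2 j
  have h2 := translate_extendPoint J c.1 {j}
  rw [Finset.map_singleton] at h2
  simp only [extendCube]
  rw [← h2, Finset.map_erase]
  exact congrArg (· • _) h1

/-- The retraction of the coordinate line in direction `v`. -/
def clamp (v : ι) (n : ℤ) : ℤ := if v ∈ J then max n 0 else 0

theorem vertPath_clamp (v : ι) {l : ι → ℤ} {I : Finset ι} (h : v ∈ I) :
    vertPath l (I.erase v) v (clamp J v (l v)) (clamp J v (l v + 1)) =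
      if v ∈ J ∧ 0 ≤ l v then Finsupp.single (l, I) 1 else 0 := by
  by_cases hv : v ∈ J ∧ 0 ≤ l v
  · rw [if_pos hv]
    have h1 : clamp J v (l v) = l v := by simp [clamp, hv.1, hv.2]
    have h2 : clamp J v (l v + 1) = l v + 1 := by
      simp only [clamp, hv.1, if_true]; omega
    rw [h1, h2, vertPath_succ, Function.update_eq_self, Finset.insert_erase h]
  · rw [if_neg hv]
    have : clamp J v (l v + 1) = clamp J v (l v) := by
      by_cases hJ : v ∈ J
      · have : ¬ 0 ≤ l v := fun h => hv ⟨hJ, h⟩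
        simp only [clamp, hJ, if_true]; omega
      · simp [clamp, hJ]
    rw [this, vertPath_self]

open Classical in
/-- The retraction of the coordinates in `S`, on cubes. -/
noncomputable def retractCube (S : Finset ι) (c : (ι → ℤ) × Finset ι) : Chain ι ℤ :=
  if ∀ v ∈ c.2, v ∈ S → v ∈ J ∧ 0 ≤ c.1 v then
    Finsupp.single (fun u => if u ∈ S then clamp J u (c.1 u) else c.1 u, c.2) 1 else 0

/-- Clamping a coordinate moves along lines of constant weight, so the coordinates can be treated
one after another. A cube with a direction that gets collapsed goes to zero. -/
theorem exists_retraction {w : (ι → ℤ) → ℤ}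
    (hw : ∀ x v, w (Function.update x v (clamp J v (x v))) = w x) (S : Finset ι) :
    ∃ K, FilteredHomotopy w K ∧ ∀ c,
      (LinearMap.id - boundary ∘ₗ K - K ∘ₗ boundary : Chain ι ℤ →ₗ[ℤ] Chain ι ℤ)
        (Finsupp.single c 1) = retractCube J S c := by
  induction S using Finset.induction_on with
  | empty =>
    refine ⟨0, ⟨fun c => zero_mem _, fun c => zero_mem _⟩, fun c => ?_⟩
    simp [retractCube]
  | insert v S hvS ih =>
    obtain ⟨K, hK, hKS⟩ := ih
    set H : Chain ι ℤ →ₗ[ℤ] Chain ι ℤ := lineHomotopy v fun c => clamp J v (c.1 v) with hH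
    have hHw : Filtered w w H := by
      rw [filtered_iff]
      rintro ⟨l, I⟩
      refine lineHomotopy_mem_cubesIn _ _ fun hv A hA n h1 h2 => ?_
      have hA' : translate l A v = l v := translate_of_notMem l fun h => hv (hA h)
      change w _ ≤ _
      refine le_trans (le_of_eq ?_) (le_cubeWeight w (l, I) hA)
      -- Every height between a coordinate and its clamped value has that same clamped value, hence
      -- the same weight.
      rw [← hw _ v, ← hw (translate l A) v, Function.update_idem, hA', Function.update_self]
      congr 2
      dsimp only at h1 h2
      by_cases hJ : v ∈ J
      · simp only [clamp, hJ, if_true] at h1 h2 ⊢; omega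
      · simp [clamp, hJ]
    have hHd : DimRel (fun p q => q = p + 1) H := dimRel_lineHomotopy _ _
    refine ⟨K ∘ₗ (LinearMap.id - boundary ∘ₗ H - H ∘ₗ boundary) + H,
      ⟨(hK.filtered.comp (filtered_of_homotopy hHw)).add hHw, fun c => add_mem
        (hK.dim.comp (r'' := fun p q => q = p + 1) (dimRel_of_homotopy hHd)
          (fun m n p h h' => by omega) c) (hHd c)⟩, ?_⟩
    rintro ⟨l, I⟩
    rw [← homotopy_comp, LinearMap.comp_apply]
    change (LinearMap.id - boundary ∘ₗ K - K ∘ₗ boundary : Chain ι ℤ →ₗ[ℤ] Chain ι ℤ)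
      (linePush v (fun c => clamp J v (c.1 v)) _) = _
    by_cases hvI : v ∈ I
    · rw [linePush_coord_of_mem v (clamp J v) hvI, vertPath_clamp J v hvI]
      by_cases hv : v ∈ J ∧ 0 ≤ l v
      · rw [if_pos hv, hKS]
        have h1 : (∀ u ∈ I, u ∈ insert v S → u ∈ J ∧ 0 ≤ l u) ↔
            ∀ u ∈ I, u ∈ S → u ∈ J ∧ 0 ≤ l u := by
          constructor
          · exact fun h u hu huS => h u hu (Finset.mem_insert_of_mem huS)
          · intro h u hu huS
            rcases Finset.mem_insert.mp huS with rfl | huS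
            · exact hv
            · exact h u hu huS
        have h2 : (fun u => if u ∈ insert v S then clamp J u (l u) else l u) =
            fun u => if u ∈ S then clamp J u (l u) else l u := by
          funext u
          by_cases hu : u = v
          · subst hu; simp [hvS, clamp, hv.1, hv.2]
          · simp [hu]
        simp only [retractCube, h1, h2]
      · rw [if_neg hv, map_zero, retractCube, if_neg]
        exact fun h => hv (h v hvI (Finset.mem_insert_self v S))
    · rw [linePush_coord_of_notMem v (clamp J v) hvI, hKS]
      have h1 : (∀ u ∈ I, u ∈ insert v S → u ∈ J ∧ 0 ≤ l u) ↔
          ∀ u ∈ I, u ∈ S → u ∈ J ∧ 0 ≤ Function.update l v (clamp J v (l v)) u := by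
        refine forall₂_congr fun u hu => ?_
        have huv : u ≠ v := fun e => hvI (e ▸ hu)
        rw [Finset.mem_insert, Function.update_of_ne huv]
        simp [huv]
      have h2 : (fun u => if u ∈ insert v S then clamp J u (l u) else l u) = fun u =>
          if u ∈ S then clamp J u (Function.update l v (clamp J v (l v)) u)
            else Function.update l v (clamp J v (l v)) u := by
        funext u
        by_cases hu : u = v
        · subst hu; simp [hvS]
        · simp [hu]
      simp only [retractCube, h1, h2]

open Classical in
/-- The projection of the chains to those of the first quadrant. -/
noncomputable def projectChain : Chain ι ℤ →ₗ[ℤ] Chain J ℕ :=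
  Finsupp.linearCombination ℤ fun c =>
    if ∀ v ∈ c.2, v ∈ J ∧ 0 ≤ c.1 v then
      Finsupp.single (fun j => (c.1 j).toNat, Finset.subtype (· ∈ J) c.2) 1 else 0

/-- Including the quadrant and then projecting is the identity; projecting and then including is the
clamping of all coordinates, which is homotopic to the identity. -/
theorem CohomologyIso.of_subspace [Fintype ι] {w : (ι → ℤ) → ℤ} {wJ : (J → ℕ) → ℤ}
    (hw : ∀ x, w x = wJ fun j => (x j).toNat) : CohomologyIso w wJ := by
  have hclamp : ∀ x v, w (Function.update x v (clamp J v (x v))) = w x := by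
    intro x v
    rw [hw, hw]
    congr 1
    funext j
    by_cases hj : j.1 = v
    · subst hj
      simp only [Function.update_self, clamp, j.2, if_true]
      omega
    · rw [Function.update_of_ne hj]
  obtain ⟨K, hK, hKc⟩ := exists_retraction J hclamp Finset.univ
  have hsp : extendChain J ∘ₗ projectChain J =
      LinearMap.id - boundary ∘ₗ K - K ∘ₗ boundary := by
    ext1 c
    refine LinearMap.ext_ring ?_
    rw [LinearMap.comp_apply, LinearMap.comp_apply, LinearMap.comp_apply (_ - _ : Chain ι ℤ →ₗ[ℤ] Chain ι ℤ),
      Finsupp.lsingle_apply, hKc]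
    simp only [projectChain, retractCube, Finsupp.linearCombination_single, one_smul,
      Finset.mem_univ, true_imp_iff, if_true]
    split_ifs with h
    · rw [extendChain_single]
      congr 1
      refine Prod.ext ?_ ?_
      · funext v
        by_cases hv : v ∈ J
        · simp [extendCube, extendPoint, hv, clamp]
        · simp [extendCube, extendPoint, hv, clamp]
      · change Finset.map _ (Finset.subtype _ _) = c.2
        exact Finset.subtype_map_of_mem fun v hv => (h v hv).1
    · rw [map_zero]
  have hps : projectChain J ∘ₗ extendChain J = LinearMap.id := by
    ext1 c
    refine LinearMap.ext_ring ?_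
    rw [LinearMap.comp_apply, LinearMap.comp_apply, Finsupp.lsingle_apply, extendChain_single]
    simp only [projectChain, Finsupp.linearCombination_single, one_smul, LinearMap.comp_apply,
      LinearMap.id_apply, Finsupp.lsingle_apply]
    rw [if_pos]
    · congr 1
      refine Prod.ext ?_ ?_
      · funext j
        simp [extendCube, extendPoint]
      · ext j
        simp [extendCube]
    · intro v hv
      simp only [extendCube, Finset.mem_map, Function.Embedding.subtype_apply] at hv
      obtain ⟨j, _, rfl⟩ := hv
      exact ⟨j.2, by simp [extendCube, extendPoint]⟩
  have hpt : ∀ i, w (extendPoint J i) = wJ i := by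
    intro i
    rw [hw]
    congr 1
    funext j
    simp [extendPoint]
  have hcw : ∀ c, cubeWeight w (extendCube J c) = cubeWeight wJ c := by
    intro c
    refine le_antisymm (cubeWeight_le_iff.mpr fun A hA => ?_) (cubeWeight_le_iff.mpr fun A hA => ?_)
    · obtain ⟨B, hB, rfl⟩ := Finset.subset_map_iff.mp hA
      change w (translate (extendPoint J c.1) _) ≤ _
      rw [translate_extendPoint, hpt]
      exact le_cubeWeight wJ c hB
    · rw [← hpt, ← translate_extendPoint]
      exact le_cubeWeight w (extendCube J c) (Finset.map_subset_map.mpr hA)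
  have hcomm : boundary ∘ₗ projectChain J = projectChain J ∘ₗ boundary := by
    -- The composite with the injective chain map `extendChain` is a chain map, and this forces the
    -- projection to be one.
    refine LinearMap.ext fun x => extendChain_injective J ?_
    have h1 := LinearMap.congr_fun (boundary_comp_extendChain J) (projectChain J x)
    have h2 := LinearMap.congr_fun (boundary_comp_of_homotopy K) x
    rw [← hsp] at h2
    exact h1.symm.trans h2
  have single_of : ∀ c, projectChain J (Finsupp.single c 1) = 0 ∨ ∃ c',
      projectChain J (Finsupp.single c 1) = Finsupp.single c' 1 := by
    intro c
    simp only [projectChain, Finsupp.linearCombination_single, one_smul]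
    split_ifs
    · exact Or.inr ⟨_, rfl⟩
    · exact Or.inl rfl
  have hmem : ∀ (c : (ι → ℤ) × Finset ι) (S : Set ((ι → ℤ) × Finset ι)),
      (LinearMap.id - boundary ∘ₗ K - K ∘ₗ boundary : Chain ι ℤ →ₗ[ℤ] Chain ι ℤ)
        (Finsupp.single c 1) ∈ Finsupp.supported ℤ ℤ S → projectChain J (Finsupp.single c 1) ∈
          Finsupp.supported ℤ ℤ (extendCube J ⁻¹' S) := by
    intro c S h
    rcases single_of c with h0 | ⟨c', h0⟩
    · rw [h0]; exact zero_mem _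
    · rw [h0]
      rw [← hsp, LinearMap.comp_apply, h0, extendChain_single] at h
      exact single_mem (h (by simp))
  have hcard : ∀ c, (extendCube J c).2.card = c.2.card := fun c => Finset.card_map _
  refine CohomologyIso.of_homotopyEquiv (f := projectChain J) (g := extendChain J)
    ⟨fun c => ?_, fun c => ?_, hcomm⟩ ⟨fun c => ?_, fun c => ?_, boundary_comp_extendChain J⟩
    hK hsp (K' := 0) ⟨fun c => zero_mem _, fun c => zero_mem _⟩ ?_
  · have := hmem c _ (filtered_of_homotopy hK.filtered c)
    simpa only [Set.preimage_ofPred_eq, hcw] using this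
  · have := hmem c _ (dimRel_of_homotopy hK.dim c)
    simpa only [Set.preimage_ofPred_eq, hcard] using this
  · rw [extendChain_single]
    exact single_mem (hcw c).le
  · rw [extendChain_single]
    exact single_mem (hcard c)
  · rw [hps]; simp

end Subspace

end LatticeCohomology

/-! # Saddle points of quadratic functions on forests -/

namespace SimpleGraph

variable {V : Type*}

open Classical in
/-- In a finite nonempty set of vertices of a tree, some vertex has at most one neighbour. -/
theorem IsTree.exists_card_neighbors_le_one {Γ : SimpleGraph V} (hΓ : Γ.IsTree) {S : Finset V}
    (hS : S.Nonempty) : ∃ v ∈ S, (S.filter (Γ.Adj v)).card ≤ 1 := by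
  obtain ⟨r⟩ := hΓ.connected.nonempty
  -- For v at maximal distance from a root, any neighbour in S is nearer to the root, and in a tree
  -- the only such neighbour is the last but one vertex on the path to v.
  obtain ⟨v, hv, hmax⟩ := S.exists_max_image (Γ.dist r) hS
  obtain ⟨p, hp, -⟩ := hΓ.connected.exists_path_of_dist r v
  refine ⟨v, hv, Finset.card_le_one.mpr ?_⟩
  have key : ∀ a ∈ S.filter (Γ.Adj v), a = p.penultimate := by
    intro a ha
    obtain ⟨haS, hadj⟩ := Finset.mem_filter.mp ha
    have hd : Γ.dist r a < Γ.dist r v := by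
      rcases hΓ.dist_eq_dist_add_one_of_adj r hadj with h | h
      · omega
      · have := hmax a haS
        omega
    obtain ⟨q, hq, hql⟩ := hΓ.connected.exists_path_of_dist r a
    refine hΓ.isAcyclic.eq_penultimate_of_adj_end hp hadj
      (hΓ.isAcyclic.mem_support_of_ne_mem_support_of_adj_of_isPath hp hq hadj fun hvq => ?_)
    have h1 := Γ.dist_le (q.takeUntil v hvq)
    have h2 := q.length_takeUntil_le_length hvq
    omega
  intro a ha b hb
  rw [key a ha, key b hb]

end SimpleGraph

section Saddle

variable {V : Type*} [DecidableEq V]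

open Classical in
-- Forcing v into the set leaves a function of the same type on the remaining vertices, with linear
-- coefficients lowered by one at the neighbours of v. The induction for saddle points stays within
-- this class.
theorem insert_increment {Γ : SimpleGraph V} {S : Finset V} {a : V → ℤ} {Q : Finset V → ℤ}
    (hQ : ∀ X ⊆ S, ∀ u ∈ S, u ∉ X → Q (insert u X) = Q X + a u - (X.filter (Γ.Adj u)).card)
    {v : V} (hv : v ∈ S) :
    ∀ X ⊆ S.erase v, ∀ u ∈ S.erase v, u ∉ X → Q (insert v (insert u X)) =
      Q (insert v X) + (a u - if Γ.Adj u v then 1 else 0) - (X.filter (Γ.Adj u)).card := by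
  intro X hX u hu huX
  obtain ⟨huv, huS⟩ := Finset.mem_erase.mp hu
  have hvX : v ∉ X := fun h => by simpa using hX h
  rw [Finset.insert_comm, hQ (insert v X) (Finset.insert_subset hv
    (hX.trans (Finset.erase_subset _ _))) u huS (by simp [huv, huX]), Finset.filter_insert]
  split_ifs
  · rw [Finset.card_insert_of_notMem (by simp [hvX])]; push_cast; ring
  · ring

open Classical in
/-- A function `Q` on the subsets of a vertex set `S` of a tree with quadratic terms `-1` for the
edges has a pure saddle point for the game in which one player chooses a subset of `S ∩ P` and the
other one a subset of `S ∖ P`. -/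
theorem exists_saddle_point {Γ : SimpleGraph V} (hΓ : Γ.IsTree) (P : Finset V) (S : Finset V) :
    ∀ (a : V → ℤ) (Q : Finset V → ℤ),
      (∀ X ⊆ S, ∀ u ∈ S, u ∉ X → Q (insert u X) = Q X + a u - (X.filter (Γ.Adj u)).card) →
      ∃ C ⊆ S ∩ P, ∃ M ⊆ S \ P, (∀ C' ⊆ S ∩ P, Q (C' ∪ M) ≤ Q (C ∪ M)) ∧
        ∀ M' ⊆ S \ P, Q (C ∪ M) ≤ Q (C ∪ M') := by
  induction S using Finset.strongInduction with
  | H S ih =>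
    intro a Q hQ
    rcases S.eq_empty_or_nonempty with rfl | hS
    · refine ⟨∅, by simp, ∅, by simp, fun C' hC' => ?_, fun M' hM' => ?_⟩
      · have : C' = ∅ := by simpa using hC'
        rw [this]
      · have : M' = ∅ := by simpa using hM'
        rw [this]
    -- With at most one neighbour of v in S, adding v changes `Q` by `a v` or `a v - 1`. By
    -- integrality the direction of this change does not depend on the other choices, so the player
    -- who owns v has a dominant move and v can be eliminated.
    · obtain ⟨v, hv, hleaf⟩ := hΓ.exists_card_neighbors_le_one hS
      have hcard : ∀ X ⊆ S.erase v, ((X.filter (Γ.Adj v)).card : ℤ) ≤ 1 := fun X hX => by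
        exact_mod_cast (Finset.card_le_card (Finset.filter_subset_filter _
          (hX.trans (Finset.erase_subset _ _)))).trans hleaf
      have hins : ∀ X ⊆ S.erase v, Q (insert v X) = Q X + a v - (X.filter (Γ.Adj v)).card :=
        fun X hX => hQ X (hX.trans (Finset.erase_subset _ _)) v hv fun h => by simpa using hX h
      have hss : S.erase v ⊂ S := Finset.erase_ssubset hv
      have hunion : ∀ {C M}, C ⊆ S.erase v ∩ P → M ⊆ S.erase v \ P → C ∪ M ⊆ S.erase v :=
        fun hC hM => Finset.union_subset (hC.trans Finset.inter_subset_left)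
          (hM.trans Finset.sdiff_subset)
      have hP_of : ∀ {C}, C ⊆ S ∩ P → v ∉ C → C ⊆ S.erase v ∩ P := fun hC h x hx => by
        have := Finset.mem_inter.mp (hC hx)
        exact Finset.mem_inter.mpr ⟨Finset.mem_erase.mpr ⟨fun e => h (e ▸ hx), this.1⟩, this.2⟩
      have hN_of : ∀ {M}, M ⊆ S \ P → v ∉ M → M ⊆ S.erase v \ P := fun hM h x hx => by
        have := Finset.mem_sdiff.mp (hM hx)
        exact Finset.mem_sdiff.mpr ⟨Finset.mem_erase.mpr ⟨fun e => h (e ▸ hx), this.1⟩, this.2⟩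
      have hPS : S.erase v ∩ P ⊆ S ∩ P := Finset.inter_subset_inter_right (Finset.erase_subset _ _)
      have hNS : S.erase v \ P ⊆ S \ P := Finset.sdiff_subset_sdiff (Finset.erase_subset _ _) le_rfl
      have hP_er : ∀ {C}, C ⊆ S ∩ P → C.erase v ⊆ S.erase v ∩ P := fun hC =>
        hP_of ((Finset.erase_subset _ _).trans hC) (by simp)
      have hN_er : ∀ {M}, M ⊆ S \ P → M.erase v ⊆ S.erase v \ P := fun hM =>
        hN_of ((Finset.erase_subset _ _).trans hM) (by simp)
      rcases le_or_gt (a v) 0 with ha | ha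
      · -- including `v` decreases `Q`
        have hdec : ∀ X ⊆ S.erase v, Q (insert v X) ≤ Q X := fun X hX => by
          have := hins X hX
          omega
        by_cases hvP : v ∈ P
        · obtain ⟨C, hC, M, hM, h1, h2⟩ := ih _ hss a Q fun X hX u hu =>
            hQ X (hX.trans hss.subset) u (hss.subset hu)
          refine ⟨C, hC.trans hPS, M, hM.trans hNS, fun C' hC' => ?_, fun M' hM' => ?_⟩
          · by_cases hvC : v ∈ C'
            · rw [← Finset.insert_erase hvC, Finset.insert_union]
              exact (hdec _ (hunion (hP_er hC') hM)).trans (h1 _ (hP_er hC'))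
            · exact h1 _ (hP_of hC' hvC)
          · exact h2 _ (hN_of hM' fun h => (Finset.mem_sdiff.mp (hM' h)).2 hvP)
        · obtain ⟨C, hC, M, hM, h1, h2⟩ := ih _ hss _ (fun X => Q (insert v X))
            (insert_increment hQ hv)
          refine ⟨C, hC.trans hPS, insert v M, Finset.insert_subset
            (Finset.mem_sdiff.mpr ⟨hv, hvP⟩) (hM.trans hNS), fun C' hC' => ?_, fun M' hM' => ?_⟩
          · rw [Finset.union_insert, Finset.union_insert]
            exact h1 _ (hP_of hC' fun h => hvP (Finset.mem_inter.mp (hC' h)).2)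
          · rw [Finset.union_insert]
            by_cases hvM : v ∈ M'
            · rw [← Finset.insert_erase hvM, Finset.union_insert]
              exact h2 _ (hN_er hM')
            · exact (h2 _ (hN_of hM' hvM)).trans (hdec _ (hunion hC (hN_of hM' hvM)))
      · -- including `v` does not decrease `Q`
        have hinc : ∀ X ⊆ S.erase v, Q X ≤ Q (insert v X) := fun X hX => by
          have := hins X hX
          have := hcard X hX
          omega
        by_cases hvP : v ∈ P
        · obtain ⟨C, hC, M, hM, h1, h2⟩ := ih _ hss _ (fun X => Q (insert v X))
            (insert_increment hQ hv)
          refine ⟨insert v C, Finset.insert_subset (Finset.mem_inter.mpr ⟨hv, hvP⟩)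
            (hC.trans hPS), M, hM.trans hNS, fun C' hC' => ?_, fun M' hM' => ?_⟩
          · rw [Finset.insert_union]
            by_cases hvC : v ∈ C'
            · rw [← Finset.insert_erase hvC, Finset.insert_union]
              exact h1 _ (hP_er hC')
            · exact (hinc _ (hunion (hP_of hC' hvC) hM)).trans (h1 _ (hP_of hC' hvC))
          · rw [Finset.insert_union, Finset.insert_union]
            exact h2 _ (hN_of hM' fun h => (Finset.mem_sdiff.mp (hM' h)).2 hvP)
        · obtain ⟨C, hC, M, hM, h1, h2⟩ := ih _ hss a Q fun X hX u hu =>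
            hQ X (hX.trans hss.subset) u (hss.subset hu)
          refine ⟨C, hC.trans hPS, M, hM.trans hNS, fun C' hC' => ?_, fun M' hM' => ?_⟩
          · exact h1 _ (hP_of hC' fun h => hvP (Finset.mem_inter.mp (hC' h)).2)
          · by_cases hvM : v ∈ M'
            · rw [← Finset.insert_erase hvM, Finset.union_insert]
              exact (h2 _ (hN_er hM')).trans (hinc _ (hunion hC (hN_er hM')))
            · exact h2 _ (hN_of hM' hvM)

end Saddle

namespace PlumbingTree

variable {V : Type*} [Fintype V] [LinearOrder V] (G : PlumbingTree V)

/-! ### Integral formulas for the weight functions -/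

/-- The intersection number `(l, E_v)` of an integral cycle. -/
noncomputable def inter (l : V → ℤ) (v : V) : ℤ :=
  ∑ u, l u * intersectionMatrix G.graph G.euler u v

theorem cast_inter (l : V → ℤ) (v : V) : (G.inter l v : ℚ) = G.pairing (toRat l) (E v) := by
  rw [pairing_E, inter]; push_cast; rfl

theorem entry_comm (u v : V) : intersectionMatrix G.graph G.euler u v =
    intersectionMatrix G.graph G.euler v u := by
  have := G.matrix_symm u v
  simp only [matrix, Matrix.map_apply] at this
  exact_mod_cast this

theorem entry_nonneg {u v : V} (h : u ≠ v) : 0 ≤ intersectionMatrix G.graph G.euler u v := by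
  simp only [intersectionMatrix, h, if_false]
  split_ifs <;> simp

theorem entry_self (v : V) : intersectionMatrix G.graph G.euler v v = G.euler v := by
  simp [intersectionMatrix]

theorem inter_add (l m : V → ℤ) (v : V) : G.inter (l + m) v = G.inter l v + G.inter m v := by
  simp [inter, add_mul, Finset.sum_add_distrib]

theorem inter_sub (l m : V → ℤ) (v : V) : G.inter (l - m) v = G.inter l v - G.inter m v := by
  simp [inter, sub_mul, Finset.sum_sub_distrib]

theorem inter_single (u v : V) :
    G.inter (Pi.single u 1) v = intersectionMatrix G.graph G.euler u v := by
  simp [inter, Pi.single_apply]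

theorem inter_mono {x y : V → ℤ} (h : x ≤ y) {v : V} (hv : x v = y v) :
    G.inter x v ≤ G.inter y v := by
  refine Finset.sum_le_sum fun u _ => ?_
  by_cases huv : u = v
  · subst huv; rw [hv]
  · exact mul_le_mul_of_nonneg_right (h u) (G.entry_nonneg huv)

theorem toRat_single (v : V) : toRat (Pi.single v 1 : V → ℤ) = E v := by
  funext u
  by_cases h : u = v
  · subst h; simp [toRat, E]
  · simp [toRat, E, h]

theorem pairing_smul_right (a : ℚ) (x z : V → ℚ) :
    G.pairing x (a • z) = a * G.pairing x z := by
  rw [pairing_comm, pairing_smul_left, pairing_comm]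

/-- `2 χ_can(l) = -∑ l_v ((l, E_v) - e_v - 2)`. -/
theorem two_mul_chi (l : V → ℤ) :
    2 * G.weight G.kCan l = -∑ v, l v * (G.inter l v - G.euler v - 2) := by
  have h : (2 * G.weight G.kCan l : ℚ) = -∑ v, l v * (G.inter l v - G.euler v - 2 : ℚ) := by
    rw [G.weight_eq_chi G.kCan_mem_charElements, chi, pairing_add_right, G.pairing_comm _ G.kCan,
      G.pairing_eq_sum_E (toRat l), G.pairing_eq_sum_E G.kCan, ← Finset.sum_add_distrib, mul_div_cancel₀ _ two_ne_zero]
    congr 1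
    refine Finset.sum_congr rfl fun v _ => ?_
    rw [pairing_kCan, cast_inter, G.pairing_E (E v)]
    simp only [E, Pi.single_apply, ite_mul, one_mul, zero_mul, Finset.sum_ite_eq', Finset.mem_univ, if_true,
      matrix_diag, toRat]
    ring
  exact_mod_cast h

theorem chi_zero : G.weight G.kCan 0 = 0 := by
  have := G.two_mul_chi 0
  simp at this
  exact this

theorem chi_single (v : V) : G.weight G.kCan (Pi.single v 1) = 1 := by
  have := G.two_mul_chi (Pi.single v 1)
  rw [Finset.sum_eq_single v (fun u _ h => by simp [h]) (by simp), inter_single, entry_self] at this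
  simp at this
  omega

theorem sum_mul_inter_comm (l m : V → ℤ) : ∑ v, m v * G.inter l v = ∑ v, l v * G.inter m v := by
  simp only [inter, Finset.mul_sum]
  rw [Finset.sum_comm]
  refine Finset.sum_congr rfl fun u _ => Finset.sum_congr rfl fun v _ => ?_
  rw [G.entry_comm u v]; ring

theorem chi_add (l m : V → ℤ) : G.weight G.kCan (l + m) =
    G.weight G.kCan l + G.weight G.kCan m - ∑ v, m v * G.inter l v := by
  have h : 2 * G.weight G.kCan (l + m) =
      2 * G.weight G.kCan l + 2 * G.weight G.kCan m - 2 * ∑ v, m v * G.inter l v := by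
    rw [two_mul_chi, two_mul_chi, two_mul_chi, two_mul (∑ v, m v * G.inter l v)]
    nth_rewrite 2 [G.sum_mul_inter_comm l m]
    simp only [inter_add, Pi.add_apply, ← Finset.sum_neg_distrib, ← Finset.sum_add_distrib,
      ← Finset.sum_sub_distrib]
    exact Finset.sum_congr rfl fun v _ => by ring
  omega

variable (k : G.charElements)

/-- The intersection number `(x + l'_{[k]}, E_v)`. -/
noncomputable def slope (x : V → ℤ) (v : V) : ℤ :=
  G.inter x v + ⌊G.pairing (G.minLift k) (E v)⌋

/-- The floor in `slope` loses nothing, because l'_{[k]} lies in the dual lattice. -/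
theorem cast_slope (x : V → ℤ) (v : V) :
    (G.slope k x v : ℚ) = G.pairing (toRat x + G.minLift k) (E v) := by
  obtain ⟨n, hn⟩ := (G.minLift_isLeast k).1.1.1 (Pi.single v 1)
  rw [toRat_single] at hn
  rw [slope, pairing_add_left, Int.cast_add, cast_inter, hn, Int.floor_intCast]

theorem slope_add (x l : V → ℤ) (v : V) : G.slope k (x + l) v = G.slope k x v + G.inter l v := by
  rw [slope, slope, inter_add]; ring

theorem slope_mono {x y : V → ℤ} (h : x ≤ y) {v : V} (hv : x v = y v) :
    G.slope k x v ≤ G.slope k y v := by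
  have := G.inter_mono h hv
  simp only [slope]; omega

/-- At v the minimum agrees with one of the two cycles and elsewhere it lies below it, so only the
cycle that is smaller at v has to satisfy the inequality. -/
theorem slope_inf_nonpos {x y : V → ℤ} {v : V} (hx : x v ≤ y v → G.slope k x v ≤ 0)
    (hy : y v ≤ x v → G.slope k y v ≤ 0) : G.slope k (x ⊓ y) v ≤ 0 := by
  rcases le_total (x v) (y v) with h | h
  · exact (G.slope_mono k inf_le_left (inf_eq_left.mpr h)).trans (hx h)
  · exact (G.slope_mono k inf_le_right (inf_eq_right.mpr h)).trans (hy h)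

theorem slope_zero_nonpos (v : V) : G.slope k 0 v ≤ 0 := by
  have h := (G.minLift_isLeast k).1.1.2 v
  have e : toRat (0 : V → ℤ) + G.minLift k = G.minLift k := by
    funext u; simp [toRat]
  have := G.cast_slope k 0 v
  rw [e] at this
  rw [← this] at h
  exact_mod_cast h

theorem distinguishedRep_mem : G.distinguishedRep k ∈ G.charElements := by
  have hl := (G.minLift_isLeast k).1.1.1
  have hk := G.kCan_mem_charElements
  refine ⟨fun x => ?_, fun x => ?_⟩
  · obtain ⟨n, hn⟩ := hl x
    obtain ⟨m, hm⟩ := hk.1 x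
    refine ⟨m + 2 * n, ?_⟩
    rw [distinguishedRep, pairing_add_left, pairing_smul_left, hn, hm]
    push_cast; ring
  · obtain ⟨n, hn⟩ := hl x
    obtain ⟨m, hm⟩ := hk.2 x
    refine ⟨m + n, ?_⟩
    rw [distinguishedRep, pairing_add_left, pairing_smul_left, hn]
    push_cast; linarith

/-- Since k_r = k_can + 2 l'_{[k]}, the increment from x is χ_can(l) corrected by the pairing of l
with x + l'_{[k]}. Weight comparisons thus reduce to rationality, through χ_can, and to signs of
slopes. -/
theorem weight_add (x l : V → ℤ) : G.weight (G.distinguishedRep k) (x + l) =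
    G.weight (G.distinguishedRep k) x + G.weight G.kCan l - ∑ v, l v * G.slope k x v := by
  have h : (G.weight (G.distinguishedRep k) (x + l) : ℚ) =
      G.weight (G.distinguishedRep k) x + G.weight G.kCan l - ∑ v, l v * (G.slope k x v : ℚ) := by
    have e : ∑ v, l v * (G.slope k x v : ℚ) = G.pairing (toRat x + G.minLift k) (toRat l) := by
      rw [pairing_eq_sum_E]
      exact Finset.sum_congr rfl fun v _ => by rw [cast_slope]; rfl
    rw [e, G.weight_eq_chi (G.distinguishedRep_mem k), G.weight_eq_chi (G.distinguishedRep_mem k),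
      G.weight_eq_chi G.kCan_mem_charElements]
    simp only [chi, distinguishedRep, toRat_add, pairing_add_left, pairing_add_right,
      pairing_smul_right]
    rw [G.pairing_comm (toRat l) (toRat x), G.pairing_comm (G.minLift k) (toRat l)]
    ring
  exact_mod_cast h

theorem weight_add_single (x : V → ℤ) (v : V) : G.weight (G.distinguishedRep k) (x + Pi.single v 1) =
    G.weight (G.distinguishedRep k) x + 1 - G.slope k x v := by
  rw [weight_add, chi_single, Finset.sum_eq_single v (fun u _ h => by simp [h]) (by simp)]
  simp

/-- Measured from the minimum, the two cycles are effective with disjoint supports, so their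
intersection number is nonnegative; it is the defect in this inequality. -/
theorem weight_sup_add_weight_inf_le (x z : V → ℤ) :
    G.weight (G.distinguishedRep k) (x ⊔ z) + G.weight (G.distinguishedRep k) (x ⊓ z) ≤
      G.weight (G.distinguishedRep k) x + G.weight (G.distinguishedRep k) z := by
  set y := x ⊓ z with hy
  have hx : x = y + (x - y) := by abel
  have hz : z = y + (z - y) := by abel
  have hs : x ⊔ z = y + ((x - y) + (z - y)) := by
    funext v
    simp only [hy, Pi.sup_apply, Pi.add_apply, Pi.sub_apply, Pi.inf_apply]
    omega
  have h0 : 0 ≤ ∑ v, (z - y) v * G.inter (x - y) v := by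
    refine Finset.sum_nonneg fun v _ => ?_
    rw [inter, Finset.mul_sum]
    refine Finset.sum_nonneg fun u _ => ?_
    have h1 : 0 ≤ (z - y) v := sub_nonneg.mpr ((inf_le_right : y ≤ z) v)
    have h2 : 0 ≤ (x - y) u := sub_nonneg.mpr ((inf_le_left : y ≤ x) u)
    by_cases huv : u = v
    · subst huv
      have h3 : (z - y) u = 0 ∨ (x - y) u = 0 := by
        simp only [hy, Pi.sub_apply, Pi.inf_apply]
        omega
      rcases h3 with h3 | h3 <;> simp [h3]
    · exact mul_nonneg h1 (mul_nonneg h2 (G.entry_nonneg huv))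
  rw [hs, G.weight_add k y]
  nth_rewrite 3 [hx]
  nth_rewrite 3 [hz]
  rw [G.weight_add k y, G.weight_add k y, chi_add]
  simp only [Pi.add_apply, add_mul, Finset.sum_add_distrib]
  omega

/-- An integral cycle `z` such that `z + l'_{[k]}` is anti-nef is effective. -/
theorem nonneg_of_slope_nonpos {z : V → ℤ} (hz : ∀ v, G.slope k z v ≤ 0) : 0 ≤ z := by
  obtain ⟨⟨⟨hd, -⟩, m, hm⟩, hmin⟩ := G.minLift_isLeast k
  have hmem : toRat z + G.minLift k ∈ G.antiNefLifts k := by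
    refine ⟨⟨fun x => ?_, fun v => ?_⟩, m - z, ?_⟩
    · obtain ⟨a, ha⟩ := G.pairing_toRat z x
      obtain ⟨b, hb⟩ := hd x
      exact ⟨a + b, by rw [pairing_add_left, ha, hb]; push_cast; rfl⟩
    · rw [← cast_slope]
      exact_mod_cast hz v
    · rw [hm]
      funext v
      simp [toRat]
      ring
  intro v
  have := hmin hmem v
  simp only [Pi.add_apply, toRat] at this
  have h2 : (0 : ℚ) ≤ z v := by linarith
  simpa using h2

/-! ### Consequences of rationality -/

variable {G} {J : Finset V}

theorem IsBadSet.mono (hJ : G.IsBadSet J) {J' : Finset V} (h : J ⊆ J') : G.IsBadSet J' := by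
  obtain ⟨G', hg, h1, h2, h3⟩ := hJ
  refine ⟨G', hg, fun v _ => ?_, fun v hv => h2 v fun h' => hv (h h'), h3⟩
  by_cases hv : v ∈ J
  · exact h1 v hv
  · exact (h2 v hv).le

/-- Cycles with coefficients `0` or `1` at the bad vertices have positive `χ_can`. -/
theorem IsBadSet.chi_pos (hJ : G.IsBadSet J) {l : V → ℤ} (hl : 0 < l)
    (h01 : ∀ j ∈ J, l j = 0 ∨ l j = 1) : 0 < G.weight G.kCan l := by
  obtain ⟨G', hg, -, h2, hr⟩ := hJ
  have h1 := hr l hl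
  rw [← G'.weight_eq_chi G'.kCan_mem_charElements] at h1
  have h1' : 0 < G'.weight G'.kCan l := by exact_mod_cast h1
  -- The two sides differ by the sum of l_v (l_v - 1)(e_v - e'_v) up to sign, which vanishes when
  -- the coefficients at the modified vertices are 0 or 1.
  have e : 2 * G.weight G.kCan l = 2 * G'.weight G'.kCan l := by
    rw [two_mul_chi, two_mul_chi]
    congr 1
    refine Finset.sum_congr rfl fun v _ => ?_
    have hi : G.inter l v - G'.inter l v = l v * (G.euler v - G'.euler v) := by
      rw [inter, inter, ← Finset.sum_sub_distrib, Finset.sum_eq_single v]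
      · rw [entry_self, entry_self]; ring
      · intro u _ huv
        have ha : G'.graph.Adj u v ↔ G.graph.Adj u v := by rw [hg]
        by_cases h : G.graph.Adj u v
        · simp [intersectionMatrix, huv, h, ha.mpr h]
        · simp [intersectionMatrix, huv, h, mt ha.mp h]
      · simp
    by_cases hv : v ∈ J
    · rcases h01 v hv with h | h
      · simp [h]
      · rw [h] at hi ⊢; linarith
    · rw [h2 v hv, sub_self, mul_zero] at hi
      rw [h2 v hv]
      have : G.inter l v = G'.inter l v := by omega
      rw [this]
  omega

theorem IsBadSet.chi_nonneg (hJ : G.IsBadSet J) {l : V → ℤ} (hl : 0 ≤ l)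
    (h01 : ∀ j ∈ J, l j = 0 ∨ l j = 1) : 0 ≤ G.weight G.kCan l := by
  rcases hl.eq_or_lt with h | h
  · rw [← h, chi_zero]
  · exact (hJ.chi_pos h h01).le

/-- The reduced cycle with support `S`. -/
def reduced (S : Finset V) : V → ℤ := fun v => if v ∈ S then 1 else 0

theorem reduced_insert {S : Finset V} {v : V} (h : v ∉ S) :
    reduced (insert v S) = reduced S + Pi.single v 1 := by
  funext u
  by_cases hu : u = v
  · subst hu; simp [reduced, h]
  · simp [reduced, hu]

theorem chi_add_of_orthogonal {l m : V → ℤ} (h : ∀ v, m v ≠ 0 → G.inter l v = 0) :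
    G.weight G.kCan (l + m) = G.weight G.kCan l + G.weight G.kCan m := by
  rw [chi_add, Finset.sum_eq_zero, sub_zero]
  intro v _
  by_cases hv : m v = 0
  · rw [hv, zero_mul]
  · rw [h v hv, mul_zero]

/-- Passing to the reduced cycle with the same support does not increase `χ_can`. -/
theorem IsBadSet.chi_reduced_le (hJ : G.IsBadSet J) (S : Finset V) :
    ∀ l : V → ℤ, (∀ v, v ∈ S → 0 < l v) → (∀ v, v ∉ S → l v = 0) →
      (∀ j ∈ J, l j = 0 ∨ l j = 1) → G.weight G.kCan (reduced S) ≤ G.weight G.kCan l := by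
  induction S using Finset.strongInduction with
  | H S ih =>
    intro l hpos hzero h01
    rcases S.eq_empty_or_nonempty with rfl | ⟨s, hs⟩
    · have h1 : l = 0 := funext fun v => hzero v (by simp)
      have h2 : (reduced ∅ : V → ℤ) = 0 := funext fun v => by simp [reduced]
      rw [h1, h2]
    -- A largest nonempty part A of S with χ_can at most 1 is split off; single vertices show that
    -- one exists.
    have hne : (S.powerset.filter fun A => A.Nonempty ∧ G.weight G.kCan (reduced A) ≤ 1).Nonempty := by
      refine ⟨{s}, Finset.mem_filter.mpr ⟨by simpa using hs, by simp, ?_⟩⟩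
      have : (reduced {s} : V → ℤ) = Pi.single s 1 := by
        funext u; by_cases hu : u = s <;> simp [reduced, hu]
      rw [this, chi_single]
    obtain ⟨A, hA, hmax⟩ := Finset.exists_max_image _ Finset.card hne
    obtain ⟨hAS, hAne, hAchi⟩ := Finset.mem_filter.mp hA
    rw [Finset.mem_powerset] at hAS
    have hterm : ∀ v u, v ∉ A → 0 ≤ reduced A u * intersectionMatrix G.graph G.euler u v := by
      intro v u hv
      by_cases hu : u ∈ A
      · simp only [reduced, hu, if_true, one_mul]
        exact G.entry_nonneg fun e => hv (e ▸ hu)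
      · simp [reduced, hu]
    -- A vertex of S outside A that meets A could be added, since χ_can changes by 1 - (A, E_v) ≤ 0.
    -- Maximality thus makes A orthogonal to the rest of S. On A positivity gives χ_can ≥ 1, and the
    -- rest is handled by induction.
    have horth : ∀ v ∈ S, v ∉ A → G.inter (reduced A) v = 0 := by
      intro v hvS hvA
      by_contra hne0
      have h0 : 0 ≤ G.inter (reduced A) v := Finset.sum_nonneg fun u _ => hterm v u hvA
      have h1 : G.weight G.kCan (reduced (insert v A)) ≤ 1 := by
        rw [reduced_insert hvA, chi_add, chi_single,
          Finset.sum_eq_single v (fun u _ h => by simp [h]) (by simp), Pi.single_eq_same]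
        omega
      have h2 := hmax (insert v A) (Finset.mem_filter.mpr
        ⟨Finset.mem_powerset.mpr (Finset.insert_subset hvS hAS), Finset.insert_nonempty _ _, h1⟩)
      rw [Finset.card_insert_of_notMem hvA] at h2
      omega
    have hentry : ∀ v ∈ S, v ∉ A → ∀ u ∈ A, intersectionMatrix G.graph G.euler u v = 0 := by
      intro v hvS hvA u hu
      have := (Finset.sum_eq_zero_iff_of_nonneg (fun u _ => hterm v u hvA)).mp
        (horth v hvS hvA) u (Finset.mem_univ u)
      simpa [reduced, hu] using this
    let l₁ : V → ℤ := fun v => if v ∈ A then l v else 0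
    let l₂ : V → ℤ := fun v => if v ∈ A then 0 else l v
    have hl : l = l₁ + l₂ := by
      funext v; by_cases hv : v ∈ A <;> simp [l₁, l₂, hv]
    have hr : reduced S = reduced A + reduced (S \ A) := by
      funext v
      by_cases hv : v ∈ A
      · simp [reduced, hv, hAS hv]
      · by_cases hvS : v ∈ S <;> simp [reduced, hv, hvS]
    have hl₂ : ∀ v, l₂ v ≠ 0 → v ∈ S ∧ v ∉ A := by
      intro v hv
      by_cases hvA : v ∈ A
      · simp [l₂, hvA] at hv
      · refine ⟨?_, hvA⟩
        by_contra hvS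
        exact hv (by simp [l₂, hzero v hvS])
    rw [hl, hr, chi_add_of_orthogonal, chi_add_of_orthogonal]
    · refine add_le_add ?_ ?_
      · refine hAchi.trans (hJ.chi_pos ?_ fun j hj => ?_)
        · obtain ⟨a, ha⟩ := hAne
          refine lt_of_le_of_ne (fun v => ?_) fun h => ?_
          · by_cases hv : v ∈ A
            · simpa [l₁, hv] using (hpos v (hAS hv)).le
            · simp [l₁, hv]
          · have h1 := congrFun h a
            have h2 := hpos a (hAS ha)
            simp only [Pi.zero_apply, l₁, ha, if_true] at h1
            omega
        · by_cases hv : j ∈ A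
          · simpa [l₁, hv] using h01 j hj
          · simp [l₁, hv]
      · obtain ⟨a, ha⟩ := hAne
        refine ih (S \ A) (Finset.ssubset_iff_subset_ne.mpr ⟨Finset.sdiff_subset, fun h => ?_⟩) l₂
          (fun v hv => ?_) (fun v hv => ?_) fun j hj => ?_
        · have := hAS ha
          rw [← h] at this
          exact (Finset.mem_sdiff.mp this).2 ha
        · obtain ⟨h1, h2⟩ := Finset.mem_sdiff.mp hv
          simpa [l₂, h2] using hpos v h1
        · by_contra h
          exact hv (Finset.mem_sdiff.mpr (hl₂ v h))
        · by_cases hv : j ∈ A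
          · simp [l₂, hv]
          · simpa [l₂, hv] using h01 j hj
    · intro v hv
      obtain ⟨h1, h2⟩ := hl₂ v hv
      refine Finset.sum_eq_zero fun u _ => ?_
      by_cases hu : u ∈ A
      · rw [hentry v h1 h2 u hu, mul_zero]
      · simp [l₁, hu]
    · intro v hv
      by_cases h : v ∈ S \ A
      · exact horth v (Finset.mem_sdiff.mp h).1 (Finset.mem_sdiff.mp h).2
      · simp [reduced, h] at hv

/-- A positive cycle supported outside the bad vertices can be reduced at some base element
without increasing `χ_can`. -/
theorem IsBadSet.exists_inter_le (hJ : G.IsBadSet J) {l : V → ℤ} (hl : 0 < l)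
    (h0 : ∀ j ∈ J, l j = 0) : ∃ u, 0 < l u ∧ G.inter l u ≤ 1 + G.euler u := by
  by_contra! h
  have h1 := hJ.chi_pos hl fun j hj => Or.inl (h0 j hj)
  have h2 := G.two_mul_chi l
  have h3 : 0 ≤ ∑ v, l v * (G.inter l v - G.euler v - 2) := by
    refine Finset.sum_nonneg fun v _ => ?_
    rcases (hl.le v).eq_or_lt with h4 | h4
    · rw [← h4]; simp
    · exact mul_nonneg h4.le (by have := h v h4; omega)
  omega

end PlumbingTree

namespace PlumbingTree

variable {V : Type*} [Fintype V] [LinearOrder V] (G : PlumbingTree V) (k : G.charElements)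

/-! ### The reduced weights as functions on the whole lattice -/

/-- The universal cycle with the coefficients of `x⁺` at the vertices in `J`. -/
noncomputable def cycleOver (J : Finset V) (x : V → ℤ) : V → ℤ :=
  G.universalCycle k J fun j => (x j).toNat

/-- The reduced weight of the restriction of `x⁺` to `J`. -/
noncomputable def weightOver (J : Finset V) (x : V → ℤ) : ℤ :=
  G.reducedWeight k J fun j => (x j).toNat

theorem weightOver_eq (J : Finset V) (x : V → ℤ) :
    G.weightOver k J x = G.weight (G.distinguishedRep k) (G.cycleOver k J x) := rfl

theorem weightOver_congr {J : Finset V} {x y : V → ℤ} (h : ∀ j ∈ J, max (x j) 0 = max (y j) 0) :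
    G.weightOver k J x = G.weightOver k J y := by
  have : (fun j : J => (x j).toNat) = fun j : J => (y j).toNat := by
    funext j
    have := h j.1 j.2
    omega
  rw [weightOver, weightOver, this]

theorem cycleOver_apply (J : Finset V) (x : V → ℤ) {j : V} (hj : j ∈ J) :
    G.cycleOver k J x j = max (x j) 0 := by
  have := (G.universalCycle_isLeast k J fun j => (x j).toNat).1.1 ⟨j, hj⟩
  simp only at this
  rw [cycleOver, this]
  omega

theorem slope_cycleOver (J : Finset V) (x : V → ℤ) {v : V} (hv : v ∉ J) :
    G.slope k (G.cycleOver k J x) v ≤ 0 := by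
  have := (G.universalCycle_isLeast k J fun j => (x j).toNat).1.2 v hv
  rw [← cast_slope] at this
  exact_mod_cast this

theorem cycleOver_le (J : Finset V) (x : V → ℤ) {z : V → ℤ} (h1 : ∀ j ∈ J, z j = max (x j) 0)
    (h2 : ∀ v, v ∉ J → G.slope k z v ≤ 0) : G.cycleOver k J x ≤ z := by
  refine (G.universalCycle_isLeast k J fun j => (x j).toNat).2 ⟨fun j => ?_, fun v hv => ?_⟩
  · rw [h1 j.1 j.2]
    exact (Int.toNat_eq_max _).symm
  · rw [← cast_slope]
    exact_mod_cast h2 v hv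

/-- The minimum of the universal cycle and 0 has nonpositive slopes everywhere: at the vertices of J
it is 0, and off J both cycles qualify. Minimality of l'_{[k]} then makes it effective. -/
theorem cycleOver_nonneg (J : Finset V) (x : V → ℤ) : 0 ≤ G.cycleOver k J x := by
  refine le_trans (G.nonneg_of_slope_nonpos k (z := G.cycleOver k J x ⊓ 0) fun v => ?_) inf_le_left
  by_cases hv : v ∈ J
  · have h1 := G.cycleOver_apply k J x hv
    refine (G.slope_mono k inf_le_right ?_).trans (G.slope_zero_nonpos k v)
    simp only [Pi.inf_apply, h1, Pi.zero_apply]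
    omega
  · exact G.slope_inf_nonpos k (fun _ => G.slope_cycleOver k J x hv)
      fun _ => G.slope_zero_nonpos k v

/-- The cycles below the universal cycle have at least its weight. -/
theorem weightOver_le_of_le (J : Finset V) (x : V → ℤ) : ∀ (n : ℕ) (z : V → ℤ),
    (∑ v, (G.cycleOver k J x v - z v)).toNat = n → z ≤ G.cycleOver k J x →
    (∀ j ∈ J, z j = max (x j) 0) → G.weightOver k J x ≤ G.weight (G.distinguishedRep k) z := by
  intro n
  induction n using Nat.strong_induction_on with
  | _ n ih =>
    intro z hn hle hz
    by_cases h : ∀ v, v ∉ J → G.slope k z v ≤ 0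
    · rw [weightOver_eq, le_antisymm (G.cycleOver_le k J x hz h) hle]
    · push Not at h
      obtain ⟨v, hv, hs⟩ := h
      -- A vertex with positive slope cannot already have its final coefficient, so adding E_v does
      -- not overshoot the universal cycle; the weight changes by 1 - slope ≤ 0.
      have hlt : z v < G.cycleOver k J x v := by
        refine lt_of_le_of_ne (hle v) fun e => ?_
        have h1 := G.slope_mono k hle e
        have h2 := G.slope_cycleOver k J x hv
        omega
      have hle' : z + Pi.single v 1 ≤ G.cycleOver k J x := by
        intro u
        by_cases hu : u = v
        · subst hu; simpa using hlt
        · simpa [hu] using hle u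
      have hsum : ∑ u, (G.cycleOver k J x u - (z + Pi.single v 1 : V → ℤ) u) =
          ∑ u, (G.cycleOver k J x u - z u) - 1 := by
        simp only [Pi.add_apply, ← sub_sub, Finset.sum_sub_distrib]
        simp
      have hpos : 0 ≤ ∑ u, (G.cycleOver k J x u - (z + Pi.single v 1 : V → ℤ) u) :=
        Finset.sum_nonneg fun u _ => sub_nonneg.mpr (hle' u)
      have := ih _ (by omega) (z + Pi.single v 1) rfl hle' fun j hj => by
        have : j ≠ v := fun e => hv (e ▸ hj)
        simpa [this] using hz j hj
      rw [weight_add_single] at this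
      omega

variable {G} {J : Finset V}

/-- The reduced weight is the minimum of the weights in the fibre. -/
theorem IsBadSet.weightOver_le (hJ : G.IsBadSet J) (x : V → ℤ) {z : V → ℤ}
    (hz : ∀ j ∈ J, z j = max (x j) 0) :
    G.weightOver k J x ≤ G.weight (G.distinguishedRep k) z := by
  set y := G.cycleOver k J x with hy
  -- By submodularity it is enough to compare with the cycles below y, reached by a computation
  -- sequence, and with those above y, where rationality gives χ_can ≥ 0.
  have h1 := G.weight_sup_add_weight_inf_le k z y
  have hyJ : ∀ j ∈ J, y j = max (x j) 0 := fun j hj => G.cycleOver_apply k J x hj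
  have h2 : G.weightOver k J x ≤ G.weight (G.distinguishedRep k) (z ⊓ y) :=
    G.weightOver_le_of_le k J x _ _ rfl inf_le_right fun j hj => by
      rw [Pi.inf_apply, hz j hj, hyJ j hj, inf_idem]
  have h3 : G.weight (G.distinguishedRep k) y ≤ G.weight (G.distinguishedRep k) (z ⊔ y) := by
    have e : z ⊔ y = y + (z ⊔ y - y) := by abel
    have h0 : 0 ≤ z ⊔ y - y := sub_nonneg.mpr le_sup_right
    have hJ0 : ∀ j ∈ J, (z ⊔ y - y) j = 0 := fun j hj => by
      rw [Pi.sub_apply, Pi.sup_apply, hz j hj, hyJ j hj, sup_idem, sub_self]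
    rw [e, weight_add]
    have h4 := hJ.chi_nonneg h0 fun j hj => Or.inl (hJ0 j hj)
    have h5 : ∑ v, (z ⊔ y - y) v * G.slope k y v ≤ 0 := by
      refine Finset.sum_nonpos fun v _ => ?_
      by_cases hv : v ∈ J
      · rw [hJ0 v hv, zero_mul]
      · exact mul_nonpos_of_nonneg_of_nonpos (h0 v) (G.slope_cycleOver k J x hv)
    omega
  omega

/-- The descending half of a line: the weights decrease up to the level of the universal cycle. -/
theorem IsBadSet.weightOver_succ_le (hJ : G.IsBadSet J) {v : V} (hv : v ∈ J) (x : V → ℤ) {n : ℤ}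
    (hn : n < G.cycleOver k (J.erase v) x v) :
    G.weightOver k J (Function.update x v (n + 1)) ≤ G.weightOver k J (Function.update x v n) := by
  -- At a negative height n both n and n + 1 have positive part 0, and the weights are equal.
  rcases lt_or_ge n 0 with h0 | h0
  · refine (G.weightOver_congr k fun j _ => ?_).le
    by_cases hj : j = v
    · subst hj; simp only [Function.update_self]; omega
    · simp [hj]
  · set z := G.cycleOver k J (Function.update x v n) with hz
    have hzv : z v = n := by
      rw [hz, cycleOver_apply _ _ _ _ hv, Function.update_self]; omega
    have hzJ : ∀ j ∈ J, j ≠ v → z j = max (x j) 0 := fun j hj hjv => by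
      rw [hz, cycleOver_apply _ _ _ _ hj, Function.update_of_ne hjv]
    -- Otherwise z would compete in the definition of the universal cycle for J ∖ v, whose
    -- coefficient at v is larger than n.
    have hs : 1 ≤ G.slope k z v := by
      by_contra hs
      have := G.cycleOver_le k (J.erase v) x (z := z)
        (fun j hj => hzJ j (Finset.mem_of_mem_erase hj) (Finset.ne_of_mem_erase hj))
        (fun u hu => by
          by_cases huv : u = v
          · subst huv; omega
          · exact G.slope_cycleOver k J _ fun h => hu (Finset.mem_erase.mpr ⟨huv, h⟩)) v
      exact absurd (this.trans_eq hzv) (not_le.mpr hn)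
    have h1 := hJ.weightOver_le k (Function.update x v (n + 1)) (z := z + Pi.single v 1)
      (fun j hj => by
        by_cases hjv : j = v
        · subst hjv
          simp only [Pi.add_apply, Pi.single_eq_same, Function.update_self]; omega
        · simp [hjv, hzJ j hj hjv])
    rw [weight_add_single] at h1
    rw [G.weightOver_eq k J (Function.update x v n), ← hz]
    omega

/-- The ascending half of a line. -/
theorem IsBadSet.weightOver_le_succ (hJ : G.IsBadSet J) {v : V} (hv : v ∈ J)
    (hJ₀ : G.IsBadSet (J.erase v)) (x : V → ℤ) {n : ℤ}
    (hn : G.cycleOver k (J.erase v) x v ≤ n) :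
    G.weightOver k J (Function.update x v n) ≤ G.weightOver k J (Function.update x v (n + 1)) := by
  set y := G.cycleOver k (J.erase v) x with hy
  have hyv : 0 ≤ y v := G.cycleOver_nonneg k (J.erase v) x v
  have hyJ : ∀ j ∈ J, j ≠ v → y j = max (x j) 0 := fun j hj hjv =>
    G.cycleOver_apply k _ x (Finset.mem_erase.mpr ⟨hjv, hj⟩)
  have hys : ∀ u, u ∉ J.erase v → G.slope k y u ≤ 0 := fun u hu => G.slope_cycleOver k _ x hu
  -- Rationality for J ∖ v allows base elements to be removed from l one at a time without raising
  -- the weight. As long as v has not been removed its coefficient in l stays positive, so the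
  -- process goes on until E_v is removed; that puts the cycle in the fibre over n.
  have descend : ∀ (m : ℕ) (l : V → ℤ), (∑ u, l u).toNat = m → 0 ≤ l →
      (∀ j ∈ J.erase v, l j = 0) → y v + l v = n + 1 →
      G.weightOver k J (Function.update x v n) ≤ G.weight (G.distinguishedRep k) (y + l) := by
    intro m
    induction m using Nat.strong_induction_on with
    | _ m ih =>
      intro l hm hl hlJ hlv
      have hlpos : 0 < l := lt_of_le_of_ne hl fun e => by
        rw [← e] at hlv; simp only [Pi.zero_apply] at hlv; omega
      obtain ⟨u, hu, hi⟩ := hJ₀.exists_inter_le hlpos hlJ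
      have huJ : u ∉ J.erase v := fun h => by have := hlJ u h; omega
      have e : y + l = (y + (l - Pi.single u 1)) + Pi.single u 1 := by abel
      have hstep : G.weight (G.distinguishedRep k) (y + (l - Pi.single u 1)) ≤
          G.weight (G.distinguishedRep k) (y + l) := by
        rw [e, weight_add_single, slope_add, inter_sub, inter_single, entry_self]
        have := hys u huJ
        omega
      refine le_trans ?_ hstep
      by_cases huv : u = v
      · subst huv
        refine hJ.weightOver_le k _ fun j hj => ?_
        by_cases hju : j = u
        · subst hju
          simp only [Pi.add_apply, Pi.sub_apply, Pi.single_eq_same, Function.update_self]; omega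
        · simp [hju, hyJ j hj hju, hlJ j (Finset.mem_erase.mpr ⟨hju, hj⟩)]
      · have hl' : 0 ≤ l - Pi.single u 1 := by
          intro w
          by_cases hw : w = u
          · subst hw; simp only [Pi.sub_apply, Pi.single_eq_same, Pi.zero_apply]; omega
          · simpa [hw] using hl w
        have hs : ∑ w, (l - Pi.single u 1 : V → ℤ) w = ∑ w, l w - 1 := by
          simp [Finset.sum_sub_distrib]
        have hs0 : 0 ≤ ∑ w, (l - Pi.single u 1 : V → ℤ) w := Finset.sum_nonneg fun w _ => hl' w
        refine ih _ (by omega) _ rfl hl' (fun j hj => ?_) ?_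
        · have : j ≠ u := fun h => huJ (h ▸ hj)
          simp [this, hlJ j hj]
        · simpa [Ne.symm huv] using hlv
  set z := G.cycleOver k J (Function.update x v (n + 1)) with hz
  have hzv : z v = n + 1 := by
    rw [hz, cycleOver_apply _ _ _ _ hv, Function.update_self]; omega
  have hzJ : ∀ j ∈ J, j ≠ v → z j = max (x j) 0 := fun j hj hjv => by
    rw [hz, cycleOver_apply _ _ _ _ hj, Function.update_of_ne hjv]
  -- The minimum of z and y satisfies the conditions that define y; at v only y matters, because y v
  -- ≤ n < z v.
  have hyz : y ≤ z := by
    refine (G.cycleOver_le k (J.erase v) x (z := z ⊓ y) (fun j hj => ?_) fun u hu => ?_).trans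
      inf_le_left
    · obtain ⟨hjv, hj⟩ := Finset.mem_erase.mp hj
      rw [Pi.inf_apply, hzJ j hj hjv, hyJ j hj hjv, inf_idem]
    · refine G.slope_inf_nonpos k (fun h => ?_) fun _ => hys u hu
      by_cases huv : u = v
      · subst huv; omega
      · exact G.slope_cycleOver k J _ fun h => hu (Finset.mem_erase.mpr ⟨huv, h⟩)
  have e : z = y + (z - y) := by abel
  rw [G.weightOver_eq k J (Function.update x v (n + 1)), ← hz, e]
  refine descend _ _ rfl (sub_nonneg.mpr hyz) (fun j hj => ?_) ?_
  · obtain ⟨hjv, hj⟩ := Finset.mem_erase.mp hj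
    rw [Pi.sub_apply, hzJ j hj hjv, hyJ j hj hjv, sub_self]
  · rw [Pi.sub_apply]; omega

theorem le_of_forall_succ_le {f : ℤ → ℤ} {a b : ℤ} (hab : a ≤ b)
    (h : ∀ n, a ≤ n → n < b → f (n + 1) ≤ f n) : f b ≤ f a := by
  induction b, hab using Int.leInduction with
  | base => exact le_rfl
  | succ n hn ih => exact (h n hn (by omega)).trans (ih fun m h1 h2 => h m h1 (by omega))

/-- The weight along the line is unimodal, with its turning point at the v-coefficient of the
universal cycle for J ∖ v. -/
theorem IsBadSet.weightOver_quasiconvex (hJ : G.IsBadSet J) {v : V} (hv : v ∈ J)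
    (hJ₀ : G.IsBadSet (J.erase v)) (x : V → ℤ) {a b c : ℤ} (hab : a ≤ b) (hbc : b ≤ c) :
    G.weightOver k J (Function.update x v b) ≤
      max (G.weightOver k J (Function.update x v a)) (G.weightOver k J (Function.update x v c)) := by
  rcases le_total b (G.cycleOver k (J.erase v) x v) with h | h
  · exact le_max_of_le_left (le_of_forall_succ_le (f := fun n => G.weightOver k J (Function.update x v n))
      hab fun n _ hn => hJ.weightOver_succ_le k hv x (by omega))
  · refine le_max_of_le_right ?_
    have := le_of_forall_succ_le (f := fun n => -G.weightOver k J (Function.update x v n))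
      hbc fun n hn _ => neg_le_neg (hJ.weightOver_le_succ k hv hJ₀ x (by omega))
    exact neg_le_neg_iff.mp this

theorem IsBadSet.weightOver_erase_le {v : V} (hJ₀ : G.IsBadSet (J.erase v)) (x : V → ℤ) :
    G.weightOver k (J.erase v) x ≤ G.weightOver k J x := by
  rw [G.weightOver_eq k J]
  exact hJ₀.weightOver_le k x fun j hj => G.cycleOver_apply k J x (Finset.mem_of_mem_erase hj)

end PlumbingTree

namespace PlumbingTree

open LatticeCohomology

variable {V : Type*} [Fintype V] [LinearOrder V] {G : PlumbingTree V} (k : G.charElements)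
  {J : Finset V}

/-! ### The levels of the cubes -/

theorem inter_reduced {A : Finset V} {u : V} (hu : u ∉ A) [DecidablePred (G.graph.Adj u)] :
    G.inter (reduced A) u = (A.filter (G.graph.Adj u)).card := by
  classical
  rw [inter, Finset.card_filter]
  push_cast
  rw [← Finset.sum_subset (Finset.subset_univ A) fun v _ hv => by simp [reduced, hv]]
  refine Finset.sum_congr rfl fun v hv => ?_
  have huv : v ≠ u := fun e => hu (e ▸ hv)
  simp [reduced, hv, intersectionMatrix, huv, G.graph.adj_comm v u]

/-- The saddle point property of the weights near a universal cycle. -/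
theorem exists_weight_saddle_point (y : V → ℤ) (P N : Finset V) (hPN : Disjoint P N) :
    ∃ C ⊆ P, ∃ M ⊆ N,
      (∀ C' ⊆ P, G.weight (G.distinguishedRep k) (y + reduced (C' ∪ M)) ≤
        G.weight (G.distinguishedRep k) (y + reduced (C ∪ M))) ∧
      ∀ M' ⊆ N, G.weight (G.distinguishedRep k) (y + reduced (C ∪ M)) ≤
        G.weight (G.distinguishedRep k) (y + reduced (C ∪ M')) := by
  classical
  have := exists_saddle_point G.isTree P (P ∪ N) (fun u => 1 - G.slope k y u)
    (fun A => G.weight (G.distinguishedRep k) (y + reduced A)) fun X _ u _ hu => by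
      rw [reduced_insert hu, ← add_assoc, weight_add_single, slope_add, inter_reduced hu]
      ring
  have e1 : (P ∪ N) ∩ P = P := Finset.inter_eq_right.mpr Finset.subset_union_left
  have e2 : (P ∪ N) \ P = N := by
    rw [Finset.union_sdiff_left]
    exact Finset.sdiff_eq_self_of_disjoint hPN.symm
  rwa [e1, e2] at this

/-- The difference of the universal cycles over the two points has coefficients 0 or 1 on J.
Replacing it by the reduced cycle of its support lowers χ_can by rationality, and it lowers the
slope term too, since slopes off J are nonpositive. So the minimizing player always has an answer
among reduced cycles. -/
theorem IsBadSet.exists_reduced_le (hJ : G.IsBadSet J) (l : V → ℤ) {C : Finset V} (hCJ : C ⊆ J)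
    (hC : ∀ j ∈ C, 0 ≤ l j) : ∃ M ⊆ Jᶜ, G.weight (G.distinguishedRep k)
      (G.cycleOver k J l + reduced (C ∪ M)) ≤ G.weightOver k J (translate l C) := by
  set y := G.cycleOver k J l with hy
  set z := G.cycleOver k J (translate l C) with hz
  have hyJ : ∀ j ∈ J, y j = max (l j) 0 := fun j hj => G.cycleOver_apply k J l hj
  have hzJ : ∀ j ∈ J, z j = y j + if j ∈ C then 1 else 0 := fun j hj => by
    rw [hz, cycleOver_apply _ _ _ _ hj, hyJ j hj]
    by_cases hjC : j ∈ C
    · have := hC j hjC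
      rw [translate_of_mem l hjC, if_pos hjC]; omega
    · rw [translate_of_notMem l hjC, if_neg hjC, add_zero]
  have hyz : y ≤ z := by
    refine (G.cycleOver_le k J l (z := z ⊓ y) (fun j hj => ?_) fun u hu => ?_).trans inf_le_left
    · rw [Pi.inf_apply, hzJ j hj, ← hyJ j hj]
      refine inf_eq_right.mpr ?_
      split_ifs <;> omega
    · exact G.slope_inf_nonpos k (fun _ => G.slope_cycleOver k J _ hu)
        fun _ => G.slope_cycleOver k J _ hu
  set m := z - y with hm
  have hm0 : 0 ≤ m := sub_nonneg.mpr hyz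
  have hmJ : ∀ j ∈ J, m j = if j ∈ C then 1 else 0 := fun j hj => by
    rw [hm, Pi.sub_apply, hzJ j hj]; ring
  let S : Finset V := Finset.univ.filter fun v => m v ≠ 0
  have hS : S = C ∪ (S \ J) := by
    ext v
    simp only [S, Finset.mem_union, Finset.mem_sdiff, Finset.mem_filter, Finset.mem_univ, true_and]
    by_cases hv : v ∈ J
    · rw [hmJ v hv]
      by_cases hvC : v ∈ C <;> simp [hvC, hv]
    · have : v ∉ C := fun h => hv (hCJ h)
      simp [hv, this]
  refine ⟨S \ J, fun v hv => Finset.mem_compl.mpr (Finset.mem_sdiff.mp hv).2, ?_⟩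
  rw [← hS, weightOver_eq, ← hz]
  have e : z = y + m := by rw [hm]; abel
  rw [e, weight_add, weight_add]
  have h1 : G.weight G.kCan (reduced S) ≤ G.weight G.kCan m := by
    refine hJ.chi_reduced_le S m (fun v hv => lt_of_le_of_ne (hm0 v) ?_) (fun v hv => ?_)
      fun j hj => ?_
    · exact (Finset.mem_filter.mp hv).2.symm
    · by_contra h
      exact hv (Finset.mem_filter.mpr ⟨Finset.mem_univ v, h⟩)
    · rw [hmJ j hj]; split_ifs <;> simp
  have h2 : ∑ v, m v * G.slope k y v ≤ ∑ v, reduced S v * G.slope k y v := by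
    refine Finset.sum_le_sum fun v _ => ?_
    have h3 : 0 ≤ m v := hm0 v
    by_cases hv : v ∈ J
    · refine le_of_eq ?_
      congr 1
      have := hmJ v hv
      by_cases hvC : v ∈ C
      · simp [reduced, S, this, hvC]
      · simp [reduced, S, this, hvC]
    · refine mul_le_mul_of_nonpos_right ?_ (G.slope_cycleOver k J l hv)
      by_cases h : m v = 0
      · simp [reduced, S, h]
      · simp only [reduced, S, Finset.mem_filter, Finset.mem_univ, true_and, ne_eq, h,
          not_false_eq_true, if_true]
        omega
  omega

/-- One player picks directions of the cube, the other a reduced cycle off J ∖ v. At the saddle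
point the answer M to the worst vertex C works for all vertices at once, and the value is at most
the weight of the vertex C of the projected cube. -/
theorem IsBadSet.exists_level (hJ : G.IsBadSet J) {v : V} (hv : v ∈ J)
    (hJ₀ : G.IsBadSet (J.erase v)) (l : V → ℤ) {I : Finset V} (hvI : v ∉ I) :
    ∃ n : ℤ, ∀ A ⊆ I, G.weightOver k J (Function.update (translate l A) v n) ≤
      cubeWeight (G.weightOver k (J.erase v)) (l, I) := by
  set y := G.cycleOver k (J.erase v) l with hy
  have hyJ : ∀ j ∈ J, j ≠ v → y j = max (l j) 0 := fun j hj hjv =>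
    G.cycleOver_apply k _ l (Finset.mem_erase.mpr ⟨hjv, hj⟩)
  -- A unit step at a negative coordinate, or outside J ∖ v, does not alter the positive parts that
  -- count, so such directions are left out of the game.
  let P : Finset V := I.filter fun j => j ∈ J.erase v ∧ 0 ≤ l j
  have hPJ : P ⊆ J.erase v := fun j hj => (Finset.mem_filter.mp hj).2.1
  have hPI : P ⊆ I := Finset.filter_subset _ _
  have hdisj : Disjoint P (J.erase v)ᶜ := disjoint_compl_right.mono_left hPJ
  obtain ⟨C, hC, M, hM, h1, h2⟩ := exists_weight_saddle_point k y P (J.erase v)ᶜ hdisj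
  obtain ⟨M', hM', h3⟩ := hJ₀.exists_reduced_le k l (hC.trans hPJ)
    fun j hj => (Finset.mem_filter.mp (hC hj)).2.2
  have h4 : G.weight (G.distinguishedRep k) (y + reduced (C ∪ M)) ≤
      cubeWeight (G.weightOver k (J.erase v)) (l, I) :=
    (h2 M' hM').trans (h3.trans (le_cubeWeight _ (l, I) (hC.trans hPI)))
  -- Since v is not in P, the lift y + reduced ((A ∩ P) ∪ M) has the same coefficient at v for every
  -- vertex A of the cube.
  refine ⟨y v + reduced M v, fun A hA => le_trans ?_ ((h1 (A ∩ P) Finset.inter_subset_right).trans h4)⟩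
  refine hJ.weightOver_le k _ fun j hj => ?_
  by_cases hjv : j = v
  · subst hjv
    have hjP : j ∉ A ∩ P := fun h => by simpa using hPJ (Finset.mem_inter.mp h).2
    have h0 : 0 ≤ y j := G.cycleOver_nonneg k _ l j
    simp only [Function.update_self, Pi.add_apply, reduced, Finset.mem_union, hjP, false_or]
    split_ifs <;> omega
  · have hjM : j ∉ M := fun h => Finset.mem_compl.mp (hM h) (Finset.mem_erase.mpr ⟨hjv, hj⟩)
    rw [Function.update_of_ne hjv, Pi.add_apply, hyJ j hj hjv]
    simp only [reduced, Finset.mem_union, hjM, or_false, Finset.mem_inter]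
    by_cases hjA : j ∈ A
    · rw [translate_of_mem l hjA]
      have hjP : j ∈ P ↔ 0 ≤ l j := by
        simp only [P, Finset.mem_filter, hA hjA, true_and, Finset.mem_erase, hj, and_true, ne_eq, hjv,
          not_false_eq_true]
      simp only [hjA, true_and, hjP]
      split_ifs <;> omega
    · simp [hjA, translate_of_notMem]

/-! ### The reduction theorem -/

theorem IsBadSet.cohomologyIso_erase (hJ : G.IsBadSet J) {v : V} (hv : v ∈ J)
    (hJ₀ : G.IsBadSet (J.erase v)) :
    CohomologyIso (G.weightOver k J) (G.weightOver k (J.erase v)) := by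
  refine CohomologyIso.of_lines v (fun x n => G.weightOver_congr k fun j hj => ?_)
    (hJ₀.weightOver_erase_le k) (fun x a b c hab hbc => hJ.weightOver_quasiconvex k hv hJ₀ x hab hbc)
    fun l I hvI => hJ.exists_level k hv hJ₀ l hvI
  rw [Function.update_of_ne (Finset.ne_of_mem_erase hj)]

theorem IsBadSet.cohomologyIso_union (hJ : G.IsBadSet J) (S : Finset V) :
    CohomologyIso (G.weightOver k (J ∪ S)) (G.weightOver k J) := by
  induction S using Finset.induction_on with
  | empty => rw [Finset.union_empty]; exact CohomologyIso.refl _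
  | insert v S _ ih =>
    by_cases hv : v ∈ J ∪ S
    · rwa [Finset.union_insert, Finset.insert_eq_of_mem hv]
    · have hbad := hJ.mono (J' := J ∪ S) Finset.subset_union_left
      have hbad' := hbad.mono (Finset.subset_insert v _)
      have := hbad'.cohomologyIso_erase k (Finset.mem_insert_self v _)
        (by rwa [Finset.erase_insert hv])
      rw [Finset.erase_insert hv] at this
      rw [Finset.union_insert]
      exact this.trans ih

/-- From a cycle that is not effective one can go up without increasing the weight. -/
theorem exists_slope_pos {z : V → ℤ} (hz : z ≤ 0) (hne : z ≠ 0) :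
    ∃ v, z v < 0 ∧ 1 ≤ G.slope k z v := by
  by_contra! h
  refine hne (le_antisymm hz (G.nonneg_of_slope_nonpos k fun v => ?_))
  rcases (hz v).lt_or_eq with h1 | h1
  · have := h v h1
    omega
  · exact (G.slope_mono k hz h1).trans (G.slope_zero_nonpos k v)

/-- The cycle `-∑_{s < t} E_{f s}`. -/
def descent (f : ℕ → V) (t : ℕ) : V → ℤ := -∑ s ∈ Finset.range t, Pi.single (f s) 1

theorem descent_succ (f : ℕ → V) (t : ℕ) : descent f (t + 1) = descent f t - Pi.single (f t) 1 := by
  rw [descent, descent, Finset.sum_range_succ, neg_add, sub_eq_add_neg]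

theorem descent_congr {f g : ℕ → V} {t : ℕ} (h : ∀ s < t, f s = g s) : descent f t = descent g t := by
  rw [descent, descent, Finset.sum_congr rfl fun s hs => by rw [h s (Finset.mem_range.mp hs)]]

/-- Starting from z, `exists_slope_pos` provides vertices to add until 0 is reached; f lists them in
reverse order. -/
theorem exists_descent : ∀ (n : ℕ) (z : V → ℤ), z ≤ 0 → (∑ v, -z v).toNat = n →
    ∃ (m : ℕ) (f : ℕ → V), descent f m = z ∧
      ∀ s < m, 1 ≤ G.slope k (descent f (s + 1)) (f s) := by
  intro n
  induction n using Nat.strong_induction_on with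
  | _ n ih =>
    intro z hz hn
    by_cases hne : z = 0
    · obtain ⟨r⟩ := G.isTree.connected.nonempty
      exact ⟨0, fun _ => r, by simp [descent, hne], by simp⟩
    · obtain ⟨v, hv, hs⟩ := exists_slope_pos k hz hne
      have hz' : z + Pi.single v 1 ≤ 0 := by
        intro u
        by_cases hu : u = v
        · subst hu; simp only [Pi.add_apply, Pi.single_eq_same, Pi.zero_apply]; omega
        · simpa [hu] using hz u
      have hsum : ∑ u, -(z + Pi.single v 1 : V → ℤ) u = ∑ u, -z u - 1 := by
        simp [Finset.sum_add_distrib]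
        ring
      have hpos : 0 ≤ ∑ u, -(z + Pi.single v 1 : V → ℤ) u :=
        Finset.sum_nonneg fun u _ => neg_nonneg.mpr (hz' u)
      obtain ⟨m, f, hf, hfs⟩ := ih _ (by omega) _ hz' rfl
      have hg : ∀ s < m, Function.update f m v s = f s := fun s hs =>
        Function.update_of_ne hs.ne _ _
      have hlast : descent (Function.update f m v) (m + 1) = z := by
        rw [descent_succ, descent_congr hg, hf, Function.update_self, add_sub_cancel_right]
      refine ⟨m + 1, Function.update f m v, hlast, fun s hsm => ?_⟩
      rcases Nat.lt_succ_iff_lt_or_eq.mp hsm with h | h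
      · rw [hg s h, descent_congr (g := f) fun t ht => hg t (by omega)]
        exact hfs s h
      · rw [h, hlast, Function.update_self]
        exact hs

theorem descent_add_mul (f : ℕ → V) (m q : ℕ) : ∀ r,
    descent (fun s => f (s % m)) (m * q + r) =
      (q : ℤ) • descent f m + descent (fun s => f (s % m)) r := by
  induction q with
  | zero => intro r; simp
  | succ q ih =>
    have hm : descent (fun s => f (s % m)) m = descent f m :=
      descent_congr fun s hs => by rw [Nat.mod_eq_of_lt hs]
    have hadd : ∀ r, descent (fun s => f (s % m)) (m + r) =
        descent f m + descent (fun s => f (s % m)) r := by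
      intro r
      rw [← hm]
      simp only [descent, Finset.sum_range_add, Nat.add_mod_left, neg_add]
    intro r
    rw [Nat.mul_succ, add_assoc, ih, hadd, Nat.cast_succ, add_smul, one_smul, add_assoc]

theorem inter_zsmul (a : ℤ) (l : V → ℤ) (v : V) : G.inter (a • l) v = a * G.inter l v := by
  simp [inter, Finset.mul_sum, mul_assoc]

/-- A slope that is positive at a member of the descending sequence remains positive at any larger
cycle with the same coefficient there, which is the condition on edges in
`CohomologyIso.of_quadrant`. -/
theorem cohomologyIso_quadrant :
    CohomologyIso (G.weight (G.distinguishedRep k)) (G.weightOver k Finset.univ) := by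
  obtain ⟨Z, hZ1, hZ2⟩ := G.exists_antiNef
  have hZ2' : ∀ v, G.inter Z v ≤ -1 := fun v => by
    have := hZ2 v
    rw [← cast_inter] at this
    exact_mod_cast this
  have hZneg : -Z ≤ 0 := fun v => by
    have := hZ1 v
    simp only [Pi.neg_apply, Pi.zero_apply]; omega
  obtain ⟨m, f, hf, hfs⟩ := exists_descent k _ (-Z) hZneg rfl
  obtain ⟨r₀⟩ := G.isTree.connected.nonempty
  have hm : 0 < m := by
    rcases Nat.eq_zero_or_pos m with h | h
    · subst h
      have h1 := congrFun hf r₀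
      have := hZ1 r₀
      simp only [descent, Finset.range_zero, Finset.sum_empty, neg_zero, Pi.zero_apply,
        Pi.neg_apply] at h1
      omega
    · exact h
  -- The descent to -Z is repeated periodically. Each period adds -(Z, E_v) ≥ 1 to every slope, so
  -- the slopes stay positive.
  let g : ℕ → V := fun s => f (s % m)
  have hg : ∀ q r, descent g (m * q + r) = (q : ℤ) • (-Z) + descent g r := fun q r => by
    rw [← hf]; exact descent_add_mul f m q r
  have hslope : ∀ t, 1 ≤ G.slope k (descent g (t + 1)) (g t) := by
    intro t
    have ht : t % m < m := Nat.mod_lt t hm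
    have e1 : t + 1 = m * (t / m) + (t % m + 1) := by
      have := Nat.div_add_mod t m
      omega
    have e2 : descent g (t % m + 1) = descent f (t % m + 1) :=
      descent_congr fun s hs => by
        simp only [g]; rw [Nat.mod_eq_of_lt (by omega)]
    rw [e1, hg, e2, add_comm, slope_add, inter_zsmul]
    have h1 := hfs _ ht
    have h2 : G.inter (-Z) (g t) = -G.inter Z (g t) := by
      rw [← neg_one_smul ℤ Z, inter_zsmul]; ring
    have h3 := hZ2' (g t)
    have h4 : 0 ≤ ((t / m : ℕ) : ℤ) * G.inter (-Z) (g t) :=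
      mul_nonneg (by positivity) (by omega)
    have h5 : G.slope k (descent f (t % m + 1)) (g t) =
      G.slope k (descent f (t % m + 1)) (f (t % m)) := rfl
    omega
  have htr : ∀ (x : V → ℤ) (v : V), translate x {v} = x + Pi.single v 1 := fun x v => by
    funext u
    by_cases hu : u = v
    · subst hu; simp [LatticeCohomology.translate]
    · simp [LatticeCohomology.translate, hu]
  have := CohomologyIso.of_quadrant (w := G.weight (G.distinguishedRep k)) (f := g)
    (y := descent g) (by simp [descent]) (fun t => by rw [htr, descent_succ, sub_add_cancel])
    (fun t x hx hxv => by
      rw [htr, weight_add_single]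
      have h1 := hslope t
      have h2 := G.slope_mono k hx hxv.symm
      omega)
    (fun x => by
      -- After that many periods the sequence is at -(∑ |x_v|) Z, which lies below x because Z has
      -- coefficients at least 1.
      refine ⟨m * (∑ v, (x v).natAbs), fun v => ?_⟩
      have h1 := hg (∑ v, (x v).natAbs) 0
      have h2 : descent g 0 = 0 := by simp [descent]
      rw [add_zero, h2, add_zero] at h1
      rw [h1, Pi.smul_apply, Pi.neg_apply, smul_eq_mul]
      have h3 : (x v).natAbs ≤ ∑ v, (x v).natAbs :=
        Finset.single_le_sum (f := fun v => (x v).natAbs) (fun _ _ => Nat.zero_le _)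
          (Finset.mem_univ v)
      have h4 := hZ1 v
      have h5 : ((∑ v, (x v).natAbs : ℕ) : ℤ) * 1 ≤ ((∑ v, (x v).natAbs : ℕ) : ℤ) * Z v :=
        mul_le_mul_of_nonneg_left h4 (by positivity)
      rw [mul_neg]
      change -(((∑ v, (x v).natAbs : ℕ) : ℤ) * Z v) ≤ x v
      omega)
  -- When every vertex is bad no condition on slopes remains, and the universal cycle is the
  -- positive part itself.
  have e : (fun x => G.weight (G.distinguishedRep k) (x ⊔ 0)) = G.weightOver k Finset.univ := by
    funext x
    rw [weightOver_eq]
    congr 1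
    funext v
    rw [cycleOver_apply _ _ _ _ (Finset.mem_univ v)]
    rfl
  rwa [e] at this

end PlumbingTree

theorem theorem3p3p2 {V : Type*} [Fintype V] [LinearOrder V] (G : PlumbingTree V)
    (k : G.charElements) (J : Finset V) (hJ : G.IsBadSet J) :
    ∃ e : ∀ q : ℕ, LatticeCohomology.Cohomology (G.weight (G.distinguishedRep k)) q ≃ₗ[Polynomial ℤ]
        LatticeCohomology.Cohomology (G.reducedWeight k J) q,
      ∀ (q : ℕ) (d : ℤ) (x : LatticeCohomology.Cohomology (G.weight (G.distinguishedRep k)) q),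
        e q x ∈ LatticeCohomology.cohomologyDegree (G.reducedWeight k J) q d ↔
          x ∈ LatticeCohomology.cohomologyDegree (G.weight (G.distinguishedRep k)) q d := by
  have h1 := PlumbingTree.cohomologyIso_quadrant k
  have h2 := hJ.cohomologyIso_union k Finset.univ
  rw [Finset.union_eq_right.mpr (Finset.subset_univ J)] at h2
  exact (h1.trans h2).trans (LatticeCohomology.CohomologyIso.of_subspace J fun _ => rfl)
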